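/- Let $\mathrm{Tower}(0,m)=m$ and $\mathrm{Tower}(k+1,m)=2^{\mathrm{Tower}(k,m)}$. Every ordinal $y$ can be written uniquely as $y=2^{\gamma_{n-1}}+\dots+2^{\gamma_0}$ with a finite strictly decreasing sequence of ordinals $\gamma_{n-1}>\dots>\gamma_0$; the set $\{\gamma_{n-1},\dots,\gamma_0\}$ is called the 2-development of $y$. Let $E$ be the binary relation on ordinals such that $(x,y)\in E$ if and only if $x=2^{\gamma}$ for some $\gamma$ in the 2-development of $y$. For an ordinal $\alpha$, let $\mathrm{FO}(2^{\alpha},+,E)$ be the first-order theory of the structure whose elements are the ordinals less than $2^{\alpha}$, with ordinal addition seen as the ternary relation $x+y=z$ and with the relation $E$. Formulas are built from the atomic formulas $x+y=z$ and $E(x,y)$, where $x,y,z$ are variables, by $\neg,\wedge,\vee,\rightarrow,\leftrightarrow$ and $\exists$ over individual variables. They are written in prefix notation as words over a finite alphabet, with variables indexed in binary; the length of a formula is the length of this word. For each $i<\omega$ there exists a constant $c_i$ such that, for $\alpha=\omega^i$, the theory $\mathrm{FO}(2^{\alpha},+,E)$ is decidable (by a Turing machine with finitely many stacks) in time $\mathcal{O}(\mathrm{Tower}(n,c_i))$,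 where $n$ is the length of the formula. -/

import Mathlib

namespace OrdinalFO

/-- The tower of exponentials: `tower 0 m = m` and `tower (k + 1) m = 2 ^ tower k m`. -/
def tower : ℕ → ℕ → ℕ
  | 0, m => m
  | k + 1, m => 2 ^ tower k m

/-- The finite list `[γ_{n-1}, …, γ_0]` is strictly decreasing and
`2 ^ γ_{n-1} + … + 2 ^ γ_0 = β`. -/
def IsTwoDevelopment (l : List Ordinal.{0}) (β : Ordinal.{0}) : Prop :=
  l.Pairwise (fun γ δ => δ < γ) ∧ (l.map (fun γ => (2 : Ordinal.{0}) ^ γ)).sum = β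

/-- The relation `E`: `x = 2 ^ γ` for some `γ` that belongs to the 2-development of `y`. -/
def RelE (x y : Ordinal.{0}) : Prop :=
  ∃ l : List Ordinal.{0}, IsTwoDevelopment l y ∧ ∃ γ ∈ l, x = 2 ^ γ

/-- First-order formulas over the signature `(+, E)`, where `+` is a ternary relation symbol and
`E` a binary one. The individual variables are indexed by `ℕ`. -/
inductive Formula : Type
  /-- `x + y = z` -/
  | add (x y z : ℕ) : Formula
  /-- `(x, y) ∈ E` -/
  | memE (x y : ℕ) : Formula
  | neg (φ : Formula) : Formula
  | conj (φ ψ : Formula) : Formula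
  | disj (φ ψ : Formula) : Formula
  | impl (φ ψ : Formula) : Formula
  | equi (φ ψ : Formula) : Formula
  /-- `∃ x, φ` -/
  | ex (x : ℕ) (φ : Formula) : Formula

namespace Formula

/-- The free variables of a formula. -/
def freeVars : Formula → Set ℕ
  | add x y z => {x, y, z}
  | memE x y => {x, y}
  | neg φ => φ.freeVars
  | conj φ ψ => φ.freeVars ∪ ψ.freeVars
  | disj φ ψ => φ.freeVars ∪ ψ.freeVars
  | impl φ ψ => φ.freeVars ∪ ψ.freeVars
  | equi φ ψ => φ.freeVars ∪ ψ.freeVars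
  | ex x φ => φ.freeVars \ {x}

/-- A sentence is a formula without free variables. -/
def IsSentence (φ : Formula) : Prop := φ.freeVars = ∅

/-- Satisfaction in the structure `(κ, +, E)`, whose elements are the ordinals less than `κ`. -/
def Sat (κ : Ordinal.{0}) : Formula → (ℕ → Set.Iio κ) → Prop
  | add x y z, v => (v x : Ordinal.{0}) + (v y : Ordinal.{0}) = (v z : Ordinal.{0})
  | memE x y, v => RelE (v x : Ordinal.{0}) (v y : Ordinal.{0})
  | neg φ, v => ¬ φ.Sat κ v
  | conj φ ψ, v => φ.Sat κ v ∧ ψ.Sat κ v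
  | disj φ ψ, v => φ.Sat κ v ∨ ψ.Sat κ v
  | impl φ ψ, v => φ.Sat κ v → ψ.Sat κ v
  | equi φ ψ, v => (φ.Sat κ v ↔ ψ.Sat κ v)
  | ex x φ, v => ∃ a : Set.Iio κ, φ.Sat κ (Function.update v x a)

end Formula

/-- The finite alphabet in which formulas are written. -/
inductive Symb : Type
  | var
  | bit (b : Bool)
  | add
  | memE
  | neg
  | conj
  | disj
  | impl
  | equi
  | ex

/-- A variable is written as the letter `var` followed by its index in binary (least significant
digit first, the index `0` being the empty word of digits). -/
def varWord (x : ℕ) : List Symb := Symb.var :: x.bits.map Symb.bit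

/-- A formula is written as a word in prefix notation, in which no parentheses are needed. The
length of a formula is the length of this word. -/
def Formula.word : Formula → List Symb
  | .add x y z => Symb.add :: (varWord x ++ varWord y ++ varWord z)
  | .memE x y => Symb.memE :: (varWord x ++ varWord y)
  | .neg φ => Symb.neg :: φ.word
  | .conj φ ψ => Symb.conj :: (φ.word ++ ψ.word)
  | .disj φ ψ => Symb.disj :: (φ.word ++ ψ.word)
  | .impl φ ψ => Symb.impl :: (φ.word ++ ψ.word)
  | .equi φ ψ => Symb.equi :: (φ.word ++ ψ.word)
  | .ex x φ => Symb.ex :: (varWord x ++ φ.word)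

/-- The first-order theory of `(κ, +, E)`: the set of the words of all sentences that are true in
this structure. -/
def theoryFO (κ : Ordinal.{0}) : Set (List Symb) :=
  {w | ∃ φ : Formula, φ.IsSentence ∧ (∀ v : ℕ → Set.Iio κ, φ.Sat κ v) ∧ φ.word = w}

/-- The set of words `L` is decidable in time `O(T)`: some Turing machine (with finitely many
stacks) computes the characteristic function of `L`, on every input word `w`, in at most `t |w|`
steps, where `t = O(T)`. -/
def DecidableInTimeO {Γ : Type} (L : Set (List Γ)) (T : ℕ → ℕ) : Prop :=
  ∃ f : List Γ → Bool, (∀ w, f w = true ↔ w ∈ L) ∧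
    ∃ M : Turing.TM2ComputableInTime (id : List Γ → List Γ) Computability.encodeBool f,
      (fun n => (M.time n : ℝ)) =O[Filter.atTop] (fun n => (T n : ℝ))

end OrdinalFO

/-! The ordinals are stratified by `radix j`, that is $2^{\omega^j}$. Since `radix (j + 1) = radix j
^ ω`, an ordinal below `radix (j + 1)` is a finite word of digits below `radix j`, and these digits
are themselves words of lower level, down to bits. Both relations can be computed from the last
digits and the remaining upper parts of their arguments (`relE_mul_add`, `add_mul_add`). Hence each
is recognized by a finite colouring in the sense of `IsColouring`, a kind of automaton on nested
words. Colourings are closed under products, which handles the binary connectives, and under passage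
to the power set, which handles quantifiers. So a formula of length $n$ needs at most Tower(n,5)
colours (`Formula.recognizable`).

A pumping argument (`exists_small_witness`) makes quantifiers finite: if the parameters have at most
`l` digits at every level and the formula has at most `K` colours, every witness has the same colour
as one with at most `l + K` digits at every level. So quantifiers may range over hereditarily short
words, coded by natural numbers below $2^{L^i}$, where `L = B * (N + 2)`, `B` bounds the numbers of
colours and `N` is at least the length of the word (`Formula.cSat_iff_oSat`).

Satisfaction with bounded quantifiers is decided by tabulating it over all assignments of codes,
subformula by subformula, while the word is parsed from right to left. For fixed `i` this is a
Kalmár elementary predicate of the number `N` coding the word and of `B` = Tower(n,5)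
(`ElemP.accepts_parser`). Elementary functions are computed by counter programs, and so by machines
with unary stacks, in time a tower of fixed height in the arguments. The total time is at most
Tower(l, Tower(n,5)) = Tower(n, Tower(l,5)) with `l` depending on `i` only, and Tower(l,5) is the
required constant. -/

namespace OrdinalFO
open Ordinal

/-! ### Digits of ordinals in the base $2^{\omega^j}$ -/

/-- The ordinal `2 ^ ω ^ j`. -/
noncomputable def radix (j : ℕ) : Ordinal.{0} := 2 ^ (ω ^ (j : Ordinal.{0}))

theorem one_lt_radix (j : ℕ) : 1 < radix j := by
  have h : (0 : Ordinal.{0}) < ω ^ (j : Ordinal.{0}) := opow_pos _ omega0_pos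
  have := (opow_lt_opow_iff_right (a := 2) one_lt_two).2 h
  simpa only [radix, opow_zero] using this

theorem radix_pos (j : ℕ) : 0 < radix j := zero_lt_one.trans (one_lt_radix j)

theorem radix_ne_zero (j : ℕ) : radix j ≠ 0 := (radix_pos j).ne'

theorem radix_zero : radix 0 = 2 := by simp [radix]

theorem radix_succ (j : ℕ) : radix (j + 1) = radix j ^ ω := by
  rw [radix, radix, ← opow_mul, ← opow_add_one]; simp

theorem radix_one : radix 1 = ω := by
  rw [radix_succ, radix_zero]
  exact_mod_cast natCast_opow_omega0 (n := 2) one_lt_two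

/-- From $\omega^{1+j} = \omega\cdot\omega^j$ and $2^\omega = \omega$ the ordinal is
$\omega^{\omega^j}$. Level 0 has to be excluded because `radix 0 = 2`; carries therefore occur only
between bits. -/
theorem isPrincipal_add_radix_succ (j : ℕ) : IsPrincipal (· + ·) (radix (j + 1)) := by
  have h : radix (j + 1) = ω ^ (ω ^ (j : Ordinal.{0})) := by
    rw [radix, show ((j + 1 : ℕ) : Ordinal.{0}) = 1 + j by rw [add_comm]; push_cast; rfl,
      opow_one_add, opow_mul]
    congr 1
    exact_mod_cast natCast_opow_omega0 (n := 2) one_lt_two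
  rw [h]
  exact isPrincipal_add_omega0_opow _

/-- The next radix is the supremum of the finite powers of this one, so only finitely many digits
occur and induction on their number is possible. -/
theorem exists_lt_radix_pow {j : ℕ} {y : Ordinal.{0}} (hy : y < radix (j + 1)) :
    ∃ n : ℕ, y < radix j ^ n := by
  rw [radix_succ, lt_opow_of_isSuccLimit (radix_ne_zero j) isSuccLimit_omega0] at hy
  obtain ⟨c, hc, h⟩ := hy
  obtain ⟨n, rfl⟩ := lt_omega0.1 hc
  exact ⟨n, by simpa [opow_natCast] using h⟩

theorem lt_radix_of_lt_pow {j n : ℕ} {y : Ordinal.{0}} (hy : y < radix j ^ n) :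
    y < radix (j + 1) := by
  rw [radix_succ]
  refine hy.trans_le ?_
  rw [← opow_natCast]
  exact opow_le_opow_right (radix_pos j) (natCast_lt_omega0 n).le

theorem mul_add_lt_radix {j : ℕ} {u a : Ordinal.{0}} (hu : u < radix (j + 1))
    (ha : a < radix j) : radix j * u + a < radix (j + 1) := by
  obtain ⟨n, hn⟩ := exists_lt_radix_pow hu
  refine lt_radix_of_lt_pow (n := n + 1) ?_
  rw [pow_succ']
  calc radix j * u + a < radix j * u + radix j := by gcongr
    _ = radix j * (u + 1) := by rw [mul_add, mul_one]
    _ ≤ _ := by gcongr; exact Order.add_one_le_of_lt hn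

theorem div_radix_lt {j : ℕ} {y : Ordinal.{0}} (hy : y < radix (j + 1)) :
    y / radix j < radix (j + 1) := by
  refine lt_of_le_of_lt ?_ hy
  refine div_le_of_le_mul ?_
  exact le_mul_right _ (radix_pos j)

theorem mod_radix_lt (j : ℕ) (y : Ordinal.{0}) : y % radix j < radix j :=
  mod_lt _ (radix_ne_zero j)

theorem div_mul_add {p u a : Ordinal.{0}} (ha : a < p) : (p * u + a) / p = u := by
  rw [mul_add_div _ (pos_of_gt ha).ne', div_eq_zero_of_lt ha, add_zero]

theorem mod_mul_add {p u a : Ordinal.{0}} (ha : a < p) : (p * u + a) % p = a := by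
  rw [mul_add_mod_self, mod_eq_of_lt ha]

theorem mul_add_inj {p u a u' a' : Ordinal.{0}} (ha : a < p) (ha' : a' < p) :
    p * u + a = p * u' + a' ↔ u = u' ∧ a = a' := by
  refine ⟨fun h => ⟨?_, ?_⟩, fun ⟨h, h'⟩ => by rw [h, h']⟩
  · rw [← div_mul_add (u := u) ha, h, div_mul_add ha']
  · rw [← mod_mul_add (u := u) ha, h, mod_mul_add ha']

/-! ### 2-developments -/

/-- The sum of the powers `2 ^ γ`. -/
noncomputable def powSum (l : List Ordinal.{0}) : Ordinal.{0} :=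
  (l.map (fun γ => (2 : Ordinal.{0}) ^ γ)).sum

@[simp] theorem powSum_nil : powSum [] = 0 := rfl

@[simp] theorem powSum_cons (γ : Ordinal.{0}) (l : List Ordinal.{0}) :
    powSum (γ :: l) = 2 ^ γ + powSum l := by simp [powSum]

theorem powSum_append (l l' : List Ordinal.{0}) :
    powSum (l ++ l') = powSum l + powSum l' := by simp [powSum]

/-- By induction the tail stays below the leading power, so the whole sum stays below twice that
power. -/
theorem powSum_lt {l : List Ordinal.{0}} (hl : l.Pairwise (fun γ δ => δ < γ)) {δ : Ordinal.{0}}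
    (h : ∀ γ ∈ l, γ < δ) : powSum l < 2 ^ δ := by
  induction l generalizing δ with
  | nil => simpa using opow_pos δ two_pos
  | cons γ l ih =>
    rw [List.pairwise_cons] at hl
    have h1 := ih hl.2 hl.1
    calc powSum (γ :: l) < 2 ^ γ + 2 ^ γ := by rw [powSum_cons]; gcongr
      _ = 2 ^ (γ + 1) := by rw [opow_add_one, ← one_add_one_eq_two, mul_add, mul_one]
      _ ≤ 2 ^ δ := opow_le_opow_right two_pos (Order.add_one_le_of_lt (h γ (by simp)))

theorem opow_le_powSum {l : List Ordinal.{0}} {γ : Ordinal.{0}} (h : γ ∈ l) :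
    2 ^ γ ≤ powSum l := by
  induction l with
  | nil => simp at h
  | cons δ l ih =>
    rw [powSum_cons]
    rcases List.mem_cons.1 h with rfl | h
    · exact le_add_of_nonneg_right zero_le
    · exact (ih h).trans (le_add_of_nonneg_left zero_le)

theorem powSum_map_add (δ : Ordinal.{0}) (l : List Ordinal.{0}) :
    powSum (l.map (δ + ·)) = 2 ^ δ * powSum l := by
  induction l with
  | nil => simp
  | cons γ l ih => simp [ih, mul_add, opow_add]

theorem exists_twoDevelopment (y : Ordinal.{0}) : ∃ l, IsTwoDevelopment l y := by
  induction y using WellFoundedLT.induction with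
  | ind y ih =>
    rcases eq_or_ne y 0 with rfl | hy
    · exact ⟨[], by simp [IsTwoDevelopment]⟩
    · have hlt : y % 2 ^ log 2 y < 2 ^ log 2 y := mod_lt _ (opow_pos _ two_pos).ne'
      obtain ⟨l, hl, hs⟩ := ih (y % 2 ^ log 2 y)
        (hlt.trans_le (opow_log_le_self _ hy))
      refine ⟨log 2 y :: l, ?_, ?_⟩
      · refine List.pairwise_cons.2 ⟨fun γ hγ => ?_, hl⟩
        have h1 : (2 : Ordinal.{0}) ^ γ < 2 ^ log 2 y :=
          ((opow_le_powSum hγ).trans hs.le).trans_lt hlt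
        exact (opow_lt_opow_iff_right one_lt_two).1 h1
      · simp only [List.map_cons, List.sum_cons, hs]
        exact two_opow_log_add hy

/-- In a decreasing list the exponents that are at least `δ` form a prefix. Cutting a development
there separates the upper part of the ordinal from its lower part. -/
theorem exists_split {l : List Ordinal.{0}} (hl : l.Pairwise (fun γ δ => δ < γ))
    (δ : Ordinal.{0}) : ∃ l₁ l₂ : List Ordinal.{0}, l = l₁.map (δ + ·) ++ l₂ ∧
      ∀ γ ∈ l₂, γ < δ := by
  induction l with
  | nil => exact ⟨[], [], by simp⟩
  | cons γ l ih =>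
    rw [List.pairwise_cons] at hl
    by_cases h : δ ≤ γ
    · obtain ⟨l₁, l₂, rfl, h2⟩ := ih hl.2
      exact ⟨(γ - δ) :: l₁, l₂, by simp [Ordinal.add_sub_cancel_of_le h], h2⟩
    · rw [not_le] at h
      refine ⟨[], γ :: l, by simp, fun ε hε => ?_⟩
      rcases List.mem_cons.1 hε with rfl | hε
      · exact h
      · exact (hl.1 ε hε).trans h

theorem relE_ne_zero {x y : Ordinal.{0}} (h : RelE x y) : x ≠ 0 := by
  obtain ⟨l, -, γ, -, rfl⟩ := h
  exact (opow_pos γ two_pos).ne'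

theorem not_relE_zero_left {y : Ordinal.{0}} : ¬ RelE 0 y := fun h => relE_ne_zero h rfl

theorem relE_zero_right {x : Ordinal.{0}} : ¬ RelE x 0 := by
  rintro ⟨l, ⟨-, hl⟩, γ, hγ, rfl⟩
  have h := opow_le_powSum hγ
  rw [powSum, hl] at h
  exact absurd h (opow_pos γ two_pos).not_ge

theorem relE_one : RelE 1 1 :=
  ⟨[0], by simp [IsTwoDevelopment], 0, by simp⟩

/-- Cut the development of the right-hand ordinal at the exponent `ω ^ j`. A power of two has a
single exponent, which lies on one side of the cut, so its other part vanishes. Conversely,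
developments of both parts are concatenated; only their existence matters, not their uniqueness. -/
theorem relE_mul_add (j : ℕ) {u a u' a' : Ordinal.{0}} (ha : a < radix j) (ha' : a' < radix j) :
    RelE (radix j * u + a) (radix j * u' + a') ↔ (u = 0 ∧ RelE a a') ∨ (a = 0 ∧ RelE u u') := by
  constructor
  · rintro ⟨l, ⟨hl, hs⟩, γ, hγ, hx⟩
    obtain ⟨l₁, l₂, rfl, h2⟩ := exists_split hl (ω ^ (j : Ordinal.{0}))
    rw [List.pairwise_append] at hl
    change powSum _ = _ at hs
    have hlt : powSum l₂ < radix j := powSum_lt hl.2.1 h2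
    rw [powSum_append, powSum_map_add] at hs
    obtain ⟨rfl, rfl⟩ := (mul_add_inj hlt ha').1 hs
    rcases List.mem_append.1 hγ with h | h
    · obtain ⟨γ', hγ', rfl⟩ := List.mem_map.1 h
      rw [opow_add] at hx
      have hx' : radix j * u + a = radix j * 2 ^ γ' + 0 := by rw [hx, add_zero, radix]
      obtain ⟨rfl, rfl⟩ := (mul_add_inj ha (radix_pos j)).1 hx'
      refine Or.inr ⟨rfl, l₁, ⟨?_, rfl⟩, γ', hγ', rfl⟩
      exact (List.pairwise_map.1 hl.1).imp (fun h => lt_of_add_lt_add_left h)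
    · have hlt' : (2 : Ordinal.{0}) ^ γ < radix j :=
        (opow_lt_opow_iff_right one_lt_two).2 (h2 γ h)
      have hx' : radix j * u + a = radix j * 0 + 2 ^ γ := by rw [hx, mul_zero, zero_add]
      obtain ⟨rfl, rfl⟩ := (mul_add_inj ha hlt').1 hx'
      exact Or.inl ⟨rfl, l₂, ⟨hl.2.1, rfl⟩, γ, h, rfl⟩
  · have key : ∀ l₁ l₂, IsTwoDevelopment l₁ u' → IsTwoDevelopment l₂ a' →
        IsTwoDevelopment (l₁.map (ω ^ (j : Ordinal.{0}) + ·) ++ l₂) (radix j * u' + a') := by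
      rintro l₁ l₂ ⟨h1, s1⟩ ⟨h2, s2⟩
      refine ⟨List.pairwise_append.2 ⟨List.pairwise_map.2 (h1.imp fun h => by gcongr), h2, ?_⟩, ?_⟩
      · intro γ hγ δ hδ
        obtain ⟨γ', -, rfl⟩ := List.mem_map.1 hγ
        have h3 : (2 : Ordinal.{0}) ^ δ < radix j :=
          ((opow_le_powSum hδ).trans s2.le).trans_lt ha'
        exact ((opow_lt_opow_iff_right one_lt_two).1 h3).trans_le (le_add_of_nonneg_right zero_le)
      · change powSum _ = _
        change powSum _ = _ at s1 s2
        rw [powSum_append, powSum_map_add, s1, s2, radix]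
    rintro (⟨rfl, l₂, h2, γ, hγ, rfl⟩ | ⟨rfl, l₁, h1, γ, hγ, rfl⟩)
    · obtain ⟨l₁, h1⟩ := exists_twoDevelopment u'
      exact ⟨_, key l₁ l₂ h1 h2, γ, by simp [hγ], by simp⟩
    · obtain ⟨l₂, h2⟩ := exists_twoDevelopment a'
      refine ⟨_, key l₁ l₂ h1 h2, ω ^ (j : Ordinal.{0}) + γ, by simp [hγ], ?_⟩
      rw [opow_add, add_zero, radix]

end OrdinalFO

namespace OrdinalFO
open Ordinal

/-! ### Towers -/

theorem tower_pos {m : ℕ} (hm : 0 < m) (k : ℕ) : 0 < tower k m := by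
  induction k with
  | zero => exact hm
  | succ k ih => exact Nat.two_pow_pos _

theorem tower_le_succ (k m : ℕ) : tower k m ≤ tower (k + 1) m := Nat.lt_two_pow_self.le

theorem tower_mono_left (m : ℕ) : Monotone fun k => tower k m :=
  monotone_nat_of_le_succ fun k => tower_le_succ k m

theorem tower_mono_right (k : ℕ) : Monotone (tower k) := by
  induction k with
  | zero => exact monotone_id
  | succ k ih => exact fun a b h => Nat.pow_le_pow_right two_pos (ih h)

theorem tower_add (k l m : ℕ) : tower (k + l) m = tower k (tower l m) := by
  induction k with
  | zero => simp [tower]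
  | succ k ih => rw [Nat.succ_add, tower, ih, tower]

theorem le_tower (k m : ℕ) : m ≤ tower k m := tower_mono_left m (Nat.zero_le k)

theorem sq_le_two_pow {n : ℕ} (h : 4 ≤ n) : n * n ≤ 2 ^ n := by
  induction n, h using Nat.le_induction with
  | base => norm_num
  | succ n h ih => rw [pow_succ]; nlinarith

/-- The product is at most the square of the tower of height `a + b`, hence at most one further
exponential. This pays for a binary connective: the extra level is the letter of the connective
itself. -/
theorem tower_mul_tower_le {a b m : ℕ} (hm : 4 ≤ m) :
    tower a m * tower b m ≤ tower (a + b + 1) m := by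
  have h1 : tower a m ≤ tower (a + b) m := tower_mono_left m (by omega)
  have h2 : tower b m ≤ tower (a + b) m := tower_mono_left m (by omega)
  exact (Nat.mul_le_mul h1 h2).trans (sq_le_two_pow (hm.trans (le_tower _ _)))

/-! ### Satisfaction over ordinals -/

/-- Satisfaction in `(2 ^ ω ^ i, +, E)`, for valuations in all ordinals. -/
def Formula.OSat (i : ℕ) : Formula → (ℕ → Ordinal.{0}) → Prop
  | add x y z, v => v x + v y = v z
  | memE x y, v => RelE (v x) (v y)
  | neg φ, v => ¬ φ.OSat i v
  | conj φ ψ, v => φ.OSat i v ∧ ψ.OSat i v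
  | disj φ ψ, v => φ.OSat i v ∨ ψ.OSat i v
  | impl φ ψ, v => φ.OSat i v → ψ.OSat i v
  | equi φ ψ, v => (φ.OSat i v ↔ ψ.OSat i v)
  | ex x φ, v => ∃ b < radix i, φ.OSat i (Function.update v x b)

theorem Formula.sat_iff_oSat (i : ℕ) (φ : Formula) (v : ℕ → Set.Iio (radix i)) :
    φ.Sat (radix i) v ↔ φ.OSat i (fun x => v x) := by
  induction φ generalizing v with
  | add x y z => rfl
  | memE x y => rfl
  | neg φ ih => simp [Sat, OSat, ih]
  | conj φ ψ ih ih' => simp [Sat, OSat, ih, ih']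
  | disj φ ψ ih ih' => simp [Sat, OSat, ih, ih']
  | impl φ ψ ih ih' => simp [Sat, OSat, ih, ih']
  | equi φ ψ ih ih' => simp [Sat, OSat, ih, ih']
  | ex x φ ih =>
    have key : ∀ b : Set.Iio (radix i), (fun y => ((Function.update v x b) y : Ordinal.{0})) =
        Function.update (fun y => (v y : Ordinal.{0})) x b := by
      intro b
      ext y
      by_cases h : y = x
      · subst h; simp
      · simp [h]
    simp only [Sat, OSat, ih, key]
    exact ⟨fun ⟨b, h⟩ => ⟨b, b.2, h⟩, fun ⟨b, hb, h⟩ => ⟨⟨b, hb⟩, h⟩⟩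

theorem Formula.sat_congr (κ : Ordinal.{0}) (φ : Formula) {v w : ℕ → Set.Iio κ}
    (h : ∀ x ∈ φ.freeVars, v x = w x) : φ.Sat κ v ↔ φ.Sat κ w := by
  induction φ generalizing v w with
  | add x y z =>
    simp only [freeVars, Set.mem_insert_iff, Set.mem_singleton_iff, forall_eq_or_imp,
      forall_eq] at h
    simp [Sat, h]
  | memE x y =>
    simp only [freeVars, Set.mem_insert_iff, Set.mem_singleton_iff, forall_eq_or_imp,
      forall_eq] at h
    simp [Sat, h]
  | neg φ ih => simp only [Sat, ih h]
  | conj φ ψ ih ih' =>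
    simp only [Sat, ih fun x hx => h x (Or.inl hx), ih' fun x hx => h x (Or.inr hx)]
  | disj φ ψ ih ih' =>
    simp only [Sat, ih fun x hx => h x (Or.inl hx), ih' fun x hx => h x (Or.inr hx)]
  | impl φ ψ ih ih' =>
    simp only [Sat, ih fun x hx => h x (Or.inl hx), ih' fun x hx => h x (Or.inr hx)]
  | equi φ ψ ih ih' =>
    simp only [Sat, ih fun x hx => h x (Or.inl hx), ih' fun x hx => h x (Or.inr hx)]
  | ex x φ ih =>
    refine exists_congr fun b => ih fun y hy => ?_
    by_cases hxy : y = x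
    · subst hxy; simp
    · simp [hxy, h y ⟨hy, hxy⟩]

/-! ### Finite colourings -/

/-- The colour of a valuation is determined by the colours of its lower and its upper part. -/
def IsColouring {Q : Type} (c : ℕ → (ℕ → Ordinal.{0}) → Q) : Prop :=
  ∀ (j : ℕ) (v v' : ℕ → Ordinal.{0}), (∀ x, v x < radix (j + 1)) → (∀ x, v' x < radix (j + 1)) →
    c j (fun x => v x % radix j) = c j (fun x => v' x % radix j) →
    c (j + 1) (fun x => v x / radix j) = c (j + 1) (fun x => v' x / radix j) →
    c (j + 1) v = c (j + 1) v'

/-- The colours at level `i` determine membership in `S`. -/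
def Recognizes {Q : Type} (c : ℕ → (ℕ → Ordinal.{0}) → Q) (i : ℕ)
    (S : (ℕ → Ordinal.{0}) → Prop) : Prop :=
  ∀ v v', (∀ x, v x < radix i) → (∀ x, v' x < radix i) → c i v = c i v' → (S v ↔ S v')

/-- `S` is recognized at level `i` by a colouring with at most `K` colours. -/
def Recognizable (i K : ℕ) (S : (ℕ → Ordinal.{0}) → Prop) : Prop :=
  ∃ (Q : Type) (_ : Finite Q) (c : ℕ → (ℕ → Ordinal.{0}) → Q),
    IsColouring c ∧ Recognizes c i S ∧ Nat.card Q ≤ K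

theorem Recognizable.mono {i K K' : ℕ} {S : (ℕ → Ordinal.{0}) → Prop} (h : Recognizable i K S)
    (hK : K ≤ K') : Recognizable i K' S := by
  obtain ⟨Q, hQ, c, h1, h2, h3⟩ := h
  exact ⟨Q, hQ, c, h1, h2, h3.trans hK⟩

theorem Recognizable.comp₂ {i K K' : ℕ} {S S' : (ℕ → Ordinal.{0}) → Prop}
    (h : Recognizable i K S) (h' : Recognizable i K' S') (f : Prop → Prop → Prop) :
    Recognizable i (K * K') fun v => f (S v) (S' v) := by
  obtain ⟨Q, hQ, c, h1, h2, h3⟩ := h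
  obtain ⟨Q', hQ', c', h1', h2', h3'⟩ := h'
  refine ⟨Q × Q', inferInstance, fun j v => (c j v, c' j v), ?_, ?_, ?_⟩
  · intro j v v' hv hv' e1 e2
    rw [Prod.mk.injEq] at e1 e2 ⊢
    exact ⟨h1 j v v' hv hv' e1.1 e2.1, h1' j v v' hv hv' e1.2 e2.2⟩
  · intro v v' hv hv' e
    rw [Prod.mk.injEq] at e
    dsimp only
    rw [propext (h2 v v' hv hv' e.1), propext (h2' v v' hv hv' e.2)]
  · rw [Nat.card_prod]
    exact Nat.mul_le_mul h3 h3'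

theorem Recognizable.not {i K : ℕ} {S : (ℕ → Ordinal.{0}) → Prop}
    (h : Recognizable i K S) : Recognizable i K fun v => ¬ S v := by
  obtain ⟨Q, hQ, c, h1, h2, h3⟩ := h
  exact ⟨Q, hQ, c, h1, fun v v' hv hv' e => not_congr (h2 v v' hv hv' e), h3⟩

theorem update_bounded {v : ℕ → Ordinal.{0}} {p b : Ordinal.{0}} (hv : ∀ y, v y < p) (hb : b < p)
    (x y : ℕ) : Function.update v x b y < p := by
  by_cases h : y = x
  · subst h; simpa
  · simpa [h] using hv y

theorem update_map (f : Ordinal.{0} → Ordinal.{0}) (v : ℕ → Ordinal.{0}) (x : ℕ) (b : Ordinal.{0}) :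
    (fun y => f (Function.update v x b y)) = Function.update (fun y => f (v y)) x (f b) := by
  ext y
  by_cases h : y = x
  · subst h; simp
  · simp [h]

/-- The power set construction: the new colour is the set of colours reached when the value of `x`
varies. It is again a colouring because a lower and an upper value of `x`, chosen independently, can
be glued to a single value. -/
theorem Recognizable.exists {i K : ℕ} {S : (ℕ → Ordinal.{0}) → Prop} (h : Recognizable i K S)
    (x : ℕ) : Recognizable i (2 ^ K) fun v => ∃ b < radix i, S (Function.update v x b) := by
  obtain ⟨Q, hQ, c, h1, h2, h3⟩ := h
  refine ⟨Set Q, inferInstance,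
    fun j v => {q | ∃ b < radix j, c j (Function.update v x b) = q}, ?_, ?_, ?_⟩
  · have key : ∀ (j : ℕ) (v v' : ℕ → Ordinal.{0}), (∀ x, v x < radix (j + 1)) →
        (∀ x, v' x < radix (j + 1)) →
        {q | ∃ b < radix j, c j (Function.update (fun y => v y % radix j) x b) = q} ⊆
          {q | ∃ b < radix j, c j (Function.update (fun y => v' y % radix j) x b) = q} →
        {q | ∃ b < radix (j + 1), c (j + 1) (Function.update (fun y => v y / radix j) x b) = q} ⊆
          {q | ∃ b < radix (j + 1),
            c (j + 1) (Function.update (fun y => v' y / radix j) x b) = q} →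
        {q | ∃ b < radix (j + 1), c (j + 1) (Function.update v x b) = q} ⊆
          {q | ∃ b < radix (j + 1), c (j + 1) (Function.update v' x b) = q} := by
      rintro j v v' hv hv' e1 e2 q ⟨b, hb, rfl⟩
      obtain ⟨a, ha, hea⟩ := e1 ⟨b % radix j, mod_radix_lt j b, rfl⟩
      obtain ⟨u, hu, heu⟩ := e2 ⟨b / radix j, div_radix_lt hb, rfl⟩
      have hb' := mul_add_lt_radix hu ha
      refine ⟨radix j * u + a, hb', ?_⟩
      refine h1 j _ _ (update_bounded hv' hb' x) (update_bounded hv hb x) ?_ ?_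
      · rw [update_map (· % radix j), update_map (· % radix j), mod_mul_add ha, hea]
      · rw [update_map (· / radix j), update_map (· / radix j), div_mul_add ha, heu]
    intro j v v' hv hv' e1 e2
    exact (key j v v' hv hv' e1.subset e2.subset).antisymm
      (key j v' v hv' hv e1.superset e2.superset)
  · have key : ∀ v v', (∀ x, v x < radix i) → (∀ x, v' x < radix i) →
        {q | ∃ b < radix i, c i (Function.update v x b) = q} ⊆
          {q | ∃ b < radix i, c i (Function.update v' x b) = q} →
        (∃ b < radix i, S (Function.update v x b)) →
        ∃ b < radix i, S (Function.update v' x b) := by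
      rintro v v' hv hv' e ⟨b, hb, hS⟩
      obtain ⟨b', hb', he⟩ := e ⟨b, hb, rfl⟩
      exact ⟨b', hb', (h2 _ _ (update_bounded hv' hb' x) (update_bounded hv hb x) he).2 hS⟩
    exact fun v v' hv hv' e => ⟨key v v' hv hv' e.subset, key v' v hv' hv e.superset⟩
  · have := Fintype.ofFinite Q
    have := Classical.decEq Q
    rw [Nat.card_eq_fintype_card, Fintype.card_set, ← Nat.card_eq_fintype_card]
    exact Nat.pow_le_pow_right two_pos h3

/-- The recursion `relE_mul_add` also asks whether a part of the left argument vanishes, so this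
truth value is tracked too. -/
theorem recognizable_relE (i x y : ℕ) : Recognizable i 4 fun v => RelE (v x) (v y) := by
  refine ⟨Prop × Prop, inferInstance, fun _ v => (v x = 0, RelE (v x) (v y)), ?_, ?_, ?_⟩
  · intro j v v' hv hv' e1 e2
    have key : ∀ v : ℕ → Ordinal.{0},
        (v x = 0 ↔ v x % radix j = 0 ∧ v x / radix j = 0) ∧ (RelE (v x) (v y) ↔
          (v x / radix j = 0 ∧ RelE (v x % radix j) (v y % radix j)) ∨
          (v x % radix j = 0 ∧ RelE (v x / radix j) (v y / radix j))) := by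
      intro v
      constructor
      · refine ⟨fun h => by simp [h], fun ⟨h, h'⟩ => ?_⟩
        rw [← div_add_mod (v x) (radix j), h, h', mul_zero, add_zero]
      · conv_lhs => rw [← div_add_mod (v x) (radix j), ← div_add_mod (v y) (radix j)]
        exact relE_mul_add j (mod_radix_lt j _) (mod_radix_lt j _)
    simp only [Prod.mk.injEq, eq_iff_iff] at e1 e2 ⊢
    rw [(key v).1, (key v').1, (key v).2, (key v').2]
    tauto
  · intro v v' _ _ e
    simp only [Prod.mk.injEq, eq_iff_iff] at e
    exact e.2
  · simp [Nat.card_eq_fintype_card]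

/-- Addition of upper and lower parts beyond the level of natural numbers. -/
theorem add_mul_add (j : ℕ) {u a u' a' w d : Ordinal.{0}} (ha : a < radix (j + 1))
    (ha' : a' < radix (j + 1)) (hd : d < radix (j + 1)) :
    (radix (j + 1) * u + a) + (radix (j + 1) * u' + a') = radix (j + 1) * w + d ↔
      (u' = 0 ∧ u = w ∧ a + a' = d) ∨ (u' ≠ 0 ∧ u + u' = w ∧ a' = d) := by
  by_cases h : u' = 0
  · subst h
    have hs : a + a' < radix (j + 1) := isPrincipal_add_radix_succ j ha ha'
    rw [mul_zero, zero_add, add_assoc, mul_add_inj hs hd]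
    simp
  -- A nonzero upper part of the right summand absorbs the lower part of the left one, by additive
  -- principality.
  · have hab : a + radix (j + 1) * u' = radix (j + 1) * u' :=
      (isPrincipal_add_radix_succ j).add_eq_right_of_le ha
        (le_mul_left _ (pos_iff_ne_zero.2 h))
    rw [add_assoc, ← add_assoc a, hab, ← add_assoc, ← mul_add, mul_add_inj ha' hd]
    simp [h]

/-- Five truth values suffice. The first three cover the case distinction of `add_mul_add` and, for
bits, determine the bits themselves. The last is addition with an incoming carry; the guard `j ≤ 1`
switches it off at the levels where no carries exist. -/
theorem recognizable_add (i x y z : ℕ) : Recognizable i 32 fun v => v x + v y = v z := by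
  refine ⟨Prop × Prop × Prop × Prop × Prop, inferInstance, fun j v =>
    (v x = v z, v y = 0, v y = v z, v x + v y = v z, j ≤ 1 ∧ v x + v y + 1 = v z), ?_, ?_, ?_⟩
  · intro j v v' hv hv' e1 e2
    simp only [Prod.mk.injEq, eq_iff_iff] at e1 e2 ⊢
    -- Passing from level 0 to level 1 is schoolbook binary addition: the colours of the last digits
    -- fix the bits, hence the carry. All higher levels use `add_mul_add`.
    rcases j with _ | j
    · have key : ∀ v : ℕ → Ordinal.{0}, (∀ x, v x < radix (0 + 1)) → ∃ f : ℕ → ℕ,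
          v = fun y => (f y : Ordinal.{0}) := by
        intro v hv
        choose f hf using fun x => lt_omega0.1 ((hv x).trans_eq radix_one)
        exact ⟨f, funext hf⟩
      obtain ⟨f, rfl⟩ := key v hv
      obtain ⟨g, rfl⟩ := key v' hv'
      simp only [radix_zero] at e1 e2
      beta_reduce
      norm_cast at e1 e2 ⊢
      have hf1 := Nat.mod_two_eq_zero_or_one (f x)
      have hf2 := Nat.mod_two_eq_zero_or_one (f y)
      have hf3 := Nat.mod_two_eq_zero_or_one (f z)
      have hg1 := Nat.mod_two_eq_zero_or_one (g x)
      have hg2 := Nat.mod_two_eq_zero_or_one (g y)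
      have hg3 := Nat.mod_two_eq_zero_or_one (g z)
      obtain ⟨a1, a2, a3, -, -⟩ := e1
      have hy : f y % 2 = g y % 2 := by omega
      have hz : f z % 2 = g z % 2 := by omega
      have hx : f x % 2 = g x % 2 := by omega
      obtain ⟨b1, b2, b3, b4, b5⟩ := e2
      refine ⟨?_, ?_, ?_, ?_, ?_⟩ <;> omega
    · have key : ∀ v : ℕ → Ordinal.{0},
          (v x = v z ↔ v x / radix (j + 1) = v z / radix (j + 1) ∧
            v x % radix (j + 1) = v z % radix (j + 1)) ∧
          (v y = 0 ↔ v y / radix (j + 1) = 0 ∧ v y % radix (j + 1) = 0) ∧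
          (v y = v z ↔ v y / radix (j + 1) = v z / radix (j + 1) ∧
            v y % radix (j + 1) = v z % radix (j + 1)) ∧
          (v x + v y = v z ↔ (v y / radix (j + 1) = 0 ∧ v x / radix (j + 1) = v z / radix (j + 1) ∧
              v x % radix (j + 1) + v y % radix (j + 1) = v z % radix (j + 1)) ∨
            (v y / radix (j + 1) ≠ 0 ∧
              v x / radix (j + 1) + v y / radix (j + 1) = v z / radix (j + 1) ∧
              v y % radix (j + 1) = v z % radix (j + 1))) := by
        intro v
        have h1 := mod_radix_lt (j + 1) (v x)
        have h2 := mod_radix_lt (j + 1) (v y)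
        have h3 := mod_radix_lt (j + 1) (v z)
        refine ⟨?_, ?_, ?_, ?_⟩
        · conv_lhs => rw [← div_add_mod (v x) (radix (j + 1)), ← div_add_mod (v z) (radix (j + 1))]
          exact mul_add_inj h1 h3
        · refine ⟨fun h => by simp [h], fun ⟨h, h'⟩ => ?_⟩
          rw [← div_add_mod (v y) (radix (j + 1)), h, h', mul_zero, add_zero]
        · conv_lhs => rw [← div_add_mod (v y) (radix (j + 1)), ← div_add_mod (v z) (radix (j + 1))]
          exact mul_add_inj h2 h3
        · conv_lhs => rw [← div_add_mod (v x) (radix (j + 1)), ← div_add_mod (v y) (radix (j + 1)),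
            ← div_add_mod (v z) (radix (j + 1))]
          exact add_mul_add j h1 h2 h3
      obtain ⟨k1, k2, k3, k4⟩ := key v
      obtain ⟨k1', k2', k3', k4'⟩ := key v'
      rw [k1, k2, k3, k4, k1', k2', k3', k4']
      obtain ⟨a1, a2, a3, a4, -⟩ := e1
      obtain ⟨b1, b2, b3, b4, -⟩ := e2
      rw [a1, a2, a3, a4, b1, ne_eq, b2, b3, b4]
      simp
  · intro v v' _ _ e
    simp only [Prod.mk.injEq, eq_iff_iff] at e
    exact e.2.2.2.1
  · simp [Nat.card_eq_fintype_card]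

/-- Each letter of the word pays for one exponential: a binary connective multiplies the numbers of
colours, a quantifier exponentiates. The base 5 is chosen so that the 32 colours of an addition atom
fit into a tower of height 1. -/
theorem Formula.recognizable (i : ℕ) (φ : Formula) :
    Recognizable i (tower φ.word.length 5) (φ.OSat i) := by
  have base : ∀ n m, n ≤ 32 → 0 < m → n ≤ tower m 5 := fun n m hn hm =>
    hn.trans (tower_mono_left 5 hm)
  have bin : ∀ (φ ψ : Formula) (f : Prop → Prop → Prop),
      Recognizable i (tower φ.word.length 5) (φ.OSat i) →
      Recognizable i (tower ψ.word.length 5) (ψ.OSat i) →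
      Recognizable i (tower (φ.word ++ ψ.word).length.succ 5)
        (fun v => f (φ.OSat i v) (ψ.OSat i v)) := fun φ ψ f h h' =>
    (h.comp₂ h' f).mono ((tower_mul_tower_le (by norm_num)).trans_eq (by simp))
  induction φ with
  | add x y z => exact (recognizable_add i x y z).mono (base _ _ le_rfl (by simp [word]))
  | memE x y => exact (recognizable_relE i x y).mono (base _ _ (by norm_num) (by simp [word]))
  | neg φ ih => exact ih.not.mono (tower_le_succ _ _)
  | conj φ ψ ih ih' => exact bin φ ψ _ ih ih'
  | disj φ ψ ih ih' => exact bin φ ψ _ ih ih'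
  | impl φ ψ ih ih' => exact bin φ ψ (fun a b => a → b) ih ih'
  | equi φ ψ ih ih' => exact bin φ ψ _ ih ih'
  | ex x φ ih =>
    refine (ih.exists x).mono ?_
    change tower (φ.word.length + 1) 5 ≤ _
    exact tower_mono_left 5 (by simp [word])

end OrdinalFO

namespace OrdinalFO
open Ordinal

/-! ### Coding ordinals by natural numbers -/

/-- The number of codes for ordinals below `radix j`, with `L` digits at every level. -/
def codeRadix (L j : ℕ) : ℕ := 2 ^ L ^ j

theorem one_lt_codeRadix {L : ℕ} (hL : 0 < L) (j : ℕ) : 1 < codeRadix L j :=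
  Nat.one_lt_two_pow (Nat.pow_pos hL).ne'

theorem codeRadix_pos (L j : ℕ) : 0 < codeRadix L j := Nat.two_pow_pos _

theorem codeRadix_succ (L j : ℕ) : codeRadix L (j + 1) = codeRadix L j ^ L := by
  rw [codeRadix, codeRadix, ← pow_mul, pow_succ]

theorem div_codeRadix_lt {L j a : ℕ} (hL : 0 < L) (ha : a ≠ 0) : a / codeRadix L j < a :=
  Nat.div_lt_self (Nat.pos_of_ne_zero ha) (one_lt_codeRadix hL j)

/-- The ordinal below `radix j` with code `a`. -/
noncomputable def decode (L : ℕ) : ℕ → ℕ → Ordinal.{0}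
  | 0, a => (a % 2 : ℕ)
  | j + 1, a =>
    if _ : a = 0 ∨ L = 0 then 0
    else radix j * decode L (j + 1) (a / codeRadix L j) + decode L j (a % codeRadix L j)
termination_by j a => (j, a)
decreasing_by
  · exact Prod.Lex.right _ (div_codeRadix_lt (by omega) (by omega))
  · exact Prod.Lex.left _ _ (Nat.lt_succ_self j)

variable {L : ℕ}

theorem decode_zero_right (j : ℕ) : decode L j 0 = 0 := by
  cases j <;> simp [decode]

theorem decode_succ (hL : 0 < L) (j a : ℕ) : decode L (j + 1) a =
    radix j * decode L (j + 1) (a / codeRadix L j) + decode L j (a % codeRadix L j) := by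
  by_cases h : a = 0
  · subst h; simp [decode_zero_right]
  · rw [decode]
    simp [h, hL.ne']

theorem decode_lt (hL : 0 < L) (j a : ℕ) : decode L j a < radix j := by
  induction j generalizing a with
  | zero =>
    rw [radix_zero, decode]
    exact_mod_cast Nat.mod_lt a two_pos
  | succ j ih =>
    induction a using Nat.strong_induction_on with
    | _ a iha =>
      rcases eq_or_ne a 0 with rfl | ha
      · rw [decode_zero_right]; exact radix_pos _
      · rw [decode_succ hL]
        exact mul_add_lt_radix (iha _ (div_codeRadix_lt hL ha)) (ih _)

theorem decode_div (hL : 0 < L) (j a : ℕ) :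
    decode L (j + 1) a / radix j = decode L (j + 1) (a / codeRadix L j) := by
  rw [decode_succ hL, div_mul_add (decode_lt hL _ _)]

theorem decode_mod (hL : 0 < L) (j a : ℕ) :
    decode L (j + 1) a % radix j = decode L j (a % codeRadix L j) := by
  rw [decode_succ hL, mod_mul_add (decode_lt hL _ _)]

/-- Remainder and quotient by `radix j` compare the lowest digits and the remaining ones. Induction
is on the sum of the codes, which drops unless both are zero. -/
theorem decode_succ_inj_of (hL : 0 < L) (j : ℕ)
    (ih : ∀ a b, a < codeRadix L j → b < codeRadix L j → decode L j a = decode L j b → a = b)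
    (n a b : ℕ) (hn : a + b = n) (h : decode L (j + 1) a = decode L (j + 1) b) : a = b := by
  induction n using Nat.strong_induction_on generalizing a b with
  | _ n ihn =>
    have h2 : a % codeRadix L j = b % codeRadix L j := by
      refine ih _ _ (Nat.mod_lt _ (codeRadix_pos L j)) (Nat.mod_lt _ (codeRadix_pos L j)) ?_
      rw [← decode_mod hL, h, decode_mod hL]
    have h1 : a / codeRadix L j = b / codeRadix L j := by
      by_cases h0 : a = 0 ∧ b = 0
      · rw [h0.1, h0.2]
      · refine ihn _ ?_ _ _ rfl (by rw [← decode_div hL, h, decode_div hL])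
        have ha := Nat.div_le_self a (codeRadix L j)
        have hb := Nat.div_le_self b (codeRadix L j)
        rcases eq_or_ne a 0 with rfl | h'
        · have := div_codeRadix_lt (a := b) (j := j) hL (by omega)
          omega
        · have := div_codeRadix_lt (j := j) hL h'
          omega
    rw [← Nat.div_add_mod a (codeRadix L j), h1, h2, Nat.div_add_mod]

theorem decode_inj (hL : 0 < L) (j : ℕ) {a b : ℕ} (ha : a < codeRadix L j)
    (hb : b < codeRadix L j) (h : decode L j a = decode L j b) : a = b := by
  induction j generalizing a b with
  | zero =>
    simp only [codeRadix, pow_zero, pow_one] at ha hb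
    simp only [decode, Nat.cast_inj] at h
    omega
  | succ j ih => exact decode_succ_inj_of hL j (fun _ _ h1 h2 h => ih h1 h2 h) _ _ _ rfl h

/-- In contrast to `decode_inj` no bound is needed: at a positive level every natural number is a
legitimate code, with as many digits as it has, whereas at level 0 only the last bit counts. -/
theorem decode_succ_inj (hL : 0 < L) (j : ℕ) {a b : ℕ} :
    decode L (j + 1) a = decode L (j + 1) b ↔ a = b :=
  ⟨decode_succ_inj_of hL j (fun _ _ h1 h2 h => decode_inj hL j h1 h2 h) _ _ _ rfl,
    fun h => by rw [h]⟩

/-! ### Boxes -/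

/-- The digits of the code `a` beyond the first `r` ones vanish, at all levels. -/
def InBox (L : ℕ) : ℕ → ℕ → ℕ → Prop
  | 0, _, a => a < 2
  | j + 1, r, a => a < codeRadix L j ^ r ∧
      ∀ k < r, InBox L j r (a / codeRadix L j ^ k % codeRadix L j)

/-- The code `a` consists of `n` digits which lie in the box of size `r`. -/
def DigitsInBox (L j r n a : ℕ) : Prop :=
  a < codeRadix L j ^ n ∧ ∀ k, InBox L j r (a / codeRadix L j ^ k % codeRadix L j)

theorem inBox_zero_right (j r : ℕ) : InBox L j r 0 := by
  induction j with
  | zero => simp [InBox]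
  | succ j ih => simp [InBox, ih, codeRadix_pos]

/-- All digits beyond the first `r` are zero, and zero lies in every box. Separating the number of
digits from the box of a single digit permits induction on the former with the latter fixed. -/
theorem inBox_succ (j r a : ℕ) : InBox L (j + 1) r a ↔ DigitsInBox L j r r a := by
  refine and_congr_right fun h => ⟨fun h' k => ?_, fun h' k _ => h' k⟩
  by_cases hk : k < r
  · exact h' k hk
  · rw [Nat.div_eq_of_lt (h.trans_le (Nat.pow_le_pow_right (codeRadix_pos L j) (by omega)))]
    exact inBox_zero_right _ _

theorem DigitsInBox.mono_length {j r n n' a : ℕ} (h : DigitsInBox L j r n a) (hn : n ≤ n') :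
    DigitsInBox L j r n' a :=
  ⟨h.1.trans_le (Nat.pow_le_pow_right (codeRadix_pos L j) hn), h.2⟩

theorem InBox.mono {j r r' a : ℕ} (h : InBox L j r a) (hr : r ≤ r') : InBox L j r' a := by
  induction j generalizing a with
  | zero => exact h
  | succ j ih =>
    rw [inBox_succ] at h ⊢
    exact DigitsInBox.mono_length ⟨h.1, fun k => ih (h.2 k)⟩ hr

theorem InBox.lt {j r a : ℕ} (h : InBox L j r a) (hr : r ≤ L) : a < codeRadix L j := by
  cases j with
  | zero => simpa [codeRadix, InBox, Nat.lt_succ_iff] using h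
  | succ j =>
    rw [codeRadix_succ]
    exact h.1.trans_le (Nat.pow_le_pow_right (codeRadix_pos L j) hr)

theorem digitsInBox_zero_right (j r n : ℕ) : DigitsInBox L j r n 0 := by
  simp [DigitsInBox, inBox_zero_right, codeRadix_pos]

theorem DigitsInBox.head {j r n a : ℕ} (h : DigitsInBox L j r n a) :
    InBox L j r (a % codeRadix L j) := by
  simpa using h.2 0

theorem DigitsInBox.tail {j r n a : ℕ} (h : DigitsInBox L j r (n + 1) a) :
    DigitsInBox L j r n (a / codeRadix L j) := by
  refine ⟨?_, fun k => ?_⟩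
  · rw [Nat.div_lt_iff_lt_mul (codeRadix_pos L j), ← pow_succ]
    exact h.1
  · rw [Nat.div_div_eq_div_mul, ← pow_succ']
    exact h.2 (k + 1)

theorem DigitsInBox.cons {j r n a a₀ : ℕ} (h : DigitsInBox L j r n a)
    (h₀ : InBox L j r a₀) (hlt : a₀ < codeRadix L j) :
    DigitsInBox L j r (n + 1) (codeRadix L j * a + a₀) := by
  refine ⟨?_, fun k => ?_⟩
  · rw [pow_succ']
    calc _ < codeRadix L j * a + codeRadix L j := by gcongr
      _ = codeRadix L j * (a + 1) := by ring
      _ ≤ _ := by gcongr; exact h.1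
  · cases k with
    | zero => simpa [Nat.mod_eq_of_lt hlt] using h₀
    | succ k =>
      rw [pow_succ', ← Nat.div_div_eq_div_mul, Nat.mul_add_div (codeRadix_pos L j),
        Nat.div_eq_of_lt hlt, add_zero]
      exact h.2 k

theorem decode_cons (hL : 0 < L) (j a : ℕ) {a₀ : ℕ} (hlt : a₀ < codeRadix L j) :
    decode L (j + 1) (codeRadix L j * a + a₀) = radix j * decode L (j + 1) a + decode L j a₀ := by
  rw [decode_succ hL, Nat.mul_add_div (codeRadix_pos L j), Nat.div_eq_of_lt hlt, add_zero,
    Nat.mul_add_mod, Nat.mod_eq_of_lt hlt]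

/-! ### Small witnesses -/

theorem IsColouring.congr_cons {Q : Type} {c : ℕ → (ℕ → Ordinal.{0}) → Q} (hc : IsColouring c)
    {j : ℕ} {v v' : ℕ → Ordinal.{0}} (hv : ∀ y, v y < radix (j + 1))
    (hv' : ∀ y, v' y < radix (j + 1)) (x : ℕ) {u a b : Ordinal.{0}} (hu : u < radix (j + 1))
    (ha : a < radix j) (hb : b < radix (j + 1))
    (h0 : c j (Function.update (fun y => v y % radix j) x a) =
      c j (Function.update (fun y => v' y % radix j) x (b % radix j)))
    (h1 : c (j + 1) (Function.update (fun y => v y / radix j) x u) =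
      c (j + 1) (Function.update (fun y => v' y / radix j) x (b / radix j))) :
    c (j + 1) (Function.update v x (radix j * u + a)) = c (j + 1) (Function.update v' x b) := by
  refine hc j _ _ (update_bounded hv (mul_add_lt_radix hu ha) x) (update_bounded hv' hb x) ?_ ?_
  · rw [update_map (· % radix j), update_map (· % radix j), mod_mul_add ha, h0]
  · rw [update_map (· / radix j), update_map (· / radix j), div_mul_add ha, h1]

/-- Induction on the level. Where the parameters may still have nonzero digits, each digit of `b` is
replaced by a small one of the same colour. After that all parameters are zero, and the rest of `b`
is replaced by at most `K` small digits through a pigeonhole argument on the set of reachable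
colours. -/
theorem exists_small_witness {Q : Type} [Finite Q] {c : ℕ → (ℕ → Ordinal.{0}) → Q}
    (hc : IsColouring c) {K l : ℕ} (hK : Nat.card Q ≤ K) (hL : 0 < L) (hlK : l + K ≤ L) (x : ℕ)
    (j : ℕ) {u : ℕ → ℕ} (hu : ∀ y, InBox L j l (u y)) {b : Ordinal.{0}} (hb : b < radix j) :
    ∃ a, InBox L j (l + K) a ∧
      c j (Function.update (fun y => decode L j (u y)) x (decode L j a)) =
        c j (Function.update (fun y => decode L j (u y)) x b) := by
  induction j generalizing u b with
  | zero =>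
    rw [radix_zero] at hb
    obtain ⟨n, rfl⟩ := lt_omega0.1 (hb.trans (natCast_lt_omega0 2))
    have hn : n < 2 := by exact_mod_cast hb
    exact ⟨n, hn, by simp [decode, Nat.mod_eq_of_lt hn]⟩
  | succ j ih =>
    set z : ℕ → Ordinal.{0} := fun _ => 0 with hz
    have z0 : (fun y => decode L j ((fun _ => 0) y)) = z := by simp [decode_zero_right, hz]
    have zd : (fun y => z y / radix j) = z := by simp [hz]
    have zm : (fun y => z y % radix j) = z := by simp [hz]
    have zlt : ∀ y, z y < radix (j + 1) := fun _ => radix_pos _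
    -- The colours reachable with `m` small digits while all parameters are zero. Prefixing a digit
    -- is a colour transition that does not depend on `m`, so the increasing chain `R` is constant
    -- as soon as it stops growing once.
    let R : ℕ → Set Q := fun m => {q | ∃ a, DigitsInBox L j (l + K) m a ∧
      c (j + 1) (Function.update z x (decode L (j + 1) a)) = q}
    have Rmono : Monotone R := fun m m' h q ⟨a, ha, hq⟩ => ⟨a, ha.mono_length h, hq⟩
    have Rstep : ∀ (m : ℕ) (b : Ordinal.{0}), b < radix (j + 1) →
        c (j + 1) (Function.update z x (b / radix j)) ∈ R m →
        c (j + 1) (Function.update z x b) ∈ R (m + 1) := by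
      rintro m b hb ⟨a, ha, hq⟩
      obtain ⟨a₀, ha₀, hq₀⟩ := ih (u := fun _ => 0) (fun _ => inBox_zero_right j l)
        (mod_radix_lt j b)
      rw [z0] at hq₀
      refine ⟨_, ha.cons ha₀ (ha₀.lt hlK), ?_⟩
      rw [decode_cons hL _ _ (ha₀.lt hlK)]
      refine hc.congr_cons zlt zlt x (decode_lt hL _ _) (decode_lt hL _ _) hb ?_ ?_
      · rw [zm, hq₀]
      · rw [zd, hq]
    have Rall : ∀ (m : ℕ) (b : Ordinal.{0}), b < radix j ^ m →
        c (j + 1) (Function.update z x b) ∈ R m := by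
      intro m
      induction m with
      | zero =>
        intro b hb
        rw [pow_zero, Order.lt_one_iff] at hb
        exact ⟨0, digitsInBox_zero_right _ _ _, by rw [decode_zero_right, hb]⟩
      | succ m ihm =>
        intro b hb
        refine Rstep m b (lt_radix_of_lt_pow hb) (ihm _ ?_)
        rw [← lt_mul_iff_div_lt (radix_ne_zero j), ← pow_succ']
        exact hb
    have Rfin : ∀ m, R m ⊆ R (Nat.card Q) := by
      intro m
      rcases le_total m (Nat.card Q) with h | h
      · exact Rmono h
      refine (Set.eq_of_subset_of_ncard_le (Rmono h) (le_of_eq ?_)).symm.subset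
      refine Nat.stabilises_of_monotone (f := fun m => (R m).ncard)
        (fun m m' h => Set.ncard_le_ncard (Rmono h)) (fun m => Set.ncard_le_card _) ?_ h
      intro m hm
      have h1 : R m = R (m + 1) := Set.eq_of_subset_of_ncard_le (Rmono m.le_succ) hm.ge
      -- Drop the lowest digit, replace the shortened code by one with `m` digits, and put a digit
      -- back.
      have h2 : R (m + 1) = R (m + 2) := by
        refine (Rmono (m + 1).le_succ).antisymm ?_
        rintro q ⟨a, ha, rfl⟩
        refine Rstep m _ (decode_lt hL _ _) ?_
        rw [decode_div hL, h1]
        exact ⟨_, ha.tail, rfl⟩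
      rw [h2]
    -- Here `n` bounds the number of digits of the parameters. It decreases as lowest digits are cut
    -- off, while the box of a single digit stays fixed.
    have main : ∀ (n : ℕ) (u : ℕ → ℕ), (∀ y, DigitsInBox L j l n (u y)) →
        ∀ b < radix (j + 1), ∃ a, DigitsInBox L j (l + K) (n + K) a ∧
          c (j + 1) (Function.update (fun y => decode L (j + 1) (u y)) x (decode L (j + 1) a)) =
            c (j + 1) (Function.update (fun y => decode L (j + 1) (u y)) x b) := by
      intro n
      induction n with
      | zero =>
        intro u hu b hb
        have hu0 : (fun y => decode L (j + 1) (u y)) = z := by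
          ext y
          have := (hu y).1
          rw [pow_zero, Nat.lt_one_iff] at this
          simp [this, decode_zero_right, hz]
        obtain ⟨m, hm⟩ := exists_lt_radix_pow hb
        obtain ⟨a, ha, hq⟩ := Rfin m (Rall m b hm)
        rw [hu0]
        exact ⟨a, ha.mono_length (by omega), hq⟩
      | succ n ihn =>
        intro u hu b hb
        obtain ⟨a, ha, hq⟩ := ihn _ (fun y => (hu y).tail) _ (div_radix_lt hb)
        obtain ⟨a₀, ha₀, hq₀⟩ := ih (fun y => (hu y).head) (mod_radix_lt j b)
        refine ⟨_, (ha.cons ha₀ (ha₀.lt hlK)).mono_length (by omega), ?_⟩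
        rw [decode_cons hL _ _ (ha₀.lt hlK)]
        refine hc.congr_cons (fun y => decode_lt hL _ _) (fun y => decode_lt hL _ _) x
          (decode_lt hL _ _) (decode_lt hL _ _) hb ?_ ?_
        · simp only [decode_mod hL]; exact hq₀
        · simp only [decode_div hL]; exact hq
    obtain ⟨a, ha, hq⟩ := main l u (fun y => (inBox_succ j l _).1 (hu y)) b hb
    exact ⟨a, (inBox_succ j _ _).2 ha, hq⟩

/-! ### The relations on codes -/

/-- The relation `E` on codes. -/
def CodeE (x y : ℕ) : Prop := ∃ p, x = 2 ^ p ∧ y.testBit p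

/-- The recursion of `relE_mul_add` for natural numbers, the lower part consisting of `s` bits. With
`s = L ^ j` the two recursions match, which proves `relE_decode`. -/
theorem codeE_split (s x y : ℕ) : CodeE x y ↔
    (x / 2 ^ s = 0 ∧ CodeE (x % 2 ^ s) (y % 2 ^ s)) ∨
      (x % 2 ^ s = 0 ∧ CodeE (x / 2 ^ s) (y / 2 ^ s)) := by
  constructor
  · rintro ⟨p, rfl, hp⟩
    rcases lt_or_ge p s with h | h
    · have h' : 2 ^ p < 2 ^ s := Nat.pow_lt_pow_right one_lt_two h
      exact Or.inl ⟨Nat.div_eq_of_lt h', p, Nat.mod_eq_of_lt h', by simp [h, hp]⟩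
    · have h' : 2 ^ p = 2 ^ s * 2 ^ (p - s) := by rw [← pow_add]; congr 1; omega
      refine Or.inr ⟨by rw [h']; simp, p - s, by rw [h']; simp, ?_⟩
      rw [Nat.testBit_div_two_pow, Nat.sub_add_cancel h, hp]
  · rintro (⟨h, p, hx, hp⟩ | ⟨h, p, hx, hp⟩)
    · refine ⟨p, ?_, ?_⟩
      · rw [← Nat.div_add_mod x (2 ^ s), h, hx]; simp
      · rw [Nat.testBit_mod_two_pow] at hp
        simp_all
    · refine ⟨p + s, ?_, ?_⟩
      · rw [← Nat.div_add_mod x (2 ^ s), h, hx]; simp [pow_add, mul_comm]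
      · rw [Nat.testBit_div_two_pow] at hp
        exact hp

theorem relE_decode (hL : 0 < L) (j : ℕ) {x y : ℕ} (hx : x < codeRadix L j)
    (hy : y < codeRadix L j) : RelE (decode L j x) (decode L j y) ↔ CodeE x y := by
  have hz : ∀ x, ¬ CodeE x 0 := by simp [CodeE]
  induction j generalizing x y with
  | zero =>
    simp only [codeRadix, pow_zero, pow_one] at hx hy
    interval_cases y
    · simp [hz, decode_zero_right, relE_zero_right]
    · interval_cases x
      · simp only [decode_zero_right, not_relE_zero_left, false_iff]
        rintro ⟨p, hp, -⟩
        exact (Nat.two_pow_pos p).ne hp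
      · simp only [decode, Nat.mod_eq_of_lt one_lt_two, Nat.cast_one, relE_one, true_iff]
        exact ⟨0, by simp⟩
  | succ j ih =>
    clear hx hy
    induction y using Nat.strong_induction_on generalizing x with
    | _ y ihy =>
      rcases eq_or_ne y 0 with rfl | hy
      · simp [hz, decode_zero_right, relE_zero_right]
      · have hm : ∀ a, a % codeRadix L j < codeRadix L j := fun a =>
          Nat.mod_lt _ (codeRadix_pos L j)
        have z1 : decode L (j + 1) (x / codeRadix L j) = 0 ↔ x / codeRadix L j = 0 := by
          rw [← decode_zero_right (L := L) (j + 1), decode_succ_inj hL]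
        have z0 : decode L j (x % codeRadix L j) = 0 ↔ x % codeRadix L j = 0 := by
          refine ⟨fun h => decode_inj hL j (hm _) (codeRadix_pos L j) ?_, fun h => ?_⟩
          · rw [h, decode_zero_right]
          · rw [h, decode_zero_right]
        have ihm := ih (hm x) (hm y)
        rw [decode_succ hL j x, decode_succ hL j y,
          relE_mul_add j (decode_lt hL _ _) (decode_lt hL _ _), z0, z1,
          codeE_split (L ^ j)]
        exact or_congr (and_congr_right' ihm) (and_congr_right' (ihy _ (div_codeRadix_lt hL hy)))

/-- Addition on codes. -/
def CodeAdd (L : ℕ) : ℕ → ℕ → ℕ → ℕ → Prop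
  | 0, x, y, z => x + y = z
  | 1, x, y, z => x + y = z
  | j + 2, x, y, z => ∃ b, y < codeRadix L (j + 1) ^ (b + 1) ∧
      (b = 0 ∨ codeRadix L (j + 1) ^ b ≤ y) ∧
      x / codeRadix L (j + 1) ^ (b + 1) = z / codeRadix L (j + 1) ^ (b + 1) ∧
      y % codeRadix L (j + 1) ^ b = z % codeRadix L (j + 1) ^ b ∧
      CodeAdd L (j + 1) (x / codeRadix L (j + 1) ^ b % codeRadix L (j + 1))
        (y / codeRadix L (j + 1) ^ b % codeRadix L (j + 1))
        (z / codeRadix L (j + 1) ^ b % codeRadix L (j + 1))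

theorem mod_mul_eq_iff {m n y z : ℕ} :
    y % (m * n) = z % (m * n) ↔ y % m = z % m ∧ y / m % n = z / m % n := by
  rcases Nat.eq_zero_or_pos m with rfl | hm
  · simp
  rw [Nat.mod_mul, Nat.mod_mul]
  constructor
  · intro h
    have h1 : y % m = z % m := by
      have := congrArg (· % m) h
      simpa using this
    rw [h1, Nat.add_left_cancel_iff] at h
    exact ⟨h1, Nat.eq_of_mul_eq_mul_left hm h⟩
  · rintro ⟨h1, h2⟩
    rw [h1, h2]

/-- In `CodeAdd` the number `b` is the position of the leading digit of `y`: above it the digits of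
`x` survive, at it the digits are added, below it those of `y` remain. For `b = 0` the summand `y`
is a single, possibly zero, digit; otherwise cutting off the lowest digit lowers `b` by one. This is
the recursion of `add_mul_add`. -/
theorem codeAdd_split (j x y z : ℕ) : CodeAdd L (j + 2) x y z ↔
    (y / codeRadix L (j + 1) = 0 ∧ x / codeRadix L (j + 1) = z / codeRadix L (j + 1) ∧
      CodeAdd L (j + 1) (x % codeRadix L (j + 1)) (y % codeRadix L (j + 1))
        (z % codeRadix L (j + 1))) ∨
    (y / codeRadix L (j + 1) ≠ 0 ∧ CodeAdd L (j + 2) (x / codeRadix L (j + 1))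
        (y / codeRadix L (j + 1)) (z / codeRadix L (j + 1)) ∧
      y % codeRadix L (j + 1) = z % codeRadix L (j + 1)) := by
  have hM := codeRadix_pos L (j + 1)
  rw [CodeAdd]
  conv_rhs => rw [CodeAdd]
  set M := codeRadix L (j + 1)
  have hdiv : y / M = 0 ↔ y < M := by rw [Nat.div_eq_zero_iff]; omega
  rw [ne_eq, hdiv]
  have e1 : ∀ (a b : ℕ), a / M ^ (b + 1) = a / M / M ^ b := fun a b => by
    rw [Nat.div_div_eq_div_mul, pow_succ']
  have e2 : ∀ b, y < M ^ (b + 1) ↔ y / M < M ^ b := fun b => by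
    rw [Nat.div_lt_iff_lt_mul hM, pow_succ]
  have e3 : ∀ b, M ^ (b + 1) ≤ y ↔ M ^ b ≤ y / M := fun b => by
    rw [Nat.le_div_iff_mul_le hM, pow_succ]
  have e4 : ∀ b, y % M ^ (b + 1) = z % M ^ (b + 1) ↔
      y % M = z % M ∧ y / M % M ^ b = z / M % M ^ b := fun b => by
    rw [pow_succ', mod_mul_eq_iff]
  constructor
  · rintro ⟨b, h1, h2, h3, h4, h5⟩
    rcases b with _ | b
    · refine Or.inl ⟨by simpa using h1, by simpa using h3, by simpa using h5⟩
    · have h2' := h2.resolve_left (by omega)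
      rw [e4] at h4
      simp only [e1] at h5 h3
      refine Or.inr ⟨?_, ⟨b, (e2 _).1 h1, Or.inr ((e3 _).1 h2'), ?_, h4.2, h5⟩, h4.1⟩
      · rw [not_lt]
        exact (Nat.le_self_pow (by omega) M).trans h2'
      · rw [e1, e1]; exact h3
  · rintro (⟨h1, h2, h3⟩ | ⟨h0, ⟨b, h1, h2, h3, h4, h5⟩, h6⟩)
    · exact ⟨0, by simpa using h1, Or.inl rfl, by simpa using h2, by simp [Nat.mod_one],
        by simpa using h3⟩
    · refine ⟨b + 1, (e2 _).2 h1, Or.inr ?_, ?_, (e4 _).2 ⟨h6, h4⟩, ?_⟩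
      · rcases h2 with rfl | h2
        · simpa using h0
        · exact (e3 _).2 h2
      · rw [e1 x, e1 z]; exact h3
      · simp only [e1]; exact h5

theorem decode_one (hL : 0 < L) (a : ℕ) : decode L 1 a = a := by
  induction a using Nat.strong_induction_on with
  | _ a ih =>
    rcases eq_or_ne a 0 with rfl | ha
    · simp [decode_zero_right]
    · rw [decode_succ hL, ih _ (div_codeRadix_lt hL ha), decode, radix_zero]
      simp only [codeRadix, pow_zero, pow_one, Nat.mod_mod]
      exact_mod_cast Nat.div_add_mod a 2

theorem add_decode (hL : 0 < L) (j : ℕ) {x y z : ℕ} (hx : x < codeRadix L j)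
    (hy : y < codeRadix L j) (hz : z < codeRadix L j) :
    decode L j x + decode L j y = decode L j z ↔ CodeAdd L j x y z := by
  cases j with
  | zero =>
    simp only [codeRadix, pow_zero, pow_one] at hx hy hz
    simp only [decode, CodeAdd, Nat.mod_eq_of_lt hx, Nat.mod_eq_of_lt hy, Nat.mod_eq_of_lt hz]
    norm_cast
  | succ j =>
    induction j generalizing x y z with
    | zero =>
      simp only [zero_add, decode_one hL, CodeAdd]
      norm_cast
    | succ j ih =>
      clear hx hy hz
      induction y using Nat.strong_induction_on generalizing x z with
      | _ y ihy =>
        have hm : ∀ a, a % codeRadix L (j + 1) < codeRadix L (j + 1) := fun a =>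
          Nat.mod_lt _ (codeRadix_pos L _)
        have z1 : decode L (j + 2) (y / codeRadix L (j + 1)) = 0 ↔ y / codeRadix L (j + 1) = 0 := by
          rw [← decode_zero_right (L := L) (j + 2), decode_succ_inj hL]
        have z0 : decode L (j + 1) (y % codeRadix L (j + 1)) =
            decode L (j + 1) (z % codeRadix L (j + 1)) ↔
            y % codeRadix L (j + 1) = z % codeRadix L (j + 1) := decode_succ_inj hL _
        rw [decode_succ hL _ x, decode_succ hL _ y, decode_succ hL _ z,
          add_mul_add j (decode_lt hL _ _) (decode_lt hL _ _) (decode_lt hL _ _), z1, ne_eq, z1, z0,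
          decode_succ_inj hL, ih (hm _) (hm _) (hm _), codeAdd_split]
        rcases eq_or_ne y 0 with rfl | hy
        · simp
        · rw [ihy _ (div_codeRadix_lt hL hy)]

end OrdinalFO

namespace OrdinalFO
open Ordinal

/-! ### Replacing quantifiers by bounded ones -/

/-- The size of the box for a quantifier that is followed by `s` letters. -/
def boxSize (B N s : ℕ) : ℕ := B * (N + 1 - s)

/-- Satisfaction on codes, for a formula whose word is followed by `t` letters. -/
def Formula.CSat (i L B N : ℕ) : ℕ → Formula → (ℕ → ℕ) → Prop
  | _, add x y z, u => CodeAdd L i (u x) (u y) (u z)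
  | _, memE x y, u => CodeE (u x) (u y)
  | t, neg φ, u => ¬ CSat i L B N t φ u
  | t, conj φ ψ, u => CSat i L B N (t + ψ.word.length) φ u ∧ CSat i L B N t ψ u
  | t, disj φ ψ, u => CSat i L B N (t + ψ.word.length) φ u ∨ CSat i L B N t ψ u
  | t, impl φ ψ, u => CSat i L B N (t + ψ.word.length) φ u → CSat i L B N t ψ u
  | t, equi φ ψ, u => (CSat i L B N (t + ψ.word.length) φ u ↔ CSat i L B N t ψ u)
  | t, ex x φ, u => ∃ a, InBox L i (boxSize B N (t + φ.word.length + (varWord x).length)) a ∧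
      CSat i L B N t φ (Function.update u x a)

theorem update_inBox {L i r : ℕ} {u : ℕ → ℕ} (hu : ∀ y, InBox L i r (u y)) {a : ℕ}
    (ha : InBox L i r a) (x y : ℕ) : InBox L i r (Function.update u x a y) := by
  by_cases h : y = x
  · subst h; simpa
  · simpa [h] using hu y

theorem decode_update (L i : ℕ) (u : ℕ → ℕ) (x a : ℕ) :
    (fun y => decode L i (Function.update u x a y)) =
      Function.update (fun y => decode L i (u y)) x (decode L i a) := by
  ext y
  by_cases h : y = x
  · subst h; simp
  · simp [h]

/-- Going inwards, the box grows by `B` with each letter, and `B` bounds the number of colours of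
every subformula, so `exists_small_witness` applies at each quantifier. The size depends on the
number of letters that follow because a parser working from right to left knows just this number. -/
theorem Formula.cSat_iff_oSat {i L B N : ℕ} (hB : 0 < B) (hL : L = B * (N + 2)) (φ : Formula)
    (t : ℕ) (ht : t + φ.word.length ≤ N) (hφ : tower φ.word.length 5 ≤ B) {u : ℕ → ℕ}
    (hu : ∀ y, InBox L i (boxSize B N (t + φ.word.length)) (u y)) :
    φ.CSat i L B N t u ↔ φ.OSat i (fun y => decode L i (u y)) := by
  have hL0 : 0 < L := by rw [hL]; positivity
  have hbox : ∀ s, boxSize B N s ≤ L := fun s => by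
    rw [hL]; exact Nat.mul_le_mul_left _ (by omega)
  have hmono : ∀ s s', s ≤ s' → boxSize B N s' ≤ boxSize B N s := fun s s' h =>
    Nat.mul_le_mul_left _ (by omega)
  induction φ generalizing t u with
  | add x y z =>
    exact (add_decode hL0 i ((hu x).lt (hbox _)) ((hu y).lt (hbox _)) ((hu z).lt (hbox _))).symm
  | memE x y => exact (relE_decode hL0 i ((hu x).lt (hbox _)) ((hu y).lt (hbox _))).symm
  | neg φ ih =>
    simp only [word, List.length_cons] at ht hφ hu
    exact not_congr (ih t (by omega) ((tower_le_succ _ _).trans hφ)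
      fun y => (hu y).mono (hmono _ _ (by omega)))
  | conj φ ψ ih ih' | disj φ ψ ih ih' | impl φ ψ ih ih' | equi φ ψ ih ih' =>
    simp only [word, List.length_cons, List.length_append] at ht hφ hu
    have h1 := ih (u := u) (t + ψ.word.length) (by omega)
      ((tower_mono_left 5 (by omega)).trans hφ) fun y => (hu y).mono (hmono _ _ (by omega))
    have h2 := ih' (u := u) t (by omega)
      ((tower_mono_left 5 (by omega)).trans hφ) fun y => (hu y).mono (hmono _ _ (by omega))
    simp only [CSat, OSat, h1, h2]
  | ex x φ ih =>
    simp only [word, List.length_cons, List.length_append] at ht hφ hu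
    set s := t + φ.word.length + (varWord x).length with hs
    have hs1 : t + ((varWord x).length + φ.word.length + 1) = s + 1 := by omega
    rw [hs1] at ht hu
    have hφ' : tower φ.word.length 5 ≤ B := (tower_mono_left 5 (by omega)).trans hφ
    -- The letter of the quantifier itself provides the enlargement by `B`; truncated subtraction
    -- does no harm since `s + 1 ≤ N`.
    have hr : boxSize B N (s + 1) + B = boxSize B N s := by
      rw [boxSize, boxSize, show N + 1 - s = (N + 1 - (s + 1)) + 1 by omega, mul_add, mul_one]
    have hsub : ∀ a, InBox L i (boxSize B N s) a →
        (CSat i L B N t φ (Function.update u x a) ↔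
          OSat i φ (Function.update (fun y => decode L i (u y)) x (decode L i a))) := by
      intro a ha
      rw [← decode_update]
      refine ih t (by omega) hφ' fun y => (update_inBox (fun y => ?_) ha x y).mono
        (hmono _ _ (by omega))
      exact (hu y).mono (hmono _ _ (by omega))
    constructor
    · rintro ⟨a, ha, h⟩
      exact ⟨decode L i a, decode_lt hL0 _ _, (hsub a ha).1 h⟩
    · rintro ⟨b, hb, h⟩
      obtain ⟨Q, hQ, c, h1, h2, h3⟩ := φ.recognizable i
      obtain ⟨a, ha, hq⟩ := exists_small_witness h1 (h3.trans hφ') hL0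
        (hr.trans_le (hbox s)) x i hu hb
      rw [hr] at ha
      refine ⟨a, ha, (hsub a ha).2 ((h2 _ _ ?_ ?_ hq).2 h)⟩
      · exact update_bounded (fun y => decode_lt hL0 _ _) (decode_lt hL0 _ _) x
      · exact update_bounded (fun y => decode_lt hL0 _ _) hb x

theorem Formula.sat_iff_cSat {i L B N : ℕ} (hB : 0 < B) (hL : L = B * (N + 2)) {φ : Formula}
    (ht : φ.word.length ≤ N) (hφ : tower φ.word.length 5 ≤ B) (hs : φ.IsSentence) :
    (∀ v, φ.Sat (radix i) v) ↔ φ.CSat i L B N 0 fun _ => 0 := by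
  rw [cSat_iff_oSat hB hL φ 0 (by omega) hφ fun y => inBox_zero_right _ _]
  simp only [decode_zero_right]
  refine Iff.trans ?_ (sat_iff_oSat i φ fun _ => ⟨0, radix_pos i⟩)
  refine ⟨fun h => h _, fun h v => (φ.sat_congr _ fun x hx => ?_).1 h⟩
  rw [hs] at hx
  exact hx.elim

end OrdinalFO

namespace OrdinalFO
open Turing

/-! ### A structured language for machines with unary stacks -/

/-- Programs for a machine with counters and an input stack. -/
inductive Cmd : Type
  | skip : Cmd
  | inc (r : ℕ) : Cmd
  | seq (a b : Cmd) : Cmd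
  /-- `while r > 0 do (decrement r; b)` -/
  | loop (r : ℕ) (b : Cmd) : Cmd
  /-- While the input is not empty, pop a letter `a` and run `b a`. -/
  | read (b : Symb → Cmd) : Cmd

namespace Cmd

/-- `Run c w s w' s' t`: from the input `w` and the store `s`, the program `c` reaches the input
`w'` and the store `s'` in `t` steps. -/
inductive Run : Cmd → List Symb → (ℕ → ℕ) → List Symb → (ℕ → ℕ) → ℕ → Prop
  | skip {w s} : Run skip w s w s 1
  | inc {r w s} : Run (inc r) w s w (Function.update s r (s r + 1)) 1
  | seq {a b w s w' s' w'' s'' t t'} : Run a w s w' s' t → Run b w' s' w'' s'' t' →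
      Run (seq a b) w s w'' s'' (t + t')
  | loop_zero {r b w s} : s r = 0 → Run (loop r b) w s w s 1
  | loop_succ {r b w s w' s' w'' s'' t t' n} : s r = n + 1 →
      Run b w (Function.update s r n) w' s' t → Run (loop r b) w' s' w'' s'' t' →
      Run (loop r b) w s w'' s'' (1 + t + t')
  | read_nil {b s} : Run (read b) [] s [] s 1
  | read_cons {b : Symb → Cmd} {a w s w' s' w'' s'' t t'} :
      Run (b a) w s w' s' t → Run (read b) w' s' w'' s'' t' →
      Run (read b) (a :: w) s w'' s'' (1 + t + t')

/-- All counters of the program are below `R`. -/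
def Bounded (R : ℕ) : Cmd → Prop
  | skip => True
  | inc r => r < R
  | seq a b => a.Bounded R ∧ b.Bounded R
  | loop r b => r < R ∧ b.Bounded R
  | read b => ∀ a, (b a).Bounded R

theorem Bounded.mono {R R' : ℕ} (h : R ≤ R') {c : Cmd} (hc : c.Bounded R) : c.Bounded R' := by
  induction c with
  | skip => trivial
  | inc r => exact lt_of_lt_of_le hc h
  | seq a b iha ihb => exact ⟨iha hc.1, ihb hc.2⟩
  | loop r b ih => exact ⟨hc.1.trans_le h, ih hc.2⟩
  | read b ih => exact fun a => ih a (hc a)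

end Cmd

/-- The digit that stands for a letter. -/
def Symb.digit : Symb → ℕ
  | var => 1
  | bit false => 2
  | bit true => 3
  | add => 4
  | memE => 5
  | neg => 6
  | conj => 7
  | disj => 8
  | impl => 9
  | equi => 10
  | ex => 11

theorem Symb.digit_lt (a : Symb) : a.digit < 12 := by
  rcases a with _ | (_ | _) | _ | _ | _ | _ | _ | _ | _ | _ <;> simp [digit]

theorem Symb.digit_injective : Function.Injective Symb.digit := by
  intro a b
  rcases a with _ | (_ | _) | _ | _ | _ | _ | _ | _ | _ | _ <;>
    rcases b with _ | (_ | _) | _ | _ | _ | _ | _ | _ | _ | _ <;> simp [digit]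

noncomputable instance : Fintype Symb :=
  Fintype.ofInjective (fun a => (⟨a.digit, a.digit_lt⟩ : Fin 12)) fun _ _ h =>
    Symb.digit_injective (congrArg Fin.val h)

namespace Cmd

theorem exists_bounded (c : Cmd) : ∃ R, c.Bounded R := by
  induction c with
  | skip => exact ⟨0, trivial⟩
  | inc r => exact ⟨r + 1, Nat.lt_succ_self r⟩
  | seq a b iha ihb =>
    obtain ⟨R, hR⟩ := iha
    obtain ⟨R', hR'⟩ := ihb
    exact ⟨max R R', hR.mono (le_max_left _ _), hR'.mono (le_max_right _ _)⟩
  | loop r b ih =>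
    obtain ⟨R, hR⟩ := ih
    exact ⟨max R (r + 1), (Nat.lt_succ_self r).trans_le (le_max_right _ _),
      hR.mono (le_max_left _ _)⟩
  | read b ih =>
    choose R hR using ih
    exact ⟨Finset.univ.sup R, fun a => (hR a).mono (Finset.le_sup (Finset.mem_univ a))⟩

/-! ### Translation to Turing machines -/

/-- The stacks: input, output, and `R + 1` counters. -/
abbrev Stack (R : ℕ) : Type := Bool ⊕ Fin (R + 1)

/-- The stack alphabets. -/
abbrev Alph (R : ℕ) : Stack R → Type
  | Sum.inl false => Symb
  | Sum.inl true => Bool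
  | Sum.inr _ => Unit

/-- The labels of a program. -/
def Lab : Cmd → Type
  | skip => Unit
  | inc _ => Unit
  | seq a b => a.Lab ⊕ b.Lab
  | loop _ b => Option b.Lab
  | read b => Option (Σ a, (b a).Lab)

theorem finite_lab (c : Cmd) : Finite c.Lab := by
  induction c with
  | skip => exact inferInstanceAs (Finite Unit)
  | inc r => exact inferInstanceAs (Finite Unit)
  | seq a b iha ihb => exact inferInstanceAs (Finite (a.Lab ⊕ b.Lab))
  | loop r b ih => exact inferInstanceAs (Finite (Option b.Lab))
  | read b ih => exact inferInstanceAs (Finite (Option (Σ a, (b a).Lab)))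

/-- The first label of a program. -/
def entry : (c : Cmd) → c.Lab
  | skip => ()
  | inc _ => ()
  | seq a _ => Sum.inl a.entry
  | loop _ b => (none : Option b.Lab)
  | read b => (none : Option (Σ a, (b a).Lab))

/-- The statements of a program, with labels renamed by `emb`, that leaves to `exit`. -/
def code {Λ : Type} (R : ℕ) : (c : Cmd) → (c.Lab → Λ) → Λ → c.Lab →
    TM2.Stmt (Alph R) Λ (Option Symb)
  | skip, _, exit, _ => TM2.Stmt.goto fun _ => exit
  | inc r, _, exit, _ =>
    TM2.Stmt.push (Sum.inr (Fin.ofNat (R + 1) r)) (fun _ => ()) (TM2.Stmt.goto fun _ => exit)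
  | seq a b, emb, exit, l =>
    Sum.elim (code R a (fun l => emb (Sum.inl l)) (emb (Sum.inr b.entry)))
      (code R b (fun l => emb (Sum.inr l)) exit) l
  | loop r b, emb, exit, l =>
    Option.elim (α := b.Lab) l
      -- The letter `Symb.var` is only a marker recording that the counter was not empty.
      (TM2.Stmt.pop (Sum.inr (Fin.ofNat (R + 1) r)) (fun _ o => o.map fun _ => Symb.var)
        (TM2.Stmt.goto fun o => if o.isSome then emb (some b.entry : Option b.Lab) else exit))
      (code R b (fun l => emb (some l : Option b.Lab)) (emb (none : Option b.Lab)))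
  | read b, emb, exit, l =>
    Option.elim (α := Σ a, (b a).Lab) l
      (TM2.Stmt.pop (Sum.inl false) (fun _ o => o)
        (TM2.Stmt.goto fun o => Option.elim o exit
          fun a => emb (some ⟨a, (b a).entry⟩ : Option (Σ a, (b a).Lab))))
      fun l => code R (b l.1) (fun l' => emb (some ⟨l.1, l'⟩ : Option (Σ a, (b a).Lab)))
        (emb (none : Option (Σ a, (b a).Lab))) l.2

/-- The stacks that represent an input and a store. -/
def stackOf (R : ℕ) (w : List Symb) (s : ℕ → ℕ) : ∀ k, List (Alph R k)
  | Sum.inl false => w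
  | Sum.inl true => []
  | Sum.inr r => List.replicate (s r) ()

theorem update_stackOf {R r : ℕ} (hr : r < R + 1) (w : List Symb) (s : ℕ → ℕ) (n : ℕ) :
    Function.update (stackOf R w s) (Sum.inr (Fin.ofNat (R + 1) r)) (List.replicate n ()) =
      stackOf R w (Function.update s r n) := by
  funext k
  rcases k with (_ | _) | k
  · simp [stackOf]
  · simp [stackOf]
  · by_cases h : k = Fin.ofNat (R + 1) r
    · subst h
      simp [stackOf, Nat.mod_eq_of_lt hr]
    · have h' : (k : ℕ) ≠ r := by
        rintro rfl
        exact h (by simp)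
      rw [Function.update_of_ne (by simpa using h)]
      simp [stackOf, Function.update_of_ne h']

theorem stackOf_inr {R r : ℕ} (hr : r < R + 1) (w : List Symb) (s : ℕ → ℕ) :
    stackOf R w s (Sum.inr (Fin.ofNat (R + 1) r)) = List.replicate (s r) () := by
  simp [stackOf, Nat.mod_eq_of_lt hr]

/-- `f` leads from `a` to `b` in `t` steps. -/
def StepsTo {C : Type} (f : C → Option C) (t : ℕ) (a b : C) : Prop :=
  (flip bind f)^[t] (some a) = some b

theorem StepsTo.trans {C : Type} {f : C → Option C} {t t' : ℕ} {a b c : C}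
    (h : StepsTo f t a b) (h' : StepsTo f t' b c) : StepsTo f (t + t') a c := by
  rw [StepsTo, add_comm, Function.iterate_add_apply, h, h']

theorem StepsTo.one {C : Type} {f : C → Option C} {a b : C} (h : f a = some b) :
    StepsTo f 1 a b := by
  simpa [StepsTo, flip] using h

theorem code_loop_entry {Λ : Type} (R r : ℕ) (b : Cmd) (emb : (loop r b).Lab → Λ) (exit : Λ) :
    code R (loop r b) emb exit (loop r b).entry =
      (TM2.Stmt.pop (Sum.inr (Fin.ofNat (R + 1) r)) (fun _ o => o.map fun _ => Symb.var)
        (TM2.Stmt.goto fun o => if o.isSome then emb (some b.entry : Option b.Lab) else exit)) :=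
  rfl

theorem code_read_entry {Λ : Type} (R : ℕ) (b : Symb → Cmd) (emb : (read b).Lab → Λ) (exit : Λ) :
    code R (read b) emb exit (read b).entry =
      (TM2.Stmt.pop (Sum.inl false) (fun _ o => o)
        (TM2.Stmt.goto fun o => Option.elim o exit
          fun a => emb (some ⟨a, (b a).entry⟩ : Option (Σ a, (b a).Lab)))) :=
  rfl

theorem step_eq {R : ℕ} {c : Cmd} {Λ : Type} {emb : c.Lab → Λ} {exit : Λ}
    {m : Λ → TM2.Stmt (Alph R) Λ (Option Symb)} (hm : ∀ l, m (emb l) = code R c emb exit l)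
    (l : c.Lab) (o : Option Symb) (S : ∀ k, List (Alph R k)) :
    TM2.step m ⟨some (emb l), o, S⟩ = some (TM2.stepAux (code R c emb exit l) o S) := by
  rw [TM2.step, hm]

/-- The cost in `Run` counts machine steps exactly, so no time is lost in the translation. The
internal state on entry is arbitrary, because each `pop` overwrites it before it is tested. -/
theorem Run.stepsTo {c : Cmd} {w w' : List Symb} {s s' : ℕ → ℕ} {t R : ℕ}
    (h : Run c w s w' s' t) (hc : c.Bounded (R + 1)) {Λ : Type} {emb : c.Lab → Λ} {exit : Λ}
    {m : Λ → TM2.Stmt (Alph R) Λ (Option Symb)} (hm : ∀ l, m (emb l) = code R c emb exit l)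
    (o : Option Symb) : ∃ o', StepsTo (TM2.step m) t ⟨some (emb c.entry), o, stackOf R w s⟩
      ⟨some exit, o', stackOf R w' s'⟩ := by
  induction h generalizing exit o with
  | skip => exact ⟨o, StepsTo.one (by simp [hm, code])⟩
  | @inc r w s =>
    refine ⟨o, StepsTo.one ?_⟩
    simp only [TM2.step, hm, code, TM2.stepAux, stackOf_inr hc]
    rw [← update_stackOf hc]
    rfl
  | @seq a b w s w' s' w'' s'' t t' _ _ iha ihb =>
    obtain ⟨o₁, h₁⟩ := iha hc.1 (fun l => hm (Sum.inl l)) o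
    obtain ⟨o₂, h₂⟩ := ihb hc.2 (fun l => hm (Sum.inr l)) o₁
    exact ⟨o₂, h₁.trans h₂⟩
  | @loop_zero r b w s hz =>
    refine ⟨none, StepsTo.one ?_⟩
    rw [step_eq hm, code_loop_entry]
    simp only [TM2.stepAux, stackOf_inr hc.1, hz]
    rw [show (List.replicate 0 ()).tail = List.replicate 0 () from rfl, update_stackOf hc.1,
      show Function.update s r 0 = s by rw [← hz, Function.update_eq_self]]
    rfl
  | @loop_succ r b w s w' s' w'' s'' t t' n hn _ _ ihb ihl =>
    obtain ⟨o₁, h₁⟩ := ihb hc.2 (fun l => hm (some l)) (some Symb.var)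
    obtain ⟨o₂, h₂⟩ := ihl hc hm o₁
    refine ⟨o₂, ((StepsTo.one ?_).trans h₁).trans h₂⟩
    rw [step_eq hm, code_loop_entry]
    simp only [TM2.stepAux, stackOf_inr hc.1, hn]
    rw [← update_stackOf hc.1]
    rfl
  | @read_nil b s =>
    refine ⟨none, StepsTo.one ?_⟩
    rw [step_eq hm, code_read_entry]
    simp only [TM2.stepAux]
    congr 2
    funext k
    rcases k with (_ | _) | k <;> rfl
  | @read_cons b a w s w' s' w'' s'' t t' _ _ ihb ihl =>
    obtain ⟨o₁, h₁⟩ := ihb (hc a) (fun l => hm (some ⟨a, l⟩)) (some a)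
    obtain ⟨o₂, h₂⟩ := ihl hc hm o₁
    refine ⟨o₂, ((StepsTo.one ?_).trans h₁).trans h₂⟩
    rw [step_eq hm, code_read_entry]
    simp only [TM2.stepAux]
    congr 2
    funext k
    rcases k with (_ | _) | k <;> rfl

/-- The machine of a program, which moves the counter `0` to the output as a truth value. -/
noncomputable def machine (R : ℕ) (c : Cmd) : FinTM2 :=
  { K := Stack R
    k₀ := Sum.inl false
    k₁ := Sum.inl true
    Γ := Alph R
    Λ := Option c.Lab
    main := some c.entry
    ΛFin := @Fintype.ofFinite _ (haveI := c.finite_lab; inferInstance)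
    σ := Option Symb
    initialState := none
    Γk₀Fin := inferInstanceAs (Fintype Symb)
    m := fun l => l.elim
      (TM2.Stmt.pop (Sum.inr 0) (fun _ o => o.map fun _ => Symb.var)
        (TM2.Stmt.push (Sum.inl true) (fun o => o.isSome) (TM2.Stmt.load (fun _ => none)
          TM2.Stmt.halt)))
      (code R c some none) }

/-- A halting configuration has empty stacks apart from the output. Hence the run must consume its
input and clear all counters but `0`, which holds 0 or 1 and is emptied by the final pop. -/
theorem machine_outputs {R : ℕ} {c : Cmd} (hc : c.Bounded (R + 1)) {w : List Symb} {b : Bool}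
    {t T : ℕ} (h : Run c w (fun _ => 0) [] (Function.update (fun _ => 0) 0 b.toNat) t)
    (ht : t + 1 ≤ T) :
    Nonempty (TM2OutputsInTime (machine R c) w (some [b]) T) := by
  obtain ⟨o, ho⟩ := h.stepsTo (emb := some) (exit := none) (m := (machine R c).m) hc
    (fun l => rfl) none
  have h1 : TM2.step (machine R c).m
      ⟨some none, o, stackOf R [] (Function.update (fun _ => 0) 0 b.toNat)⟩ =
      some ⟨none, none,
        stackOf R [] (fun _ => 0) |> fun S => Function.update S (Sum.inl true) [b]⟩ := by
    cases b
    all_goals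
      refine congrArg some (congrArg (TM2.Cfg.mk none none) ?_)
      funext k
      rcases k with (_ | _) | k
      · rfl
      · rfl
      · refine Fin.cases ?_ (fun k => ?_) k <;> rfl
  have h2 : haltList (machine R c) [b] = ⟨none, none,
      stackOf R [] (fun _ => 0) |> fun S => Function.update S (Sum.inl true) [b]⟩ := by
    refine congrArg (TM2.Cfg.mk none none) ?_
    funext k
    rcases k with (_ | _) | k <;> rfl
  have h0 : initList (machine R c) w = ⟨some (some c.entry), none, stackOf R w (fun _ => 0)⟩ := by
    refine congrArg (TM2.Cfg.mk (some (some c.entry)) none) ?_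
    funext k
    rcases k with (_ | _) | k <;> rfl
  have h3 := ho.trans (StepsTo.one h1)
  refine ⟨⟨⟨t + 1, ?_⟩, ht⟩⟩
  rw [h0]
  exact Eq.trans h3 (congrArg some h2.symm)

/-- A program that decides `L` in time `T` yields a Turing machine. -/
theorem decidableInTimeO {c : Cmd} {L : Set (List Symb)} {f : List Symb → Bool}
    (hf : ∀ w, f w = true ↔ w ∈ L) {T T' : ℕ → ℕ}
    (h : ∀ w, ∃ t ≤ T w.length,
      Run c w (fun _ => 0) [] (Function.update (fun _ => 0) 0 (f w).toNat) t)
    (hT : ∀ n, T n + 1 ≤ T' n) : DecidableInTimeO L T' := by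
  obtain ⟨R, hR⟩ := c.exists_bounded
  refine ⟨f, hf, ⟨⟨⟨machine R c, Equiv.refl _, Equiv.refl _⟩, fun n => T n + 1, fun w => ?_⟩, ?_⟩⟩
  · refine Classical.choice ?_
    obtain ⟨t, ht, hr⟩ := h w
    have := machine_outputs (hR.mono (Nat.le_succ R)) hr (Nat.succ_le_succ ht)
    -- The input of the machine is `w` mapped along the identity equivalence, which must be
    -- rewritten to `w`.
    have key : ∀ w', w' = w →
        Nonempty (TM2OutputsInTime (machine R c) w' (some [f w]) (T w.length + 1)) := by
      rintro _ rfl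
      exact this
    exact key _ (List.map_id (α := Symb) w)
  · refine Asymptotics.IsBigO.of_bound 1 (Filter.Eventually.of_forall fun n => ?_)
    rw [one_mul, Real.norm_of_nonneg (Nat.cast_nonneg _), Real.norm_of_nonneg (Nat.cast_nonneg _)]
    exact_mod_cast hT n

end Cmd
end OrdinalFO

namespace OrdinalFO

/-! ### Primitive recursive expressions -/

/-- The environment that maps `0` to `a` and `n + 1` to `v n`. -/
def scons (a : ℕ) (v : ℕ → ℕ) : ℕ → ℕ
  | 0 => a
  | n + 1 => v n

/-- Expressions for primitive recursive functions of an environment. -/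
inductive Expr : Type
  | var (x : ℕ) : Expr
  | zero : Expr
  | succ (e : Expr) : Expr
  /-- `e`-fold recursion from `a`; in `b` the variable `0` is the counter and `1` the last value -/
  | iter (e a b : Expr) : Expr

namespace Expr

/-- The value of an expression. -/
def eval : Expr → (ℕ → ℕ) → ℕ
  | var x, v => v x
  | zero, _ => 0
  | succ e, v => e.eval v + 1
  | iter e a b, v => Nat.rec (a.eval v) (fun k y => b.eval (scons k (scons y v))) (e.eval v)

/-- A bound for the time in which an expression is computed. -/
def cost : Expr → (ℕ → ℕ) → ℕ
  | var x, v => 5 * v x + 2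
  | zero, _ => 1
  | succ e, v => e.cost v + 1
  | iter e a b, v =>
    let f : ℕ → ℕ := fun n => Nat.rec (a.eval v) (fun k y => b.eval (scons k (scons y v))) n
    e.cost v + a.cost v + (1 + ∑ k ∈ Finset.range (e.eval v),
      (1 + (b.cost (scons k (scons (f k) v)) + 2 * f k + 2 * f (k + 1) + 3))) +
      2 * e.eval v + 2 * f (e.eval v) + 2

end Expr

namespace Cmd

/-- `Takes c s s' T`: the program `c` leads from `s` to `s'` in at most `T` steps without
reading. -/
def Takes (c : Cmd) (s s' : ℕ → ℕ) (T : ℕ) : Prop :=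
  ∀ w, ∃ t ≤ T, Run c w s w s' t

theorem Takes.mono {c : Cmd} {s s' : ℕ → ℕ} {T T' : ℕ} (h : Takes c s s' T) (hT : T ≤ T') :
    Takes c s s' T' := fun w => (h w).imp fun _ h => ⟨h.1.trans hT, h.2⟩

theorem Takes.congr {c : Cmd} {s s' s'' : ℕ → ℕ} {T T' : ℕ} (h : Takes c s s' T) (hs : s' = s'')
    (hT : T ≤ T') : Takes c s s'' T' := hs ▸ h.mono hT

theorem Takes.seq {a b : Cmd} {s s' s'' : ℕ → ℕ} {T T' : ℕ} (h : Takes a s s' T)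
    (h' : Takes b s' s'' T') : Takes (seq a b) s s'' (T + T') := by
  intro w
  obtain ⟨t, ht, hr⟩ := h w
  obtain ⟨t', ht', hr'⟩ := h' w
  exact ⟨t + t', by omega, hr.seq hr'⟩

theorem takes_skip (s : ℕ → ℕ) : Takes skip s s 1 := fun _ => ⟨1, le_rfl, Run.skip⟩

theorem takes_inc (r : ℕ) (s : ℕ → ℕ) : Takes (inc r) s (Function.update s r (s r + 1)) 1 :=
  fun _ => ⟨1, le_rfl, Run.inc⟩

/-- An invariant rule: `S k` is the store at the test after `k` rounds, and the body starts from it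
with the counter `r` already decremented. -/
theorem takes_loop {r : ℕ} {b : Cmd} {n : ℕ} (S : ℕ → ℕ → ℕ) (T : ℕ → ℕ)
    (hr : ∀ k ≤ n, S k r = n - k)
    (h : ∀ k < n, Takes b (Function.update (S k) r (n - k - 1)) (S (k + 1)) (T k)) :
    Takes (loop r b) (S 0) (S n) (1 + ∑ k ∈ Finset.range n, (1 + T k)) := by
  induction n generalizing S T with
  | zero => exact fun w => ⟨1, by simp, Run.loop_zero (hr 0 le_rfl)⟩
  | succ n ih =>
    intro w
    obtain ⟨t, ht, h0⟩ := h 0 (by omega) w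
    obtain ⟨t', ht', h1⟩ := ih (fun k => S (k + 1)) (fun k => T (k + 1))
      (fun k hk => by rw [hr (k + 1) (by omega)]; omega)
      (fun k hk => by
        have := h (k + 1) (by omega)
        rwa [show n + 1 - (k + 1) - 1 = n - k - 1 by omega] at this) w
    refine ⟨1 + t + t', ?_, Run.loop_succ (n := n) (hr 0 (by omega)) h0 h1⟩
    rw [Finset.sum_range_succ']
    omega

/-- Set the counter `r` to zero. -/
def clear (r : ℕ) : Cmd := loop r skip

theorem takes_clear (r : ℕ) (s : ℕ → ℕ) :
    Takes (clear r) s (Function.update s r 0) (2 * s r + 1) := by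
  have := takes_loop (r := r) (b := skip) (n := s r) (fun k => Function.update s r (s r - k))
    (fun _ => 1) (fun k _ => by simp) (fun k hk => by
      rw [Function.update_idem, Nat.sub_sub]; exact takes_skip _)
  simp only [Nat.sub_zero, Function.update_eq_self, Nat.sub_self] at this
  exact this.mono (by simp; omega)

/-- Add the counter `r` to `r'` and set it to zero. -/
def move (r r' : ℕ) : Cmd := loop r (inc r')

theorem takes_move {r r' : ℕ} (h : r ≠ r') (s : ℕ → ℕ) :
    Takes (move r r') s (Function.update (Function.update s r 0) r' (s r' + s r))
      (2 * s r + 1) := by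
  have := takes_loop (r := r) (b := inc r') (n := s r)
    (fun k => Function.update (Function.update s r (s r - k)) r' (s r' + k))
    (fun _ => 1) (fun k _ => by simp [h]) (fun k hk => by
      convert takes_inc r' _ using 1
      funext x
      by_cases h1 : x = r'
      · subst h1; simp [h.symm]; omega
      · by_cases h2 : x = r
        · subst h2; simp [h]; omega
        · simp [h1, h2])
  simp only [Nat.sub_zero, Function.update_eq_self, Nat.sub_self, add_zero] at this
  exact this.mono (by simp; omega)

/-- Add the counter `r` to `r'`, using the empty counter `r''`. -/
def copy (r r' r'' : ℕ) : Cmd := seq (loop r (seq (inc r') (inc r''))) (move r'' r)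

theorem takes_copy {r r' r'' : ℕ} (h : r ≠ r') (h' : r ≠ r'') (h'' : r' ≠ r'') {s : ℕ → ℕ}
    (hs : s r'' = 0) :
    Takes (copy r r' r'') s (Function.update s r' (s r' + s r)) (5 * s r + 2) := by
  have := takes_loop (r := r) (b := seq (inc r') (inc r'')) (n := s r)
    (fun k => Function.update (Function.update (Function.update s r (s r - k)) r' (s r' + k)) r'' k)
    (fun _ => 2) (fun k _ => by simp [h, h']) (fun k hk => by
      convert (takes_inc r' _).seq (takes_inc r'' _) using 1
      funext x
      by_cases h1 : x = r'
      · subst h1; simp [h.symm, h'']; omega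
      · by_cases h2 : x = r
        · subst h2; simp [h, h']; omega
        · by_cases h3 : x = r''
          · subst h3; simp [h'.symm, h''.symm]
          · simp [h1, h2, h3])
  refine Takes.mono (T := (1 + ∑ k ∈ Finset.range (s r), (1 + 2)) + (2 * s r + 1)) ?_
    (by simp; omega)
  refine Takes.seq (s' := Function.update (Function.update (Function.update s r (s r - s r)) r'
    (s r' + s r)) r'' (s r)) ?_ ?_
  · convert this using 1
    funext x
    by_cases h3 : x = r''
    · subst h3; simp [hs]
    · simp [h3]
  · convert takes_move h'.symm _ using 1
    · funext x
      by_cases h1 : x = r'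
      · subst h1; simp [h.symm, h'']
      · by_cases h2 : x = r
        · subst h2; simp [h, h']
        · by_cases h3 : x = r''
          · subst h3; simp [h'.symm, h''.symm, hs]
          · simp [h1, h2, h3]
    · simp

end Cmd

/-! ### Compiling expressions into counter programs -/

namespace Expr
open Cmd

/-- The program that computes an expression in the counter `m`, the variable `x` being stored in the
counter `ρ x`. -/
def comp : Expr → (ℕ → ℕ) → ℕ → Cmd
  | var x, ρ, m => copy (ρ x) m (m + 1)
  | zero, _, _ => skip
  | succ e, ρ, m => seq (e.comp ρ m) (inc m)
  | iter e a b, ρ, m => seq (e.comp ρ m) <| seq (a.comp ρ (m + 1)) <|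
      seq (loop m <| seq (b.comp (scons (m + 2) (scons (m + 1) ρ)) (m + 3)) <|
        seq (clear (m + 1)) <| seq (move (m + 3) (m + 1)) (inc (m + 2))) <|
      seq (clear (m + 2)) (move (m + 1) m)

/-- Counters below `m` hold the variables and survive; those from `m` on are empty scratch space.
During an iteration `m` holds the remaining rounds, `m + 1` the current value, `m + 2` the index of
the round and `m + 3` the result of the body. -/
theorem takes_comp (e : Expr) {ρ : ℕ → ℕ} {m : ℕ} (hρ : ∀ x, ρ x < m) {s : ℕ → ℕ}
    (hs : ∀ r, m ≤ r → s r = 0) : Takes (e.comp ρ m) s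
      (Function.update s m (e.eval fun x => s (ρ x))) (e.cost fun x => s (ρ x)) := by
  induction e generalizing ρ m s with
  | var x =>
    have := takes_copy (r := ρ x) (r' := m) (r'' := m + 1) (hρ x).ne
      ((hρ x).trans (Nat.lt_succ_self m)).ne (Nat.succ_ne_self m).symm (hs (m + 1) (by omega))
    rwa [hs m le_rfl, zero_add] at this
  | zero =>
    have : Function.update s m 0 = s := by rw [← hs m le_rfl, Function.update_eq_self]
    simpa only [eval, this, comp, cost] using takes_skip s
  | succ e ih =>
    have := (ih hρ hs).seq (takes_inc m _)
    simpa [comp, eval, cost] using this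
  | iter e a b ihe iha ihb =>
    set v : ℕ → ℕ := fun x => s (ρ x) with hv
    set n := e.eval v with hn
    set f : ℕ → ℕ := fun n => Nat.rec (a.eval v) (fun k y => b.eval (scons k (scons y v))) n with hf
    have hfs : ∀ k, f (k + 1) = b.eval (scons k (scons (f k) v)) := fun k => rfl
    let S : ℕ → ℕ → ℕ := fun k => Function.update (Function.update (Function.update s m (n - k))
      (m + 1) (f k)) (m + 2) k
    have h1 := ihe hρ hs
    have h2 := iha (ρ := ρ) (m := m + 1) (s := Function.update s m n)
      (fun x => (hρ x).trans (Nat.lt_succ_self m))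
      (fun r hr => by rw [Function.update_of_ne (by omega), hs r (by omega)])
    have hv' : (fun x => Function.update s m n (ρ x)) = v := by
      funext x
      rw [Function.update_of_ne (hρ x).ne]
    rw [hv'] at h2
    have h3 := takes_loop (r := m) (n := n)
      (b := seq (b.comp (scons (m + 2) (scons (m + 1) ρ)) (m + 3)) <|
        seq (clear (m + 1)) <| seq (move (m + 3) (m + 1)) (inc (m + 2))) S
      (fun k => b.cost (scons k (scons (f k) v)) + 2 * f k + 2 * f (k + 1) + 3)
      (fun k hk => by simp [S]) (fun k hk => by
        have hS : ∀ r, m + 3 ≤ r → Function.update (S k) m (n - k - 1) r = 0 := fun r hr => by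
          simp [S, show r ≠ m by omega, show r ≠ m + 1 by omega,
            show r ≠ m + 2 by omega, hs r (by omega)]
        have hρ' : ∀ x, scons (m + 2) (scons (m + 1) ρ) x < m + 3 := by
          rintro (_ | _ | x)
          · simp [scons]
          · simp [scons]
          · exact (hρ x).trans (by omega)
        have h4 := ihb hρ' hS
        have hv'' : (fun x => Function.update (S k) m (n - k - 1)
            (scons (m + 2) (scons (m + 1) ρ) x)) = scons k (scons (f k) v) := by
          funext x
          rcases x with _ | _ | x
          · simp [scons, S]
          · simp [scons, S]
          · have := hρ x
            simp [scons, S, show ρ x ≠ m by omega,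
              show ρ x ≠ m + 1 by omega, show ρ x ≠ m + 2 by omega, hv]
        rw [hv'', ← hfs] at h4
        have h5 := h4.seq <| (takes_clear (m + 1) _).seq <|
          (takes_move (show m + 3 ≠ m + 1 by omega) _).seq (takes_inc (m + 2) _)
        refine h5.congr ?_ ?_
        · funext r
          by_cases r1 : r = m
          · subst r1; simp [S]; omega
          by_cases r2 : r = m + 1
          · subst r2; simp [S]
          by_cases r3 : r = m + 2
          · subst r3; simp [S]
          by_cases r4 : r = m + 3
          · subst r4; simp [S, hs]
          · simp [S, r1, r2, r3, r4]
        · simp [S]; omega)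
    have h4 := (takes_clear (m + 2) (S n)).seq (takes_move (show m + 1 ≠ m by omega) _)
    have h0 : Function.update (Function.update s m n) (m + 1) (a.eval v) = S 0 := by
      funext r
      by_cases r1 : r = m + 2
      · subst r1; simp [S, hs]
      · simp [S, r1, f]
    rw [h0] at h2
    refine (h1.seq (h2.seq (h3.seq h4))).congr ?_ ?_
    · change _ = Function.update s m (f n)
      funext r
      by_cases r1 : r = m
      · subst r1; simp [S]
      by_cases r2 : r = m + 1
      · subst r2; simp [S, hs]
      by_cases r3 : r = m + 2
      · subst r3; simp [S, hs]
      · simp [S, r1, r2, r3]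
    · have hc : (iter e a b).cost v = e.cost v + a.cost v + (1 + ∑ k ∈ Finset.range n,
          (1 + (b.cost (scons k (scons (f k) v)) + 2 * f k + 2 * f (k + 1) + 3))) +
          2 * n + 2 * f n + 2 := rfl
      rw [← hv, hc]
      have e1 : S n (m + 2) = n := by simp [S]
      have e2 : Function.update (S n) (m + 2) 0 (m + 1) = f n := by simp [S]
      rw [e1, e2]
      omega

end Expr
end OrdinalFO

namespace OrdinalFO

/-! ### Bounds by towers of fixed height -/

/-- Some tower of fixed height in a bound `M` of the argument, in the sense of `β`, bounds `f`. -/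
def TowerBounded {ι : Type} (β : ι → ℕ → Prop) (f : ι → ℕ) : Prop :=
  ∃ k, ∀ M i, β i M → f i ≤ tower k M

theorem self_le_tower (k m : ℕ) : k ≤ tower k m := by
  induction k with
  | zero => exact Nat.zero_le _
  | succ k ih => exact ih.trans_lt Nat.lt_two_pow_self

namespace TowerBounded

variable {ι : Type} {β : ι → ℕ → Prop} {f g : ι → ℕ}

theorem mono (hg : TowerBounded β g) (h : ∀ M i, β i M → f i ≤ g i) : TowerBounded β f := by
  obtain ⟨k, hk⟩ := hg
  exact ⟨k, fun M i hi => (h M i hi).trans (hk M i hi)⟩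

theorem const (c : ℕ) : TowerBounded β fun _ => c := ⟨c, fun M _ _ => self_le_tower c M⟩

theorem mul (hf : TowerBounded β f) (hg : TowerBounded β g) :
    TowerBounded β fun i => f i * g i := by
  obtain ⟨k, hk⟩ := hf
  obtain ⟨l, hl⟩ := hg
  refine ⟨max k l + 4 + 1, fun M i hi => ?_⟩
  have h1 := (hk M i hi).trans (tower_mono_left M (show k ≤ max k l + 4 by omega))
  have h2 := (hl M i hi).trans (tower_mono_left M (show l ≤ max k l + 4 by omega))
  have h3 : 4 ≤ tower (max k l + 4) M := (by omega : 4 ≤ max k l + 4).trans (self_le_tower _ _)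
  exact (Nat.mul_le_mul h1 h2).trans (sq_le_two_pow h3)

theorem add (hf : TowerBounded β f) (hg : TowerBounded β g) :
    TowerBounded β fun i => f i + g i := by
  obtain ⟨k, hk⟩ := hf
  obtain ⟨l, hl⟩ := hg
  refine ⟨max k l + 4 + 1, fun M i hi => ?_⟩
  have h1 := (hk M i hi).trans (tower_mono_left M (show k ≤ max k l + 4 by omega))
  have h2 := (hl M i hi).trans (tower_mono_left M (show l ≤ max k l + 4 by omega))
  have h3 : 4 ≤ tower (max k l + 4) M := (by omega : 4 ≤ max k l + 4).trans (self_le_tower _ _)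
  refine le_trans ?_ (sq_le_two_pow h3)
  dsimp only
  nlinarith

theorem two_pow (hf : TowerBounded β f) : TowerBounded β fun i => 2 ^ f i := by
  obtain ⟨k, hk⟩ := hf
  exact ⟨k + 1, fun M i hi => Nat.pow_le_pow_right two_pos (hk M i hi)⟩

theorem pow (hf : TowerBounded β f) (hg : TowerBounded β g) :
    TowerBounded β fun i => f i ^ g i := by
  refine (hf.mul hg).two_pow.mono fun M i _ => ?_
  rw [pow_mul]
  exact Nat.pow_le_pow_left Nat.lt_two_pow_self.le _

/-- A sum is at most the number of terms times the largest term. The tower bounding the terms must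
be uniform in the summation index, which is therefore made part of the argument. -/
theorem sum {n : ι → ℕ} {F : ι → ℕ → ℕ} (hn : TowerBounded β n)
    (hF : TowerBounded (ι := ι × ℕ) (fun p M => β p.1 M ∧ p.2 < n p.1) fun p => F p.1 p.2) :
    TowerBounded β fun i => ∑ k ∈ Finset.range (n i), F i k := by
  obtain ⟨k, hk⟩ := hF
  obtain ⟨l, hl⟩ := hn.mul (g := fun i => ⨆ j : Fin (n i), F i j) ⟨k, fun M i hi => by
    rcases Nat.eq_zero_or_pos (n i) with h | h
    · have : IsEmpty (Fin (n i)) := by rw [h]; infer_instance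
      simp
    · have : Nonempty (Fin (n i)) := ⟨⟨0, h⟩⟩
      exact ciSup_le fun j => hk M (i, j) ⟨hi, j.2⟩⟩
  refine ⟨l, fun M i hi => le_trans ?_ (hl M i hi)⟩
  refine (Finset.sum_le_card_nsmul _ _ (⨆ j : Fin (n i), F i j) fun k hk => ?_).trans (by simp)
  exact le_ciSup (f := fun j : Fin (n i) => F i j) (Set.finite_range _).bddAbove
    ⟨k, Finset.mem_range.1 hk⟩

end TowerBounded

/-- The environment `v` is bounded by `M`. -/
def EnvLE (v : ℕ → ℕ) (M : ℕ) : Prop := ∀ x, v x ≤ M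

namespace TowerBounded

variable {ι : Type} {β : ι → ℕ → Prop} {g : ι → ℕ} {f : (ℕ → ℕ) → ℕ}

theorem var (x : ℕ) : TowerBounded EnvLE fun v => v x := ⟨0, fun _ _ hv => hv x⟩

theorem comp (hf : TowerBounded EnvLE f) (hg : TowerBounded β g) {w : ι → ℕ → ℕ}
    (hw : ∀ M i, β i M → ∀ x, w i x ≤ M ∨ w i x ≤ g i) : TowerBounded β fun i => f (w i) := by
  obtain ⟨k, hk⟩ := hf
  obtain ⟨l, hl⟩ := hg
  refine ⟨k + l, fun M i hi => ?_⟩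
  rw [tower_add]
  refine hk _ _ fun x => ?_
  rcases hw M i hi x with h | h
  · exact h.trans (le_tower l M)
  · exact h.trans (hl M i hi)

theorem ren (hf : TowerBounded EnvLE f) (ρ : ℕ → ℕ) :
    TowerBounded EnvLE fun v => f fun x => v (ρ x) :=
  hf.comp (const 0) fun _ _ hv x => Or.inl (hv (ρ x))

end TowerBounded

/-! ### Elementary functions -/

namespace Expr

theorem eval_le_cost (e : Expr) (v : ℕ → ℕ) : e.eval v ≤ e.cost v := by
  cases e with
  | var x => simp only [eval, cost]; omega
  | zero => simp [eval]
  | succ e => exact Nat.succ_le_succ (eval_le_cost e v)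
  | iter e a b => simp only [eval, cost]; omega

/-- Renaming of variables. -/
def ren : Expr → (ℕ → ℕ) → Expr
  | var x, ρ => var (ρ x)
  | zero, _ => zero
  | succ e, ρ => succ (e.ren ρ)
  | iter e a b, ρ => iter (e.ren ρ) (a.ren ρ) (b.ren (scons 0 (scons 1 fun x => ρ x + 2)))

theorem scons_ren (ρ v : ℕ → ℕ) (k y : ℕ) :
    (fun x => scons k (scons y v) (scons 0 (scons 1 fun x => ρ x + 2) x)) =
      scons k (scons y fun x => v (ρ x)) := by
  funext x
  rcases x with _ | _ | x <;> rfl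

theorem eval_ren (e : Expr) (ρ v : ℕ → ℕ) : (e.ren ρ).eval v = e.eval fun x => v (ρ x) := by
  induction e generalizing ρ v with
  | var x => rfl
  | zero => rfl
  | succ e ih => simp [ren, eval, ih]
  | iter e a b ihe iha ihb => simp only [ren, eval, ihe, iha, ihb, scons_ren]

theorem cost_ren (e : Expr) (ρ v : ℕ → ℕ) : (e.ren ρ).cost v = e.cost fun x => v (ρ x) := by
  induction e generalizing ρ v with
  | var x => rfl
  | zero => rfl
  | succ e ih => simp [ren, cost, ih]
  | iter e a b ihe iha ihb => simp only [ren, cost, ihe, iha, ihb, scons_ren, eval_ren]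

end Expr

/-- The function is computed by an expression with a cost that is bounded by a tower of fixed
height. -/
def Elem (f : (ℕ → ℕ) → ℕ) : Prop :=
  ∃ e : Expr, (∀ v, e.eval v = f v) ∧ TowerBounded EnvLE e.cost

/-- The environment without the variable `0`. -/
def tail (v : ℕ → ℕ) : ℕ → ℕ := fun x => v (x + 1)

namespace Elem

variable {f g h : (ℕ → ℕ) → ℕ}

theorem towerBounded (hf : Elem f) : TowerBounded EnvLE f := by
  obtain ⟨e, he, hc⟩ := hf
  exact hc.mono fun _ v _ => (he v).symm.trans_le (e.eval_le_cost v)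

theorem var (x : ℕ) : Elem fun v => v x :=
  ⟨.var x, fun _ => rfl,
    (((TowerBounded.const 5).mul (TowerBounded.var x)).add (TowerBounded.const 2))⟩

theorem succ (hf : Elem f) : Elem fun v => f v + 1 := by
  obtain ⟨e, he, hc⟩ := hf
  exact ⟨.succ e, fun v => congrArg (· + 1) (he v), hc.add (TowerBounded.const 1)⟩

theorem const (c : ℕ) : Elem fun _ => c := by
  induction c with
  | zero => exact ⟨.zero, fun _ => rfl, TowerBounded.const 1⟩
  | succ c ih => exact ih.succ

theorem ren (hf : Elem f) (ρ : ℕ → ℕ) : Elem fun v => f fun x => v (ρ x) := by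
  obtain ⟨e, he, hc⟩ := hf
  refine ⟨e.ren ρ, fun v => by rw [e.eval_ren, he], ?_⟩
  exact (hc.ren ρ).mono fun _ v _ => (e.cost_ren ρ v).le

/-- Limited recursion: the a priori bound `h` on all intermediate values keeps the height of the
towers fixed, where unrestricted recursion could raise it in every round. -/
theorem iter {n a : (ℕ → ℕ) → ℕ} {b : (ℕ → ℕ) → ℕ → ℕ → ℕ} (hn : Elem n) (ha : Elem a)
    (hb : Elem fun v => b (tail (tail v)) (v 0) (v 1)) (hh : TowerBounded EnvLE h)
    (hle : ∀ v, ∀ k ≤ n v, (Nat.rec (a v) (b v) k : ℕ) ≤ h v) :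
    Elem fun v => Nat.rec (a v) (b v) (n v) := by
  obtain ⟨en, hen, hcn⟩ := hn
  obtain ⟨ea, hea, hca⟩ := ha
  obtain ⟨eb, heb, hcb⟩ := hb
  have heb' : ∀ v k y, eb.eval (scons k (scons y v)) = b v k y := fun v k y => heb _
  refine ⟨.iter en ea eb, fun v => by simp only [Expr.eval, hen, hea, heb'], ?_⟩
  simp only [Expr.cost, hen, hea, heb']
  have hnb : TowerBounded EnvLE n := hcn.mono fun _ v _ => (hen v).symm.trans_le (en.eval_le_cost v)
  have two : ∀ {ι : Type} {β : ι → ℕ → Prop} {f : ι → ℕ}, TowerBounded β f →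
    TowerBounded β fun i => 2 * f i := fun h => (TowerBounded.const 2).mul h
  have hh' : TowerBounded (ι := (ℕ → ℕ) × ℕ) (fun p M => EnvLE p.1 M ∧ p.2 < n p.1)
      fun p => h p.1 := hh.imp fun k hk M p hp => hk M p.1 hp.1
  have hn' : TowerBounded (ι := (ℕ → ℕ) × ℕ) (fun p M => EnvLE p.1 M ∧ p.2 < n p.1)
      fun p => n p.1 := hnb.imp fun k hk M p hp => hk M p.1 hp.1
  refine ((((hcn.add hca).add ((TowerBounded.const 1).add (hnb.sum ?_))).add (two hnb)).add
    (two (hh.mono fun _ v _ => hle v _ le_rfl))).add (TowerBounded.const 2)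
  refine (TowerBounded.const 1).add ((((hcb.comp (hh'.add hn') ?_).add
    (two (hh'.mono fun _ p hp => hle p.1 _ hp.2.le))).add
    (two (hh'.mono fun _ p hp => hle p.1 _ hp.2))).add (TowerBounded.const 3))
  rintro M p ⟨hp, hlt⟩ (_ | _ | x)
  · exact Or.inr (hlt.le.trans (Nat.le_add_left _ _))
  · exact Or.inr ((hle p.1 _ hlt.le).trans (Nat.le_add_right _ _))
  · exact Or.inl (hp x)

/-- Substitution for the variable `0`. -/
theorem subst (hf : Elem f) (hg : Elem g) : Elem fun v => f (scons (g v) v) := by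
  have h0 : Elem fun v => f (scons (v 1) (tail (tail v))) := by
    have h : ∀ v, scons (v 1) (tail (tail v)) = fun x => v (x + 1) := fun v => by
      funext x
      cases x <;> rfl
    simp only [h]
    exact hf.ren (fun x => x + 1)
  -- Expressions have no composition, so a recursion of a single round acts as a `let`: it starts
  -- from the value of `g`, and its body sees this value as the variable `1`.
  have h1 := iter (b := fun v _ y => f (scons y v)) (const 1) hg h0
    (h := fun v => g v + f (scons (g v) v))
    (hg.towerBounded.add (hf.towerBounded.comp hg.towerBounded fun M v hv x => by
      rcases x with _ | x
      · exact Or.inr le_rfl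
      · exact Or.inl (hv x)))
    (fun v k hk => by
      interval_cases k
      · exact Nat.le_add_right _ _
      · exact Nat.le_add_left _ _)
  exact h1

theorem tail (hf : Elem f) : Elem fun v => f (tail v) := hf.ren _

/-- The environment `v` with the values of the functions in `l` put in front. -/
def _root_.OrdinalFO.extend : List ((ℕ → ℕ) → ℕ) → (ℕ → ℕ) → ℕ → ℕ
  | [], v => v
  | g :: l, v => scons (g v) (extend l v)

/-- Bookkeeping for substituting one function at a time: a value waiting in the variable `0` ends up
behind the values of `l`, and renaming brings it to the front. -/
theorem extend_tail (l : List ((ℕ → ℕ) → ℕ)) (v : ℕ → ℕ) (x : ℕ) :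
    extend (l.map fun g v => g (OrdinalFO.tail v)) v (if x < l.length then x else x + 1) =
      extend l (OrdinalFO.tail v) x ∧
    extend (l.map fun g v => g (OrdinalFO.tail v)) v l.length = v 0 := by
  induction l generalizing x with
  | nil => exact ⟨rfl, rfl⟩
  | cons g l ih =>
    refine ⟨?_, (ih 0).2⟩
    cases x with
    | zero => simp [extend, scons]
    | succ x =>
      have := (ih x).1
      simp only [List.length_cons, Nat.add_lt_add_iff_right]
      split_ifs with hx <;> simp only [hx, if_true, if_false] at this <;> exact this

/-- Simultaneous substitution. -/
theorem comp (hf : Elem f) (l : List ((ℕ → ℕ) → ℕ)) (hl : ∀ g ∈ l, Elem g) :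
    Elem fun v => f (extend l v) := by
  obtain ⟨n, hn⟩ : ∃ n, l.length = n := ⟨_, rfl⟩
  induction n generalizing l f with
  | zero =>
    rw [List.length_eq_zero_iff.1 hn]
    exact hf
  | succ n ih =>
    obtain ⟨g, l, rfl⟩ := List.exists_cons_of_length_eq_add_one hn
    simp only [List.length_cons, Nat.add_right_cancel_iff] at hn
    have h1 := ih (hf.ren (scons l.length fun x => if x < l.length then x else x + 1))
      (l.map fun g v => g (OrdinalFO.tail v)) (fun g' hg' => by
        obtain ⟨g'', hg'', rfl⟩ := List.mem_map.1 hg'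
        exact (hl _ (List.mem_cons_of_mem _ hg'')).tail) (by simpa using hn)
    have h2 : ∀ v, (fun x => extend (l.map fun g v => g (OrdinalFO.tail v)) v
        (scons l.length (fun x => if x < l.length then x else x + 1) x)) =
        scons (v 0) (extend l (OrdinalFO.tail v)) := by
      intro v
      funext x
      cases x with
      | zero => exact (extend_tail l v 0).2
      | succ x => exact (extend_tail l v x).1
    simp only [h2] at h1
    exact h1.subst (hl g List.mem_cons_self)

theorem comp₁ {F : ℕ → ℕ} (hF : Elem fun v => F (v 0)) (hf : Elem f) : Elem fun v => F (f v) :=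
  hF.comp [f] (by simpa using hf)

theorem comp₂ {F : ℕ → ℕ → ℕ} (hF : Elem fun v => F (v 0) (v 1)) (hf : Elem f) (hg : Elem g) :
    Elem fun v => F (f v) (g v) :=
  hF.comp [f, g] (by simpa using ⟨hf, hg⟩)

theorem add (hf : Elem f) (hg : Elem g) : Elem fun v => f v + g v := by
  have h0 : ∀ a b : ℕ, (Nat.rec a (fun _ y => y + 1) b : ℕ) = a + b := fun a b => by
    induction b with
    | zero => rfl
    | succ b ih => rw [← add_assoc, ← ih]
  have h1 := iter (b := fun _ _ y => y + 1) (var 1) (var 0) (var 1).succ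
    (h := fun v => v 0 + v 1) ((TowerBounded.var 0).add (TowerBounded.var 1))
    (fun v k hk => by rw [h0]; omega)
  simp only [h0] at h1
  exact comp₂ h1 hf hg

theorem mul (hf : Elem f) (hg : Elem g) : Elem fun v => f v * g v := by
  have h0 : ∀ a b : ℕ, (Nat.rec 0 (fun _ y => y + a) b : ℕ) = a * b := fun a b => by
    induction b with
    | zero => rfl
    | succ b ih => rw [mul_add, mul_one, ← ih]
  have h1 := iter (b := fun v _ y => y + v 0) (var 1) (const 0) ((var 1).add (var 2))
    (h := fun v => v 0 * v 1) ((TowerBounded.var 0).mul (TowerBounded.var 1))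
    (fun v k hk => by rw [h0]; exact Nat.mul_le_mul_left _ hk)
  simp only [h0] at h1
  exact comp₂ h1 hf hg

theorem pow (hf : Elem f) (hg : Elem g) : Elem fun v => f v ^ g v := by
  have h0 : ∀ a b : ℕ, (Nat.rec 1 (fun _ y => y * a) b : ℕ) = a ^ b := fun a b => by
    induction b with
    | zero => rfl
    | succ b ih => rw [pow_succ, ← ih]
  have h1 := iter (b := fun v _ y => y * v 0) (var 1) (const 1) ((var 1).mul (var 2))
    (h := fun v => (v 0 + 1) ^ v 1)
    (((TowerBounded.var 0).add (TowerBounded.const 1)).pow (TowerBounded.var 1))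
    (fun v k hk => by
      rw [h0]
      exact (Nat.pow_le_pow_left (Nat.le_succ _) _).trans
        (Nat.pow_le_pow_right (Nat.succ_pos _) hk))
  simp only [h0] at h1
  exact comp₂ h1 hf hg

theorem pred (hf : Elem f) : Elem fun v => f v - 1 := by
  have h0 : ∀ a : ℕ, (Nat.rec 0 (fun k _ => k) a : ℕ) = a - 1 := fun a => by
    cases a <;> rfl
  have h1 := iter (b := fun _ k _ => k) (var 0) (const 0) (var 0) (TowerBounded.var 0)
    (fun v k hk => by rw [h0]; omega)
  simp only [h0] at h1
  exact comp₁ (F := fun a => a - 1) h1 hf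

theorem sub (hf : Elem f) (hg : Elem g) : Elem fun v => f v - g v := by
  have h0 : ∀ a b : ℕ, (Nat.rec a (fun _ y => y - 1) b : ℕ) = a - b := fun a b => by
    induction b with
    | zero => rfl
    | succ b ih => rw [← Nat.sub_sub, ← ih]
  have h1 := iter (b := fun _ _ y => y - 1) (var 1) (var 0) (var 1).pred
    (TowerBounded.var 0) (fun v k hk => by rw [h0]; omega)
  simp only [h0] at h1
  exact comp₂ h1 hf hg

theorem sum {n : (ℕ → ℕ) → ℕ} {F : (ℕ → ℕ) → ℕ → ℕ} (hn : Elem n)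
    (hF : Elem fun v => F (OrdinalFO.tail v) (v 0)) :
    Elem fun v => ∑ k ∈ Finset.range (n v), F v k := by
  have h0 : ∀ v b, (Nat.rec 0 (fun k y => y + F v k) b : ℕ) = ∑ k ∈ Finset.range b, F v k :=
    fun v b => by
      induction b with
      | zero => rfl
      | succ b ih => rw [Finset.sum_range_succ, ← ih]
  have h1 := iter (b := fun v k y => y + F v k) hn (const 0)
    ((var 1).add (hF.ren (scons 0 fun x => x + 2)))
    (h := fun v => ∑ k ∈ Finset.range (n v), F v k)
    (hn.towerBounded.sum ?_) (fun v k hk => by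
      rw [h0]
      exact Finset.sum_le_sum_of_subset (Finset.range_subset_range.2 hk))
  · simp only [h0] at h1
    exact h1
  · have hn' : TowerBounded (ι := (ℕ → ℕ) × ℕ) (fun p M => EnvLE p.1 M ∧ p.2 < n p.1)
      fun p => n p.1 := hn.towerBounded.imp fun k hk M p hp => hk M p.1 hp.1
    refine hF.towerBounded.comp (w := fun p => scons p.2 p.1) hn' ?_
    rintro M p ⟨hp, hlt⟩ (_ | x)
    · exact Or.inr hlt.le
    · exact Or.inl (hp x)

end Elem

/-! ### Elementary predicates -/

open Classical in
/-- The characteristic function of the predicate is elementary. -/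
def ElemP (p : (ℕ → ℕ) → Prop) : Prop := Elem fun v => if p v then 1 else 0

namespace ElemP

variable {p q : (ℕ → ℕ) → Prop} {f g : (ℕ → ℕ) → ℕ}

theorem congr (hp : ElemP p) (h : ∀ v, p v ↔ q v) : ElemP q := by
  rwa [show q = p from funext fun v => propext (h v).symm]

theorem indicator [DecidablePred p] (hp : ElemP p) : Elem fun v => if p v then 1 else 0 := by
  unfold ElemP at hp
  convert hp

theorem ite [DecidablePred p] (hp : ElemP p) (hf : Elem f) (hg : Elem g) :
    Elem fun v => if p v then f v else g v := by
  have h := (Elem.mul hp.indicator hf).add ((Elem.sub (Elem.const 1) hp.indicator).mul hg)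
  convert h using 2 with v
  by_cases h : p v <;> simp [h]

theorem of_pos (hf : Elem f) : ElemP fun v => 0 < f v := by
  have h := (Elem.const 1).sub ((Elem.const 1).sub hf)
  unfold ElemP
  convert h using 2 with v
  split_ifs <;> omega

theorem not (hp : ElemP p) : ElemP fun v => ¬ p v := by
  have h := (Elem.const 1).sub hp
  unfold ElemP
  convert h using 2 with v
  by_cases h : p v <;> simp [h]

theorem and (hp : ElemP p) (hq : ElemP q) : ElemP fun v => p v ∧ q v := by
  have h := Elem.mul hp hq
  unfold ElemP
  convert h using 2 with v
  by_cases h : p v <;> by_cases h' : q v <;> simp [h, h']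

theorem or (hp : ElemP p) (hq : ElemP q) : ElemP fun v => p v ∨ q v :=
  (hp.not.and hq.not).not.congr fun v => by tauto

theorem imp (hp : ElemP p) (hq : ElemP q) : ElemP fun v => p v → q v :=
  (hp.not.or hq).congr fun v => by tauto

theorem iff (hp : ElemP p) (hq : ElemP q) : ElemP fun v => (p v ↔ q v) :=
  ((hp.imp hq).and (hq.imp hp)).congr fun v => by tauto

theorem lt (hf : Elem f) (hg : Elem g) : ElemP fun v => f v < g v :=
  (of_pos (hg.sub hf)).congr fun v => by omega

theorem le (hf : Elem f) (hg : Elem g) : ElemP fun v => f v ≤ g v :=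
  (lt hg hf).not.congr fun v => by omega

theorem eq (hf : Elem f) (hg : Elem g) : ElemP fun v => f v = g v :=
  ((le hf hg).and (le hg hf)).congr fun v => by omega

/-- Bounded search as counting: the sum of the characteristic function is positive exactly if there
is a witness. -/
theorem exists_lt {n : (ℕ → ℕ) → ℕ} {P : (ℕ → ℕ) → ℕ → Prop} (hn : Elem n)
    (hP : ElemP fun v => P (OrdinalFO.tail v) (v 0)) : ElemP fun v => ∃ k < n v, P v k := by
  classical
  refine (of_pos (Elem.sum (F := fun v k => if P v k then 1 else 0) hn hP)).congr fun v => ?_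
  rw [Nat.pos_iff_ne_zero, ne_eq, Finset.sum_eq_zero_iff]
  simp

theorem forall_lt {n : (ℕ → ℕ) → ℕ} {P : (ℕ → ℕ) → ℕ → Prop} (hn : Elem n)
    (hP : ElemP fun v => P (OrdinalFO.tail v) (v 0)) : ElemP fun v => ∀ k < n v, P v k :=
  (exists_lt (P := fun v k => ¬ P v k) hn hP.not).not.congr fun v => by push Not; rfl

end ElemP

namespace Elem

variable {f g : (ℕ → ℕ) → ℕ}

/-- The quotient counts the positive multiples of the divisor up to the dividend; division by zero
gets the value 0. -/
theorem div (hf : Elem f) (hg : Elem g) : Elem fun v => f v / g v := by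
  have h1 : Elem fun v : ℕ → ℕ => v 0 / v 1 := by
    have h2 : Elem fun v : ℕ → ℕ => if v 1 = 0 then 0 else
        ∑ k ∈ Finset.range (v 0), if (k + 1) * v 1 ≤ v 0 then 1 else 0 :=
      ((ElemP.eq (var 1) (const 0)).ite (const 0) (sum (var 0)
        (ElemP.indicator (p := fun v => (v 0 + 1) * v 2 ≤ v 1)
          (ElemP.le ((var 0).succ.mul (var 2)) (var 1)))))
    convert h2 using 2 with v
    split_ifs with h
    · simp [h]
    · rw [Finset.sum_boole, Nat.cast_id]
      have : Finset.filter (fun k => (k + 1) * v 1 ≤ v 0) (Finset.range (v 0)) =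
          Finset.range (v 0 / v 1) := by
        ext k
        simp only [Finset.mem_filter, Finset.mem_range]
        rw [← Nat.le_div_iff_mul_le (Nat.pos_of_ne_zero h), Nat.succ_le_iff]
        exact ⟨fun h => h.2, fun h' => ⟨h'.trans_le (Nat.div_le_self _ _), h'⟩⟩
      rw [this, Finset.card_range]
  exact comp₂ h1 hf hg

theorem mod (hf : Elem f) (hg : Elem g) : Elem fun v => f v % g v := by
  have h := hf.sub (hg.mul (hf.div hg))
  convert h using 2 with v
  rw [Nat.mod_def]

end Elem

theorem ElemP.testBit {f g : (ℕ → ℕ) → ℕ} (hf : Elem f) (hg : Elem g) :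
    ElemP fun v => (f v).testBit (g v) = true :=
  (ElemP.eq ((hf.div ((Elem.const 2).pow hg)).mod (Elem.const 2)) (Elem.const 1)).congr fun v => by
    rw [Nat.testBit_eq_decide_div_mod_eq, decide_eq_true_iff]

end OrdinalFO

namespace OrdinalFO

/-! ### Parsing from right to left -/

/-- A variable or a formula. -/
inductive Item : Type
  | var (x : ℕ) : Item
  | form (φ : Formula) : Item

/-- The word of a variable or a formula. -/
def Item.word : Item → List Symb
  | var x => varWord x
  | form φ => φ.word

/-- The word of a list of items. -/
def itemsWord (l : List Item) : List Symb := l.flatMap Item.word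

@[simp] theorem itemsWord_nil : itemsWord [] = [] := rfl

@[simp] theorem itemsWord_cons (a : Item) (l : List Item) :
    itemsWord (a :: l) = a.word ++ itemsWord l := rfl

/-- The parser puts a letter in front of a number, which is written in binary, and a list of
items. -/
def parseStep : Symb → ℕ → List Item → Option (ℕ × List Item)
  -- Read from the right, a numeral starts with its most significant digit. The test rejects a
  -- leading zero, so that only canonical numerals are accepted.
  | .bit b, x, l => if 2 * x + b.toNat = 0 then none else some (2 * x + b.toNat, l)
  | .var, x, l => some (0, .var x :: l)
  | .add, 0, .var x :: .var y :: .var z :: l => some (0, .form (.add x y z) :: l)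
  | .memE, 0, .var x :: .var y :: l => some (0, .form (.memE x y) :: l)
  | .neg, 0, .form φ :: l => some (0, .form (.neg φ) :: l)
  | .conj, 0, .form φ :: .form ψ :: l => some (0, .form (.conj φ ψ) :: l)
  | .disj, 0, .form φ :: .form ψ :: l => some (0, .form (.disj φ ψ) :: l)
  | .impl, 0, .form φ :: .form ψ :: l => some (0, .form (.impl φ ψ) :: l)
  | .equi, 0, .form φ :: .form ψ :: l => some (0, .form (.equi φ ψ) :: l)
  | .ex, 0, .var x :: .form φ :: l => some (0, .form (.ex x φ) :: l)
  | _, _, _ => none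

/-- The result of parsing a word from right to left. -/
def parse : List Symb → Option (ℕ × List Item)
  | [] => some (0, [])
  | a :: w => (parse w).bind fun p => parseStep a p.1 p.2

theorem bits_step {x : ℕ} {b : Bool} (h : 2 * x + b.toNat ≠ 0) :
    (2 * x + b.toNat).bits = b :: x.bits := by
  have := Nat.bits_append_bit x b (fun hx => by
    subst hx
    cases b
    · simp at h
    · rfl)
  rwa [Nat.bit_val] at this

theorem parseStep_word {a : Symb} {x y : ℕ} {l l' : List Item}
    (h : parseStep a x l = some (y, l')) :
    y.bits.map Symb.bit ++ itemsWord l' = a :: (x.bits.map Symb.bit ++ itemsWord l) := by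
  unfold parseStep at h
  split at h
  · split_ifs at h with h0
    simp only [Option.some.injEq, Prod.mk.injEq] at h
    obtain ⟨rfl, rfl⟩ := h
    rw [bits_step h0]
    rfl
  all_goals simp only [reduceCtorEq, Option.some.injEq, Prod.mk.injEq] at h
  all_goals
    obtain ⟨rfl, rfl⟩ := h
    simp [Item.word, varWord, Formula.word]

/-- The invariant behind soundness: the state always spells the part of the word already read. -/
theorem word_of_parse {w : List Symb} {x : ℕ} {l : List Item} (h : parse w = some (x, l)) :
    w = x.bits.map Symb.bit ++ itemsWord l := by
  induction w generalizing x l with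
  | nil =>
    simp only [parse, Option.some.injEq, Prod.mk.injEq] at h
    obtain ⟨rfl, rfl⟩ := h
    rfl
  | cons a w ih =>
    simp only [parse, Option.bind_eq_some_iff] at h
    obtain ⟨⟨y, l'⟩, h1, h2⟩ := h
    rw [parseStep_word h2, ← ih h1]

theorem parse_bits {w : List Symb} {l : List Item} (h : parse w = some (0, l)) (x : ℕ) :
    parse (x.bits.map Symb.bit ++ w) = some (x, l) := by
  induction x using Nat.strong_induction_on with
  | _ x ih =>
    rcases Nat.eq_zero_or_pos x with rfl | hx
    · simpa using h
    · have e : x = 2 * (x / 2) + (decide (x % 2 = 1)).toNat := by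
        rcases Nat.mod_two_eq_zero_or_one x with h | h <;> simp [h] <;> omega
      have hb : x.bits = decide (x % 2 = 1) :: (x / 2).bits := by
        conv_lhs => rw [e]
        exact bits_step (by omega)
      rw [hb, List.map_cons, List.cons_append, parse, ih (x / 2) (by omega)]
      simp only [Option.bind_some, parseStep]
      rw [← e, if_neg hx.ne']

theorem parse_var {w : List Symb} {l : List Item} (h : parse w = some (0, l)) (x : ℕ) :
    parse (varWord x ++ w) = some (0, .var x :: l) := by
  rw [varWord, List.cons_append, parse, parse_bits h x]
  rfl

theorem parse_form {w : List Symb} {l : List Item} (h : parse w = some (0, l)) (φ : Formula) :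
    parse (φ.word ++ w) = some (0, .form φ :: l) := by
  induction φ generalizing w l with
  | add x y z =>
    simp only [Formula.word, List.cons_append, List.append_assoc, parse]
    rw [parse_var (parse_var (parse_var h z) y) x]
    rfl
  | memE x y =>
    simp only [Formula.word, List.cons_append, List.append_assoc, parse]
    rw [parse_var (parse_var h y) x]
    rfl
  | neg φ ih =>
    simp only [Formula.word, List.cons_append, parse]
    rw [ih h]
    rfl
  | conj φ ψ ih ih' | disj φ ψ ih ih' | impl φ ψ ih ih' | equi φ ψ ih ih' =>
    simp only [Formula.word, List.cons_append, List.append_assoc, parse]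
    rw [ih (ih' h)]
    rfl
  | ex x φ ih =>
    simp only [Formula.word, List.cons_append, List.append_assoc, parse]
    rw [parse_var (ih h) x]
    rfl

theorem parse_eq_form_iff (w : List Symb) (φ : Formula) :
    parse w = some (0, [.form φ]) ↔ φ.word = w := by
  constructor
  · intro h
    simpa [Item.word] using (word_of_parse h).symm
  · rintro rfl
    simpa using parse_form (w := []) (l := []) rfl φ

end OrdinalFO

namespace OrdinalFO

/-! ### Truth tables as numbers -/

open Classical in
/-- The number whose bits below `m` are given by `P`. -/
noncomputable def bitSum (m : ℕ) (P : ℕ → Prop) : ℕ :=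
  ∑ j ∈ Finset.range m, 2 ^ j * if P j then 1 else 0

theorem bitSum_lt (m : ℕ) (P : ℕ → Prop) : bitSum m P < 2 ^ m := by
  induction m with
  | zero => simp [bitSum]
  | succ m ih =>
    rw [bitSum, Finset.sum_range_succ, ← bitSum, pow_succ]
    split_ifs <;> omega

theorem testBit_bitSum (m : ℕ) (P : ℕ → Prop) (k : ℕ) :
    (bitSum m P).testBit k = true ↔ k < m ∧ P k := by
  induction m with
  | zero => simp [bitSum]
  | succ m ih =>
    have hlt := bitSum_lt m P
    have hlt' := bitSum_lt (m + 1) P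
    rcases lt_trichotomy k m with h | rfl | h
    · rw [bitSum, Finset.sum_range_succ, ← bitSum]
      split_ifs with hm
      · rw [mul_one, add_comm, Nat.testBit_two_pow_add_gt h, ih]
        simp [h, h.trans (Nat.lt_succ_self m)]
      · rw [mul_zero, add_zero, ih]
        simp [h, h.trans (Nat.lt_succ_self m)]
    · rw [bitSum, Finset.sum_range_succ, ← bitSum]
      have h0 := Nat.testBit_lt_two_pow hlt
      split_ifs with hm
      · rw [mul_one, add_comm, Nat.testBit_two_pow_add_eq, h0]
        simp [hm]
      · simp [h0, hm]
    · rw [Nat.testBit_lt_two_pow (hlt'.trans_le (Nat.pow_le_pow_right two_pos h))]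
      simp only [Bool.false_eq_true, false_iff]
      omega

/-- The number of digits of a code. -/
def sideLength (N B : ℕ) : ℕ := B * (N + 2)

/-- The number of codes. -/
def numCodes (i N B : ℕ) : ℕ := codeRadix (sideLength N B) i

/-- The number of assignments of codes to the variables below `2 ^ N`. -/
def numAsg (i N B : ℕ) : ℕ := numCodes i N B ^ 2 ^ N

/-- The number of bits of a table: one for every assignment and one for every variable. -/
def width (i N B : ℕ) : ℕ := numAsg i N B + 2 ^ N

/-- The code that the assignment `j` gives to the variable `x`. -/
def asg (i N B j x : ℕ) : ℕ := j / numCodes i N B ^ x % numCodes i N B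

theorem numCodes_pos (i N B : ℕ) : 0 < numCodes i N B := codeRadix_pos _ _

theorem asg_lt (i N B j x : ℕ) : asg i N B j x < numCodes i N B := Nat.mod_lt _ (numCodes_pos i N B)

/-- Every assignment of codes to finitely many variables is the digit sequence of some number, so
quantifying over assignments becomes a bounded numerical search. -/
theorem exists_digits {D : ℕ} (hD : 0 < D) (V : ℕ) (u : ℕ → ℕ) (hu : ∀ y, u y < D) :
    ∃ j < D ^ V, ∀ y < V, j / D ^ y % D = u y := by
  induction V generalizing u with
  | zero => exact ⟨0, by simp⟩
  | succ V ih =>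
    obtain ⟨j, hj, h⟩ := ih (fun y => u (y + 1)) fun y => hu _
    refine ⟨u 0 + D * j, ?_, fun y hy => ?_⟩
    · have := hu 0
      rw [pow_succ']
      calc u 0 + D * j < D + D * j := by omega
        _ = D * (j + 1) := by ring
        _ ≤ D * D ^ V := Nat.mul_le_mul_left _ hj
    · cases y with
      | zero => simp [Nat.mod_eq_of_lt (hu 0)]
      | succ y =>
        rw [pow_succ', ← Nat.div_div_eq_div_mul, Nat.add_mul_div_left _ _ hD,
          Nat.div_eq_of_lt (hu 0), zero_add]
        exact h y (by omega)

theorem asg_of_le {i N B j y : ℕ} (hj : j < numAsg i N B) (hy : 2 ^ N ≤ y) : asg i N B j y = 0 := by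
  rw [asg, Nat.div_eq_of_lt (hj.trans_le (Nat.pow_le_pow_right (numCodes_pos i N B) hy)),
    Nat.zero_mod]

/-- `F` is the table of the formula `φ`, the word of which is followed by `t` letters. -/
structure IsTable (i N B t : ℕ) (φ : Formula) (F : ℕ) : Prop where
  lt : F < 2 ^ width i N B
  vars : ∀ y ∈ φ.freeVars, y < 2 ^ N
  sat : ∀ j < numAsg i N B,
    F.testBit j = true ↔ φ.CSat i (sideLength N B) B N t (asg i N B j)
  free : ∀ y < 2 ^ N, F.testBit (numAsg i N B + y) = true ↔ y ∈ φ.freeVars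

/-- The bit of the new table for the assignment `j`. The letter is given by the digit `d`, the
items it applies to by `c₀`, `c₁`, `c₂`. -/
def TruthBit (i N B t d c₀ c₁ c₂ j : ℕ) : Prop :=
  (d = 4 ∧ CodeAdd (sideLength N B) i (asg i N B j (c₀ - 2)) (asg i N B j (c₁ - 2))
    (asg i N B j (c₂ - 2))) ∨
  (d = 5 ∧ CodeE (asg i N B j (c₀ - 2)) (asg i N B j (c₁ - 2))) ∨
  (d = 6 ∧ ¬ (c₀ - 2 - 2 ^ N).testBit j = true) ∨
  (d = 7 ∧ ((c₀ - 2 - 2 ^ N).testBit j = true ∧ (c₁ - 2 - 2 ^ N).testBit j = true)) ∨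
  (d = 8 ∧ ((c₀ - 2 - 2 ^ N).testBit j = true ∨ (c₁ - 2 - 2 ^ N).testBit j = true)) ∨
  (d = 9 ∧ ((c₀ - 2 - 2 ^ N).testBit j = true → (c₁ - 2 - 2 ^ N).testBit j = true)) ∨
  (d = 10 ∧ ((c₀ - 2 - 2 ^ N).testBit j = true ↔ (c₁ - 2 - 2 ^ N).testBit j = true)) ∨
  (d = 11 ∧ ∃ j' < numAsg i N B, (∀ y < 2 ^ N, y ≠ c₀ - 2 → asg i N B j' y = asg i N B j y) ∧
    InBox (sideLength N B) i (boxSize B N t) (asg i N B j' (c₀ - 2)) ∧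
    (c₁ - 2 - 2 ^ N).testBit j' = true)

/-- The bit of the new table for the free variable `y`. -/
def FreeBit (i N B d c₀ c₁ c₂ y : ℕ) : Prop :=
  (d = 4 ∧ (y = c₀ - 2 ∨ y = c₁ - 2 ∨ y = c₂ - 2)) ∨
  (d = 5 ∧ (y = c₀ - 2 ∨ y = c₁ - 2)) ∨
  (d = 6 ∧ (c₀ - 2 - 2 ^ N).testBit (numAsg i N B + y) = true) ∨
  ((7 ≤ d ∧ d ≤ 10) ∧ ((c₀ - 2 - 2 ^ N).testBit (numAsg i N B + y) = true ∨
    (c₁ - 2 - 2 ^ N).testBit (numAsg i N B + y) = true)) ∨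
  (d = 11 ∧ y ≠ c₀ - 2 ∧ (c₁ - 2 - 2 ^ N).testBit (numAsg i N B + y) = true)

/-- The new table. -/
noncomputable def table (i N B t d c₀ c₁ c₂ : ℕ) : ℕ :=
  bitSum (width i N B) fun j => (j < numAsg i N B ∧ TruthBit i N B t d c₀ c₁ c₂ j) ∨
    ∃ y < 2 ^ N, j = numAsg i N B + y ∧ FreeBit i N B d c₀ c₁ c₂ y

theorem isTable_table {i N B t t' d c₀ c₁ c₂ : ℕ} {φ : Formula} (hv : ∀ y ∈ φ.freeVars, y < 2 ^ N)
    (hs : ∀ j < numAsg i N B, TruthBit i N B t' d c₀ c₁ c₂ j ↔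
      φ.CSat i (sideLength N B) B N t (asg i N B j))
    (hf : ∀ y < 2 ^ N, FreeBit i N B d c₀ c₁ c₂ y ↔ y ∈ φ.freeVars) :
    IsTable i N B t φ (table i N B t' d c₀ c₁ c₂) where
  lt := bitSum_lt _ _
  vars := hv
  sat j hj := by
    rw [table, testBit_bitSum, ← hs j hj]
    constructor
    · rintro ⟨-, ⟨-, h⟩ | ⟨y, -, rfl, -⟩⟩
      · exact h
      · omega
    · exact fun h => ⟨hj.trans_le (Nat.le_add_right _ _), Or.inl ⟨hj, h⟩⟩
  free y hy := by
    rw [table, testBit_bitSum, ← hf y hy]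
    constructor
    · rintro ⟨-, ⟨h, -⟩ | ⟨y', -, h, h'⟩⟩
      · omega
      · rwa [show y = y' by omega]
    · exact fun h => ⟨by rw [width]; omega, Or.inr ⟨y, hy, rfl, h⟩⟩

section tables

variable {i N B t t' c₁ c₂ : ℕ}

theorem isTable_add {x y z : ℕ} (hx : x < 2 ^ N) (hy : y < 2 ^ N) (hz : z < 2 ^ N) :
    IsTable i N B t (.add x y z) (table i N B t' 4 (2 + x) (2 + y) (2 + z)) := by
  refine isTable_table ?_ ?_ ?_ <;>
    simp [Formula.freeVars, TruthBit, FreeBit, Formula.CSat, hx, hy, hz]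

theorem isTable_memE {x y : ℕ} (hx : x < 2 ^ N) (hy : y < 2 ^ N) :
    IsTable i N B t (.memE x y) (table i N B t' 5 (2 + x) (2 + y) c₂) := by
  refine isTable_table ?_ ?_ ?_ <;>
    simp [Formula.freeVars, TruthBit, FreeBit, Formula.CSat, hx, hy]

theorem sub_sub_aux (N F : ℕ) : 2 + 2 ^ N + F - 2 - 2 ^ N = F := by omega

theorem isTable_neg {φ : Formula} {F : ℕ} (h : IsTable i N B t φ F) :
    IsTable i N B t (.neg φ) (table i N B t' 6 (2 + 2 ^ N + F) c₁ c₂) := by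
  refine isTable_table h.vars (fun j hj => ?_) (fun y hy => ?_)
  · simp only [TruthBit, sub_sub_aux, Formula.CSat, ← h.sat j hj]
    simp
  · simp only [FreeBit, sub_sub_aux, Formula.freeVars, ← h.free y hy]
    simp

theorem isTable_binary {φ ψ χ : Formula} {F G d : ℕ} (h : IsTable i N B (t + ψ.word.length) φ F)
    (h' : IsTable i N B t ψ G) (hχ : (d = 7 ∧ χ = .conj φ ψ) ∨ (d = 8 ∧ χ = .disj φ ψ) ∨
      (d = 9 ∧ χ = .impl φ ψ) ∨ (d = 10 ∧ χ = .equi φ ψ)) :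
    IsTable i N B t χ (table i N B t' d (2 + 2 ^ N + F) (2 + 2 ^ N + G) c₂) := by
  have hfree : χ.freeVars = φ.freeVars ∪ ψ.freeVars := by
    rcases hχ with ⟨-, rfl⟩ | ⟨-, rfl⟩ | ⟨-, rfl⟩ | ⟨-, rfl⟩ <;> rfl
  refine isTable_table ?_ (fun j hj => ?_) (fun y hy => ?_)
  · rw [hfree]
    rintro y (hy | hy)
    · exact h.vars y hy
    · exact h'.vars y hy
  · simp only [TruthBit, sub_sub_aux, h.sat j hj, h'.sat j hj]
    rcases hχ with ⟨rfl, rfl⟩ | ⟨rfl, rfl⟩ | ⟨rfl, rfl⟩ | ⟨rfl, rfl⟩ <;> simp [Formula.CSat]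
  · simp only [FreeBit, sub_sub_aux, h.free y hy, h'.free y hy, hfree]
    rcases hχ with ⟨rfl, -⟩ | ⟨rfl, -⟩ | ⟨rfl, -⟩ | ⟨rfl, -⟩ <;> simp

/-- Changing the value of `x` leads to another numbered assignment `j'`. Its values below `2 ^ N`
determine it completely, as all other variables have the value 0; hence comparing finitely many
variables suffices. -/
theorem isTable_ex {φ : Formula} {x F : ℕ} (hx : x < 2 ^ N)
    (h : IsTable i N B t φ F) (ht : t' = t + φ.word.length + (varWord x).length) :
    IsTable i N B t (.ex x φ) (table i N B t' 11 (2 + x) (2 + 2 ^ N + F) c₂) := by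
  refine isTable_table (fun y hy => h.vars y hy.1) (fun j hj => ?_) (fun y hy => ?_)
  · have key : ∀ j' < numAsg i N B, ∀ a, (∀ y < 2 ^ N, asg i N B j' y =
        Function.update (asg i N B j) x a y) →
        asg i N B j' = Function.update (asg i N B j) x a := by
      intro j' hj' a h
      funext y
      rcases lt_or_ge y (2 ^ N) with hy | hy
      · exact h y hy
      · rw [Function.update_of_ne (by omega), asg_of_le hj' hy, asg_of_le hj hy]
    have h11 : TruthBit i N B t' 11 (2 + x) (2 + 2 ^ N + F) c₂ j ↔ ∃ j' < numAsg i N B,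
        (∀ y < 2 ^ N, y ≠ x → asg i N B j' y = asg i N B j y) ∧
        InBox (sideLength N B) i (boxSize B N t') (asg i N B j' x) ∧
        F.testBit j' = true := by
      simp only [TruthBit, sub_sub_aux, Nat.add_sub_cancel_left]
      simp
    rw [h11]
    simp only [Formula.CSat, ← ht]
    constructor
    · rintro ⟨j', hj', h1, h2, h3⟩
      refine ⟨_, h2, ?_⟩
      rw [← key j' hj' (asg i N B j' x) fun y hy => ?_]
      · exact (h.sat j' hj').1 h3
      · by_cases hyx : y = x
        · subst hyx; simp
        · simp [hyx, h1 y hy hyx]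
    · rintro ⟨a, h2, h3⟩
      have ha : a < numCodes i N B := h2.lt (by
        rw [boxSize, sideLength]
        exact Nat.mul_le_mul_left _ (by omega))
      obtain ⟨j', hj', hd⟩ := exists_digits (numCodes_pos i N B) (2 ^ N)
        (Function.update (asg i N B j) x a) fun y => by
          by_cases hyx : y = x
          · subst hyx; simpa
          · simpa [hyx] using asg_lt i N B j y
      have hj'' := key j' hj' a hd
      refine ⟨j', hj', fun y hy hyx => ?_, ?_, ?_⟩
      · rw [hj'', Function.update_of_ne hyx]
      · rw [hj'', Function.update_self]
        exact h2
      · rw [h.sat j' hj', hj'']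
        exact h3
  · simp only [FreeBit, sub_sub_aux, Nat.add_sub_cancel_left, h.free y hy, Formula.freeVars]
    simp [and_comm]

end tables

end OrdinalFO

namespace OrdinalFO

/-! ### The parser on numbers -/

theorem Symb.digit_bit (b : Bool) : (Symb.bit b).digit = 2 + b.toNat := by
  cases b <;> rfl

theorem Symb.digit_pos (a : Symb) : 0 < a.digit := by
  rcases a with _ | (_ | _) | _ | _ | _ | _ | _ | _ | _ | _ <;> decide

/-- The base in which a list of items is coded. -/
def stackBase (i N B : ℕ) : ℕ := 2 + 2 ^ N + 2 ^ width i N B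

/-- `c` codes a variable. -/
def IsVarCode (N c : ℕ) : Prop := 2 ≤ c ∧ c < 2 + 2 ^ N

/-- `c` codes a formula. -/
def IsFormCode (N c : ℕ) : Prop := 2 + 2 ^ N ≤ c

/-- The letter given by the digit `d` can be put in front of the items with codes `c₀`, `c₁`,
`c₂`. -/
def Applicable (N d c₀ c₁ c₂ : ℕ) : Prop :=
  (d = 4 ∧ IsVarCode N c₀ ∧ IsVarCode N c₁ ∧ IsVarCode N c₂) ∨
  (d = 5 ∧ IsVarCode N c₀ ∧ IsVarCode N c₁) ∨
  (d = 6 ∧ IsFormCode N c₀) ∨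
  ((7 ≤ d ∧ d ≤ 10) ∧ IsFormCode N c₀ ∧ IsFormCode N c₁) ∨
  (d = 11 ∧ IsVarCode N c₀ ∧ IsFormCode N c₁)

/-- The number of items to which the letter given by the digit `d` applies. -/
def arity (d : ℕ) : ℕ := if d = 4 then 3 else if d = 6 then 1 else 2

open Classical in
/-- The step of the parser with number `x` and list of items `S`. -/
noncomputable def stackStep (i N B t d x S : ℕ) : ℕ :=
  -- The state is `x + stackBase i N B * S`. The digit 1 is the letter `var`, which turns the
  -- pending number into an item and resets it to 0; the digits 2 and 3 are bits; the result 0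
  -- signals failure.
  if d = 1 then stackBase i N B * (2 + x + stackBase i N B * S)
  else if d ≤ 3 then
    if 2 * x + (d - 2) = 0 then 0 else 2 * x + (d - 2) + stackBase i N B * S
  else if x = 0 ∧ Applicable N d (S % stackBase i N B) (S / stackBase i N B % stackBase i N B)
      (S / stackBase i N B / stackBase i N B % stackBase i N B) then
    stackBase i N B * (2 + 2 ^ N + table i N B t d (S % stackBase i N B)
      (S / stackBase i N B % stackBase i N B)
      (S / stackBase i N B / stackBase i N B % stackBase i N B) +
      stackBase i N B * (S / stackBase i N B ^ arity d))
  else 0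

/-- The step of the parser at the letter given by the digit `d`. -/
noncomputable def parserStep (i N B t d a : ℕ) : ℕ :=
  if d = 0 then a else if a = 0 then 0
  else stackStep i N B t d (a % stackBase i N B) (a / stackBase i N B)

/-- The parser on the word that is coded by `N`. -/
noncomputable def parser (i N B : ℕ) (n : ℕ) : ℕ :=
  Nat.rec (stackBase i N B) (fun t a => parserStep i N B t (N / 12 ^ t % 12) a) n

/-- The number `S` codes the list of items `l`. -/
def StackRel (i N B : ℕ) : ℕ → List Item → Prop
  | S, [] => S = 1
  | S, .var x :: l => ∃ S', S = 2 + x + stackBase i N B * S' ∧ x < 2 ^ N ∧ StackRel i N B S' l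
  | S, .form φ :: l => ∃ F S', S = 2 + 2 ^ N + F + stackBase i N B * S' ∧
      IsTable i N B (itemsWord l).length φ F ∧ StackRel i N B S' l

/-- The number `a` codes the state `p` of the parser. -/
def ParserRel (i N B a : ℕ) : Option (ℕ × List Item) → Prop
  | none => a = 0
  | some p => p.1 < 2 ^ N ∧ ∃ S, a = p.1 + stackBase i N B * S ∧ StackRel i N B S p.2

section parser

variable {i N B t : ℕ}

theorem add_base_mul_mod {c S : ℕ} (hc : c < stackBase i N B) :
    (c + stackBase i N B * S) % stackBase i N B = c := by
  rw [Nat.add_mul_mod_self_left, Nat.mod_eq_of_lt hc]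

theorem add_base_mul_div {c S : ℕ} (hc : c < stackBase i N B) :
    (c + stackBase i N B * S) / stackBase i N B = S := by
  rw [Nat.add_mul_div_left _ _ (by omega), Nat.div_eq_of_lt hc, zero_add]

theorem two_lt_base : 2 + 2 ^ N < stackBase i N B := by
  have := Nat.two_pow_pos (width i N B)
  rw [stackBase]; omega

theorem var_lt_base {x : ℕ} (hx : x < 2 ^ N) : 2 + x < stackBase i N B :=
  (Nat.add_lt_add_left hx 2).trans two_lt_base

theorem number_lt_base {x : ℕ} (hx : x < 2 ^ N) : x < stackBase i N B :=
  lt_of_le_of_lt (Nat.le_add_left x 2) (var_lt_base hx)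

theorem one_lt_base : 1 < stackBase i N B :=
  lt_of_le_of_lt (by omega) (var_lt_base (Nat.two_pow_pos N))

theorem form_lt_base {F : ℕ} (hF : F < 2 ^ width i N B) : 2 + 2 ^ N + F < stackBase i N B := by
  rw [stackBase]; omega

theorem StackRel.pos {S : ℕ} {l : List Item} (h : StackRel i N B S l) : 0 < S := by
  rcases l with _ | ⟨x | φ, l⟩
  · exact h ▸ one_pos
  · obtain ⟨S', rfl, -⟩ := h; omega
  · obtain ⟨F, S', rfl, -⟩ := h; positivity

/-- The lowest digit reveals the kind of the topmost item, the ranges being disjoint: 1 is the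
bottom of the stack, variables start at 2 and tables at `2 + 2 ^ N`. -/
theorem StackRel.var_inv {S : ℕ} {l : List Item} (h : StackRel i N B S l)
    (hc : IsVarCode N (S % stackBase i N B)) : ∃ x l', l = .var x :: l' ∧ x < 2 ^ N ∧
      S % stackBase i N B = 2 + x ∧ StackRel i N B (S / stackBase i N B) l' := by
  rcases l with _ | ⟨x | φ, l⟩
  · obtain rfl : S = 1 := h
    rw [Nat.mod_eq_of_lt one_lt_base] at hc
    exact absurd hc.1 (by omega)
  · obtain ⟨S', rfl, hx, h'⟩ := h
    rw [add_base_mul_mod (var_lt_base hx), add_base_mul_div (var_lt_base hx)]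
    exact ⟨x, l, rfl, hx, rfl, h'⟩
  · obtain ⟨F, S', rfl, hF, h'⟩ := h
    rw [add_base_mul_mod (form_lt_base hF.lt)] at hc
    exact absurd hc.2 (by omega)

theorem StackRel.form_inv {S : ℕ} {l : List Item} (h : StackRel i N B S l)
    (hc : IsFormCode N (S % stackBase i N B)) : ∃ φ l' F, l = .form φ :: l' ∧
      IsTable i N B (itemsWord l').length φ F ∧ S % stackBase i N B = 2 + 2 ^ N + F ∧
      StackRel i N B (S / stackBase i N B) l' := by
  rcases l with _ | ⟨x | φ, l⟩
  · obtain rfl : S = 1 := h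
    rw [Nat.mod_eq_of_lt one_lt_base] at hc
    exact absurd ((Nat.le_add_right _ _).trans hc) (by norm_num)
  · obtain ⟨S', rfl, hx, h'⟩ := h
    rw [add_base_mul_mod (var_lt_base hx)] at hc
    exact absurd (show 2 + 2 ^ N ≤ 2 + x from hc) (by omega)
  · obtain ⟨F, S', rfl, hF, h'⟩ := h
    rw [add_base_mul_mod (form_lt_base hF.lt), add_base_mul_div (form_lt_base hF.lt)]
    exact ⟨φ, l, F, rfl, hF, rfl, h'⟩

theorem StackRel.var {S x : ℕ} {l : List Item} (h : StackRel i N B S (.var x :: l)) :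
    IsVarCode N (S % stackBase i N B) ∧ StackRel i N B (S / stackBase i N B) l := by
  obtain ⟨S', rfl, hx, h'⟩ := h
  rw [add_base_mul_mod (var_lt_base hx), add_base_mul_div (var_lt_base hx)]
  exact ⟨⟨by omega, by omega⟩, h'⟩

theorem StackRel.form {S : ℕ} {φ : Formula} {l : List Item}
    (h : StackRel i N B S (.form φ :: l)) :
    IsFormCode N (S % stackBase i N B) ∧ StackRel i N B (S / stackBase i N B) l := by
  obtain ⟨F, S', rfl, hF, h'⟩ := h
  rw [add_base_mul_mod (form_lt_base hF.lt), add_base_mul_div (form_lt_base hF.lt)]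
  exact ⟨Nat.le_add_right _ _, h'⟩

theorem lt_of_parse {w : List Symb} {x : ℕ} {l : List Item} (h : parse w = some (x, l))
    (hw : w.length ≤ N) : x < 2 ^ N := by
  have h1 := congrArg List.length (word_of_parse h)
  rw [List.length_append, List.length_map, Nat.size_eq_bits_len] at h1
  exact (Nat.lt_size_self x).trans_le (Nat.pow_le_pow_right two_pos (by omega))

/-- The letters that apply to items. -/
theorem parserRel_letter {a : Symb} (ha : 4 ≤ a.digit) {x S : ℕ} {l : List Item}
    (hS : StackRel i N B S l) (ht : x = 0 → t = (itemsWord l).length) :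
    ParserRel i N B (stackStep i N B t a.digit x S) (parseStep a x l) := by
  rw [stackStep, if_neg (by omega), if_neg (by omega)]
  split_ifs with h
  · obtain ⟨rfl, h⟩ := h
    replace ht := ht rfl
    rcases h with ⟨hd, h0, h1, h2⟩ | ⟨hd, h0, h1⟩ | ⟨hd, h0⟩ | ⟨hd, h0, h1⟩ | ⟨hd, h0, h1⟩
    · obtain ⟨y₀, l, rfl, hy₀, e₀, h⟩ := hS.var_inv h0
      obtain ⟨y₁, l, rfl, hy₁, e₁, h⟩ := h.var_inv h1
      obtain ⟨y₂, l, rfl, hy₂, e₂, h⟩ := h.var_inv h2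
      obtain rfl : a = .add := Symb.digit_injective hd
      refine ⟨by simp, _, (zero_add _).symm, _, _, rfl, ?_, ?_⟩
      · rw [e₀, e₁, e₂]
        exact isTable_add hy₀ hy₁ hy₂
      · simpa [arity, Symb.digit, pow_succ, Nat.div_div_eq_div_mul] using h
    · obtain ⟨y₀, l, rfl, hy₀, e₀, h⟩ := hS.var_inv h0
      obtain ⟨y₁, l, rfl, hy₁, e₁, h⟩ := h.var_inv h1
      obtain rfl : a = .memE := Symb.digit_injective hd
      refine ⟨by simp, _, (zero_add _).symm, _, _, rfl, ?_, ?_⟩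
      · rw [e₀, e₁]
        exact isTable_memE hy₀ hy₁
      · simpa [arity, Symb.digit, pow_succ, Nat.div_div_eq_div_mul] using h
    · obtain ⟨φ, l, F, rfl, hF, e₀, h⟩ := hS.form_inv h0
      obtain rfl : a = .neg := Symb.digit_injective hd
      refine ⟨by simp, _, (zero_add _).symm, _, _, rfl, ?_, ?_⟩
      · rw [e₀]
        exact isTable_neg hF
      · simpa [arity, Symb.digit] using h
    · obtain ⟨φ, l, F, rfl, hF, e₀, h⟩ := hS.form_inv h0
      obtain ⟨ψ, l, G, rfl, hG, e₁, h⟩ := h.form_inv h1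
      have hF' : IsTable i N B ((itemsWord l).length + ψ.word.length) φ F := by
        simpa [Item.word, add_comm] using hF
      obtain rfl | rfl | rfl | rfl : a = .conj ∨ a = .disj ∨ a = .impl ∨ a = .equi := by
        obtain h | h | h | h : a.digit = 7 ∨ a.digit = 8 ∨ a.digit = 9 ∨ a.digit = 10 := by omega
        · exact Or.inl (Symb.digit_injective h)
        · exact Or.inr (Or.inl (Symb.digit_injective h))
        · exact Or.inr (Or.inr (Or.inl (Symb.digit_injective h)))
        · exact Or.inr (Or.inr (Or.inr (Symb.digit_injective h)))
      all_goals
        refine ⟨by simp, _, (zero_add _).symm, _, _, rfl, ?_, ?_⟩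
        · rw [e₀, e₁]
          exact isTable_binary hF' hG (by simp [Symb.digit])
        · simpa [arity, Symb.digit, pow_succ, Nat.div_div_eq_div_mul] using h
    · obtain ⟨y₀, l, rfl, hy₀, e₀, h⟩ := hS.var_inv h0
      obtain ⟨φ, l, F, rfl, hF, e₁, h⟩ := h.form_inv h1
      obtain rfl : a = .ex := Symb.digit_injective hd
      refine ⟨by simp, _, (zero_add _).symm, _, _, rfl, ?_, ?_⟩
      · rw [e₀, e₁]
        exact isTable_ex hy₀ hF (by rw [ht]; simp [Item.word]; omega)
      · simpa [arity, Symb.digit, pow_succ, Nat.div_div_eq_div_mul] using h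
  · suffices h' : parseStep a x l = none by rw [h']; rfl
    by_contra hne
    refine h ?_
    unfold parseStep at hne
    split at hne
    · rw [Symb.digit_bit] at ha
      have := Bool.toNat_lt ‹Bool›
      omega
    · simp [Symb.digit] at ha
    all_goals first
      | exact absurd rfl hne
      | refine ⟨rfl, ?_⟩
    · simp [Applicable, Symb.digit, hS.var, hS.var.2.var, hS.var.2.var.2.var]
    · simp [Applicable, Symb.digit, hS.var, hS.var.2.var]
    · simp [Applicable, Symb.digit, hS.form]
    · simp [Applicable, Symb.digit, hS.form, hS.form.2.form]
    · simp [Applicable, Symb.digit, hS.form, hS.form.2.form]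
    · simp [Applicable, Symb.digit, hS.form, hS.form.2.form]
    · simp [Applicable, Symb.digit, hS.form, hS.form.2.form]
    · simp [Applicable, Symb.digit, hS.var, hS.var.2.form]

theorem parserRel_cons {a : Symb} {w : List Symb} (hw : (a :: w).length ≤ N) {s : ℕ}
    (h : ParserRel i N B s (parse w)) :
    ParserRel i N B (parserStep i N B w.length a.digit s) (parse (a :: w)) := by
  have hd := a.digit_pos.ne'
  rw [parserStep, if_neg hd]
  cases hp : parse w with
  | none =>
    rw [hp] at h
    rw [if_pos (show s = 0 from h), parse, hp]
    rfl
  | some p =>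
    obtain ⟨x, l⟩ := p
    have hpar : parse (a :: w) = parseStep a x l := by rw [parse, hp]; rfl
    rw [hp] at h
    obtain ⟨hx, S, rfl, hS⟩ := h
    have hx' : x < stackBase i N B := number_lt_base hx
    rw [if_neg (by
      have := Nat.mul_pos (show 0 < stackBase i N B by omega) hS.pos
      omega), add_base_mul_mod hx', add_base_mul_div hx', hpar]
    rcases Nat.lt_or_ge a.digit 4 with ha | ha
    · rw [stackStep]
      rcases a with _ | b | _ | _ | _ | _ | _ | _ | _ | _
      case var =>
        rw [if_pos (by rfl)]
        exact ⟨by simp, _, (zero_add _).symm, S, rfl, hx, hS⟩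
      case bit =>
        have hb := Bool.toNat_lt b
        rw [Symb.digit_bit, if_neg (by omega), if_pos (by omega), Nat.add_sub_cancel_left]
        rw [parseStep] at hpar ⊢
        split_ifs with h0
        · rfl
        · rw [if_neg h0] at hpar
          exact ⟨lt_of_parse hpar hw, S, rfl, hS⟩
      all_goals simp [Symb.digit] at ha
    · refine parserRel_letter ha hS ?_
      rintro rfl
      conv_lhs => rw [word_of_parse hp]
      simp

end parser

/-! ### Words as numbers, and correctness of the numerical parser -/

/-- The number coding a word. -/
def wordNum (n : ℕ) (w : List Symb) : ℕ := w.foldl (fun n a => 12 * n + a.digit) n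

theorem wordNum_append (n : ℕ) (v w : List Symb) : wordNum n (v ++ w) = wordNum (wordNum n v) w :=
  List.foldl_append

theorem wordNum_eq (n : ℕ) (w : List Symb) : wordNum n w = wordNum 0 w + 12 ^ w.length * n := by
  induction w generalizing n with
  | nil => simp [wordNum]
  | cons a w ih =>
    change wordNum (12 * n + a.digit) w = wordNum (12 * 0 + a.digit) w + _
    rw [ih, ih (12 * 0 + a.digit), List.length_cons, pow_succ]
    ring

theorem wordNum_lt (w : List Symb) : wordNum 0 w < 12 ^ w.length := by
  induction w with
  | nil => simp [wordNum]
  | cons a w ih =>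
    change wordNum (12 * 0 + a.digit) w < _
    rw [wordNum_eq, List.length_cons, pow_succ]
    have := a.digit_lt
    nlinarith

/-- No letter has the digit 0. Hence the code of a word bounds its length and can replace it as the
parameter `N` and as the number of rounds of the parser. -/
theorem add_length_le_wordNum (n : ℕ) (w : List Symb) : n + w.length ≤ wordNum n w := by
  induction w generalizing n with
  | nil => rfl
  | cons a w ih =>
    refine le_trans ?_ (ih (12 * n + a.digit))
    have hd := a.digit_pos
    rw [List.length_cons]
    omega

theorem wordNum_digit (v : List Symb) (a : Symb) (w : List Symb) :
    wordNum 0 (v ++ a :: w) / 12 ^ w.length % 12 = a.digit := by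
  rw [wordNum_append]
  change wordNum (12 * wordNum 0 v + a.digit) w / _ % _ = _
  rw [wordNum_eq, Nat.add_mul_div_left _ _ (by positivity), Nat.div_eq_of_lt (wordNum_lt w),
    zero_add, Nat.mul_add_mod, Nat.mod_eq_of_lt a.digit_lt]

theorem parserRel_parser (i B : ℕ) (v w : List Symb) :
    ParserRel i (wordNum 0 (v ++ w)) B (parser i (wordNum 0 (v ++ w)) B w.length) (parse w) := by
  induction w generalizing v with
  | nil => exact ⟨by simp, 1, by simp [parser], rfl⟩
  | cons a w ih =>
    have h := ih (v ++ [a])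
    rw [List.append_assoc, List.singleton_append] at h
    have h' := parserRel_cons (a := a) (by
      refine le_trans ?_ (add_length_le_wordNum 0 (v ++ a :: w))
      simp) h
    rwa [← wordNum_digit v a w] at h'

/-- Beyond the word all digits are 0, on which the parser idles, so the length itself need not be
known. -/
theorem parser_of_le (i B : ℕ) (w : List Symb) {n : ℕ} (hn : w.length ≤ n) :
    parser i (wordNum 0 w) B n = parser i (wordNum 0 w) B w.length := by
  induction n, hn using Nat.le_induction with
  | base => rfl
  | succ n hn ih =>
    rw [← ih]
    change parserStep i _ B n (wordNum 0 w / 12 ^ n % 12) (parser i (wordNum 0 w) B n) = _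
    rw [parserStep, if_pos]
    rw [Nat.div_eq_of_lt ((wordNum_lt w).trans_le (Nat.pow_le_pow_right (by norm_num) hn)),
      Nat.zero_mod]

/-- The state `a` of the parser consists of the code of a true sentence. -/
def Accepts (i N B a : ℕ) : Prop :=
  a % stackBase i N B = 0 ∧ IsFormCode N (a / stackBase i N B % stackBase i N B) ∧
  a / stackBase i N B / stackBase i N B = 1 ∧
  (∀ y < 2 ^ N, ¬ (a / stackBase i N B % stackBase i N B - 2 - 2 ^ N).testBit
    (numAsg i N B + y) = true) ∧
  (a / stackBase i N B % stackBase i N B - 2 - 2 ^ N).testBit 0 = true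

/-- The stack has to consist of a single table. Its second block shows that there are no free
variables, and the assignment number 0, which is the zero valuation, then gives the truth value. -/
theorem accepts_iff {i N B a : ℕ} {w : List Symb} (h : ParserRel i N B a (parse w)) :
    Accepts i N B a ↔ ∃ φ : Formula, φ.IsSentence ∧
      φ.CSat i (sideLength N B) B N 0 (fun _ => 0) ∧ φ.word = w := by
  have hpos : 2 < stackBase i N B := lt_of_le_of_lt (Nat.le_add_right _ _) two_lt_base
  have h0 : asg i N B 0 = fun _ => 0 := funext fun x => by simp [asg]
  have hA : 0 < numAsg i N B := Nat.pow_pos (numCodes_pos _ _ _)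
  have key : ∀ {φ F}, IsTable i N B 0 φ F → ((∀ y < 2 ^ N,
      ¬ F.testBit (numAsg i N B + y) = true) ↔ φ.IsSentence) := by
    intro φ F hF
    constructor
    · refine fun h => Set.eq_empty_of_forall_notMem fun y hy => ?_
      exact h y (hF.vars y hy) ((hF.free y (hF.vars y hy)).2 hy)
    · intro h y hy hy'
      have := (hF.free y hy).1 hy'
      rw [show φ.freeVars = ∅ from h] at this
      exact this
  constructor
  · rintro ⟨h1, h2, h3, h4, h5⟩
    cases hp : parse w with
    | none =>
      rw [hp] at h
      obtain rfl : a = 0 := h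
      simp at h3
    | some p =>
      obtain ⟨x, l⟩ := p
      rw [hp] at h
      obtain ⟨hx, S, rfl, hS⟩ := h
      have hx' : x < stackBase i N B := number_lt_base hx
      rw [add_base_mul_mod hx'] at h1
      rw [add_base_mul_div hx'] at h2 h3 h4 h5
      obtain ⟨φ, l, F, rfl, hF, e, hS⟩ := hS.form_inv h2
      rw [e, sub_sub_aux] at h4 h5
      rw [h3] at hS
      obtain rfl : l = [] := by
        rcases l with _ | ⟨x | φ, l⟩
        · rfl
        · obtain ⟨S', h, -⟩ := hS; omega
        · obtain ⟨F, S', h, -⟩ := hS; omega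
      refine ⟨φ, (key hF).1 h4, ?_,
        (parse_eq_form_iff w φ).1 (by rw [hp]; simp [show x = 0 from h1])⟩
      rw [← h0]
      exact (hF.sat 0 hA).1 h5
  · rintro ⟨φ, h1, h2, h3⟩
    rw [(parse_eq_form_iff w φ).2 h3] at h
    obtain ⟨-, S, rfl, F, S', rfl, hF, rfl⟩ := h
    rw [Accepts, add_base_mul_mod (by omega), add_base_mul_div (by omega),
      add_base_mul_mod (form_lt_base hF.lt), add_base_mul_div (form_lt_base hF.lt), sub_sub_aux]
    refine ⟨rfl, Nat.le_add_right _ _, rfl, (key hF).2 h1, (hF.sat 0 hA).2 ?_⟩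
    rwa [h0]

/-- The code of the word `w` is accepted exactly if `w` is a true sentence. -/
theorem accepts_parser_iff (i : ℕ) (w : List Symb) :
    Accepts i (wordNum 0 w) (tower w.length 5)
      (parser i (wordNum 0 w) (tower w.length 5) (wordNum 0 w)) ↔
      w ∈ theoryFO ((2 : Ordinal.{0}) ^ (Ordinal.omega0.{0} ^ (i : Ordinal.{0}))) := by
  have hle : w.length ≤ wordNum 0 w := by simpa using add_length_le_wordNum 0 w
  have h := parserRel_parser i (tower w.length 5) [] w
  rw [List.nil_append] at h
  rw [parser_of_le i _ w hle, accepts_iff h]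
  refine exists_congr fun φ => and_congr_right fun hs => ?_
  constructor
  · rintro ⟨hc, rfl⟩
    exact ⟨(Formula.sat_iff_cSat (tower_pos (by norm_num) _) rfl hle le_rfl hs).2 hc, rfl⟩
  · rintro ⟨hc, rfl⟩
    exact ⟨(Formula.sat_iff_cSat (tower_pos (by norm_num) _) rfl hle le_rfl hs).1 hc, rfl⟩

end OrdinalFO

namespace OrdinalFO

/-! ### The decision procedure is elementary -/

section elementary

variable {f L N B t d x y z r S c₀ c₁ c₂ j : (ℕ → ℕ) → ℕ}

theorem Elem.codeRadix (hL : Elem L) (j : ℕ) : Elem fun v => codeRadix (L v) j :=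
  (Elem.const 2).pow (hL.pow (Elem.const j))

theorem ElemP.codeE (hx : Elem x) (hy : Elem y) : ElemP fun v => CodeE (x v) (y v) :=
  (exists_lt (P := fun v p => x v = 2 ^ p ∧ (y v).testBit p = true) hy
    ((eq hx.tail ((Elem.const 2).pow (Elem.var 0))).and (testBit hy.tail (Elem.var 0)))).congr
    fun v => by
      refine exists_congr fun p => and_iff_right_of_imp fun h => ?_
      by_contra hlt
      rw [Nat.testBit_lt_two_pow ((not_lt.1 hlt).trans_lt Nat.lt_two_pow_self)] at h
      simp at h

theorem ElemP.inBox (hL : Elem L) (hr : Elem r) (hx : Elem x) (j : ℕ) :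
    ElemP fun v => InBox (L v) j (r v) (x v) := by
  induction j generalizing L r x with
  | zero => exact lt hx (Elem.const 2)
  | succ j ih =>
    exact (lt hx ((hL.codeRadix j).pow hr)).and (forall_lt
      (P := fun v k => InBox (L v) j (r v) (x v / OrdinalFO.codeRadix (L v) j ^ k %
        OrdinalFO.codeRadix (L v) j)) hr (ih hL.tail hr.tail
      ((hx.tail.div ((hL.tail.codeRadix j).pow (Elem.var 0))).mod (hL.tail.codeRadix j))))

/-- Powers of a base greater than 1 exceed their exponents, which bounds `b` and makes the search
elementary. The base 1, which occurs for `L = 0`, is contradictory unless `b = 0`. -/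
theorem CodeAdd.succ_succ_iff {L x y z j : ℕ} : CodeAdd L (j + 2) x y z ↔
    ∃ b < y + 1, y < codeRadix L (j + 1) ^ (b + 1) ∧ (b = 0 ∨ codeRadix L (j + 1) ^ b ≤ y) ∧
      x / codeRadix L (j + 1) ^ (b + 1) = z / codeRadix L (j + 1) ^ (b + 1) ∧
      y % codeRadix L (j + 1) ^ b = z % codeRadix L (j + 1) ^ b ∧
      CodeAdd L (j + 1) (x / codeRadix L (j + 1) ^ b % codeRadix L (j + 1))
        (y / codeRadix L (j + 1) ^ b % codeRadix L (j + 1))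
        (z / codeRadix L (j + 1) ^ b % codeRadix L (j + 1)) := by
  refine exists_congr fun b => ⟨fun h => ⟨?_, h⟩, fun h => h.2⟩
  rcases h.2.1 with rfl | h'
  · exact Nat.succ_pos _
  · rcases (show 1 ≤ codeRadix L (j + 1) from codeRadix_pos _ _).eq_or_lt with h1 | h1
    · have h2 := h.1
      rw [← h1, one_pow] at h2 h'
      omega
    · exact Nat.lt_succ_of_le ((Nat.lt_pow_self h1).le.trans h')

theorem ElemP.codeAdd (hL : Elem L) (hx : Elem x) (hy : Elem y) (hz : Elem z)
    (j : ℕ) : ElemP fun v => CodeAdd (L v) j (x v) (y v) (z v) := by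
  induction j generalizing L x y z with
  | zero => exact eq (hx.add hy) hz
  | succ j ih =>
    cases j with
    | zero => exact eq (hx.add hy) hz
    | succ j =>
      have hM := hL.tail.codeRadix (j + 1)
      have hb : Elem fun v => v 0 := Elem.var 0
      have hdig : ∀ {f : (ℕ → ℕ) → ℕ}, Elem f → Elem fun v =>
          f (OrdinalFO.tail v) / OrdinalFO.codeRadix (L (OrdinalFO.tail v)) (j + 1) ^ v 0 %
            OrdinalFO.codeRadix (L (OrdinalFO.tail v)) (j + 1) :=
        fun hf => (hf.tail.div (hM.pow hb)).mod hM
      refine ElemP.congr ?_ fun v => CodeAdd.succ_succ_iff.symm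
      exact exists_lt hy.succ <| (lt hy.tail (hM.pow hb.succ)).and <|
        ((eq hb (Elem.const 0)).or (le (hM.pow hb) hy.tail)).and <|
        (eq (hx.tail.div (hM.pow hb.succ)) (hz.tail.div (hM.pow hb.succ))).and <|
        (eq (hy.tail.mod (hM.pow hb)) (hz.tail.mod (hM.pow hb))).and <|
        ih hL.tail (hdig hx) (hdig hy) (hdig hz)

variable (i : ℕ)

theorem Elem.sideLength (hN : Elem N) (hB : Elem B) : Elem fun v => sideLength (N v) (B v) :=
  hB.mul (hN.add (const 2))

theorem Elem.numCodes (hN : Elem N) (hB : Elem B) : Elem fun v => numCodes i (N v) (B v) :=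
  (hN.sideLength hB).codeRadix i

theorem Elem.two_pow (hN : Elem N) : Elem fun v => 2 ^ N v := (const 2).pow hN

theorem Elem.numAsg (hN : Elem N) (hB : Elem B) : Elem fun v => numAsg i (N v) (B v) :=
  (hN.numCodes i hB).pow hN.two_pow

theorem Elem.width (hN : Elem N) (hB : Elem B) : Elem fun v => width i (N v) (B v) :=
  (hN.numAsg i hB).add hN.two_pow

theorem Elem.asg (hN : Elem N) (hB : Elem B) (hj : Elem j) (hx : Elem x) :
    Elem fun v => asg i (N v) (B v) (j v) (x v) :=
  (hj.div ((hN.numCodes i hB).pow hx)).mod (hN.numCodes i hB)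

theorem Elem.stackBase (hN : Elem N) (hB : Elem B) : Elem fun v => stackBase i (N v) (B v) :=
  ((const 2).add hN.two_pow).add (hN.width i hB).two_pow

theorem ElemP.truthBit (hN : Elem N) (hB : Elem B) (ht : Elem t) (hd : Elem d) (h₀ : Elem c₀)
    (h₁ : Elem c₁) (h₂ : Elem c₂) (hj : Elem j) : ElemP fun v =>
    TruthBit i (N v) (B v) (t v) (d v) (c₀ v) (c₁ v) (c₂ v) (j v) := by
  have hd' (n : ℕ) : ElemP fun v => d v = n := eq hd (Elem.const n)
  have hv {c : (ℕ → ℕ) → ℕ} (hc : Elem c) :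
      Elem fun v => OrdinalFO.asg i (N v) (B v) (j v) (c v - 2) :=
    hN.asg i hB hj (hc.sub (Elem.const 2))
  have hb {c : (ℕ → ℕ) → ℕ} (hc : Elem c) :
      ElemP fun v => (c v - 2 - 2 ^ N v).testBit (j v) = true :=
    testBit ((hc.sub (Elem.const 2)).sub hN.two_pow) hj
  refine ((hd' 4).and ?_).or <| ((hd' 5).and ?_).or <| ((hd' 6).and ?_).or <|
    ((hd' 7).and ?_).or <| ((hd' 8).and ?_).or <| ((hd' 9).and ?_).or <|
    ((hd' 10).and ?_).or <| (hd' 11).and ?_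
  · exact codeAdd (hN.sideLength hB) (hv h₀) (hv h₁) (hv h₂) i
  · exact codeE (hv h₀) (hv h₁)
  · exact (hb h₀).not
  · exact (hb h₀).and (hb h₁)
  · exact (hb h₀).or (hb h₁)
  · exact (hb h₀).imp (hb h₁)
  · exact (hb h₀).iff (hb h₁)
  · have h0 : Elem fun v => v 0 := Elem.var 0
    refine exists_lt (P := fun v j' => (∀ y < 2 ^ N v, y ≠ c₀ v - 2 →
        OrdinalFO.asg i (N v) (B v) j' y = OrdinalFO.asg i (N v) (B v) (j v) y) ∧
        InBox (OrdinalFO.sideLength (N v) (B v)) i (boxSize (B v) (N v) (t v))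
          (OrdinalFO.asg i (N v) (B v) j' (c₀ v - 2)) ∧
        (c₁ v - 2 - 2 ^ N v).testBit j' = true) (hN.numAsg i hB) ?_
    refine (forall_lt (P := fun v y => y ≠ c₀ (OrdinalFO.tail v) - 2 →
      OrdinalFO.asg i (N (OrdinalFO.tail v)) (B (OrdinalFO.tail v)) (v 0) y =
      OrdinalFO.asg i (N (OrdinalFO.tail v)) (B (OrdinalFO.tail v)) (j (OrdinalFO.tail v)) y)
      hN.tail.two_pow ?_).and <| ElemP.and ?_ ?_
    · exact (eq h0 (h₀.tail.tail.sub (Elem.const 2))).not.imp <|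
        eq (hN.tail.tail.asg i hB.tail.tail (Elem.var 1) h0)
          (hN.tail.tail.asg i hB.tail.tail hj.tail.tail h0)
    · exact inBox (hN.tail.sideLength hB.tail)
        (hB.tail.mul (hN.tail.succ.sub ht.tail))
        (hN.tail.asg i hB.tail h0 (h₀.tail.sub (Elem.const 2))) i
    · exact testBit ((h₁.tail.sub (Elem.const 2)).sub hN.tail.two_pow) h0

theorem ElemP.freeBit (hN : Elem N) (hB : Elem B) (hd : Elem d) (h₀ : Elem c₀)
    (h₁ : Elem c₁) (h₂ : Elem c₂) (hy : Elem y) : ElemP fun v =>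
    FreeBit i (N v) (B v) (d v) (c₀ v) (c₁ v) (c₂ v) (y v) := by
  have hd' (n : ℕ) : ElemP fun v => d v = n := eq hd (Elem.const n)
  have he {c : (ℕ → ℕ) → ℕ} (hc : Elem c) : ElemP fun v => y v = c v - 2 :=
    eq hy (hc.sub (Elem.const 2))
  have hb {c : (ℕ → ℕ) → ℕ} (hc : Elem c) :
      ElemP fun v => (c v - 2 - 2 ^ N v).testBit (OrdinalFO.numAsg i (N v) (B v) + y v) = true :=
    testBit ((hc.sub (Elem.const 2)).sub hN.two_pow) ((hN.numAsg i hB).add hy)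
  exact ((hd' 4).and ((he h₀).or ((he h₁).or (he h₂)))).or <|
    ((hd' 5).and ((he h₀).or (he h₁))).or <| ((hd' 6).and (hb h₀)).or <|
    (((le (Elem.const 7) hd).and (le hd (Elem.const 10))).and ((hb h₀).or (hb h₁))).or <|
    (hd' 11).and ((he h₀).not.and (hb h₁))

theorem Elem.table (hN : Elem N) (hB : Elem B) (ht : Elem t) (hd : Elem d) (h₀ : Elem c₀)
    (h₁ : Elem c₁) (h₂ : Elem c₂) :
    Elem fun v => table i (N v) (B v) (t v) (d v) (c₀ v) (c₁ v) (c₂ v) := by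
  have h0 : Elem fun v => v 0 := var 0
  refine sum (hN.width i hB)
    (h0.two_pow.mul (@ElemP.indicator _ (fun _ => Classical.propDecidable _) ?_))
  refine ((ElemP.lt h0 (hN.tail.numAsg i hB.tail)).and
    (ElemP.truthBit i hN.tail hB.tail ht.tail hd.tail h₀.tail h₁.tail h₂.tail h0)).or ?_
  exact ElemP.exists_lt hN.tail.two_pow <|
    (ElemP.eq (var 1) ((hN.tail.tail.numAsg i hB.tail.tail).add h0)).and <|
    ElemP.freeBit i hN.tail.tail hB.tail.tail hd.tail.tail h₀.tail.tail h₁.tail.tail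
      h₂.tail.tail h0

theorem ElemP.applicable (hN : Elem N) (hd : Elem d) (h₀ : Elem c₀) (h₁ : Elem c₁) (h₂ : Elem c₂) :
    ElemP fun v => Applicable (N v) (d v) (c₀ v) (c₁ v) (c₂ v) := by
  have hd' (n : ℕ) : ElemP fun v => d v = n := eq hd (Elem.const n)
  have hb : Elem fun v => 2 + 2 ^ N v := (Elem.const 2).add hN.two_pow
  have hv {c : (ℕ → ℕ) → ℕ} (hc : Elem c) : ElemP fun v => IsVarCode (N v) (c v) :=
    (le (Elem.const 2) hc).and (lt hc hb)
  have hf {c : (ℕ → ℕ) → ℕ} (hc : Elem c) : ElemP fun v => IsFormCode (N v) (c v) := le hb hc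
  exact ((hd' 4).and ((hv h₀).and ((hv h₁).and (hv h₂)))).or <|
    ((hd' 5).and ((hv h₀).and (hv h₁))).or <| ((hd' 6).and (hf h₀)).or <|
    (((le (Elem.const 7) hd).and (le hd (Elem.const 10))).and ((hf h₀).and (hf h₁))).or <|
    (hd' 11).and ((hv h₀).and (hf h₁))

theorem Elem.stackStep (hN : Elem N) (hB : Elem B) (ht : Elem t) (hd : Elem d) (hx : Elem x)
    (hS : Elem S) : Elem fun v => stackStep i (N v) (B v) (t v) (d v) (x v) (S v) := by
  classical
  have hD := hN.stackBase i hB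
  have hd' (n : ℕ) : ElemP fun v => d v = n := ElemP.eq hd (const n)
  have h₀ := hS.mod hD
  have h₁ := (hS.div hD).mod hD
  have h₂ := ((hS.div hD).div hD).mod hD
  have h2 := ((const 2).mul hx).add (hd.sub (const 2))
  unfold OrdinalFO.stackStep
  refine (hd' 1).ite (hD.mul (((const 2).add hx).add (hD.mul hS))) <|
    (ElemP.le hd (const 3)).ite ((ElemP.eq h2 (const 0)).ite (const 0) (h2.add (hD.mul hS))) <|
    ((ElemP.eq hx (const 0)).and (ElemP.applicable hN hd h₀ h₁ h₂)).ite
      (hD.mul ((((const 2).add hN.two_pow).add (hN.table i hB ht hd h₀ h₁ h₂)).add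
        (hD.mul (hS.div (hD.pow ?_))))) (const 0)
  exact (hd' 4).ite (const 3) ((hd' 6).ite (const 1) (const 2))

theorem Elem.parserStep (hN : Elem N) (hB : Elem B) (ht : Elem t) (hd : Elem d) (hx : Elem x) :
    Elem fun v => parserStep i (N v) (B v) (t v) (d v) (x v) :=
  (ElemP.eq hd (const 0)).ite hx <| (ElemP.eq hx (const 0)).ite (const 0) <|
    hN.stackStep i hB ht hd (hx.mod (hN.stackBase i hB)) (hx.div (hN.stackBase i hB))

/-- A single step enlarges the state by a bounded number of base factors only. Iterated in
`parser_le`, this yields the a priori bound that limited recursion demands. -/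
theorem parserStep_le (N B t d a : ℕ) :
    parserStep i N B t d a ≤ stackBase i N B * (stackBase i N B + a) := by
  have hD : 2 ≤ stackBase i N B := one_lt_base
  have ha := Nat.mod_add_div a (stackBase i N B)
  rw [parserStep]
  split_ifs
  · exact (Nat.le_add_left _ _).trans (Nat.le_mul_of_pos_left _ (by omega))
  · exact Nat.zero_le _
  rw [stackStep]
  split_ifs with h1 h2 h3 h4
  · refine Nat.mul_le_mul_left _ ?_
    omega
  · exact Nat.zero_le _
  · refine le_trans ?_ (Nat.mul_le_mul_right _ hD)
    omega
  · refine Nat.mul_le_mul_left _ (Nat.add_le_add (form_lt_base (bitSum_lt _ _)).le ?_)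
    refine le_trans (Nat.mul_le_mul_left _ (Nat.div_le_self _ _)) ?_
    omega
  · exact Nat.zero_le _

theorem parser_le (N B n : ℕ) : parser i N B n ≤ stackBase i N B ^ (2 * n + 1) := by
  induction n with
  | zero => simp [parser]
  | succ n ih =>
    refine (parserStep_le i N B n _ _).trans ?_
    rw [show 2 * (n + 1) + 1 = 1 + (1 + (2 * n + 1)) by ring, pow_add, pow_one, pow_add, pow_one]
    refine Nat.mul_le_mul_left _ ?_
    have h1 : 1 < stackBase i N B := one_lt_base
    have h2 := Nat.le_self_pow (show 2 * n + 1 ≠ 0 by omega) (stackBase i N B)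
    change parser i N B n ≤ _ at ih
    change _ + parser i N B n ≤ _
    nlinarith

theorem Elem.parser : Elem fun v => parser i (v 0) (v 1) (v 0) := by
  refine iter (b := fun v t a => OrdinalFO.parserStep i (v 0) (v 1) t (v 0 / 12 ^ t % 12) a)
    (h := fun v => OrdinalFO.stackBase i (v 0) (v 1) ^ (2 * v 0 + 1)) (var 0)
    ((var 0).stackBase i (var 1)) ?_
    (((var 0).stackBase i (var 1)).pow (((const 2).mul (var 0)).succ)).towerBounded ?_
  · exact (var 2).parserStep i (var 3) (var 0)
      (((var 2).div ((const 12).pow (var 0))).mod (const 12)) (var 1)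
  · exact fun v k hk => (parser_le i (v 0) (v 1) k).trans
      (Nat.pow_le_pow_right (one_pos.trans one_lt_base) (by omega))

theorem ElemP.accepts_parser :
    ElemP fun v => Accepts i (v 0) (v 1) (parser i (v 0) (v 1) (v 0)) := by
  have hD : Elem fun v => OrdinalFO.stackBase i (v 0) (v 1) := (Elem.var 0).stackBase i (Elem.var 1)
  have hS := (Elem.parser i).div hD
  have hF := ((hS.mod hD).sub (Elem.const 2)).sub (Elem.var 0).two_pow
  refine (eq ((Elem.parser i).mod hD) (Elem.const 0)).and <|
    (le ((Elem.const 2).add (Elem.var 0).two_pow) (hS.mod hD)).and <|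
    (eq (hS.div hD) (Elem.const 1)).and <| ElemP.and ?_ (testBit hF (Elem.const 0))
  exact forall_lt (Elem.var 0).two_pow
    (testBit hF.tail (((Elem.var 1).numAsg i (Elem.var 2)).add (Elem.var 0))).not

end elementary
end OrdinalFO

namespace OrdinalFO

/-! ### The machine -/

/-- The store with the values `N` and `B` in the counters `0` and `1`. -/
def store (N B : ℕ) : ℕ → ℕ := scons N (scons B fun _ => 0)

theorem store_update_zero (N B n : ℕ) : Function.update (store N B) 0 n = store n B := by
  funext x
  rcases x with _ | x <;> simp [store, scons]

theorem store_update_one (N B n : ℕ) : Function.update (store N B) 1 n = store N n := by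
  funext x
  rcases x with _ | _ | x <;> simp [store, scons]

theorem store_of_two_le (N B : ℕ) {r : ℕ} (hr : 2 ≤ r) : store N B r = 0 := by
  rcases r with _ | _ | r
  · omega
  · omega
  · rfl

/-- The environment in which expressions are evaluated on `store N B`. -/
theorem envLE_store {N B M : ℕ} (hN : N ≤ M) (hB : B ≤ M) :
    EnvLE (fun x => store N B (min x 1)) M := by
  rintro (_ | x)
  · exact hN
  · dsimp only
    rwa [show min (x + 1) 1 = 1 by omega]

namespace Cmd

/-- Replace the value of the counter `r` by that of an expression. -/
def assign (e : Expr) (r : ℕ) : Cmd :=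
  seq (e.comp (fun x => min x 1) 2) (seq (clear r) (move 2 r))

theorem takes_assign (e : Expr) {r : ℕ} (hr : r < 2) (N B : ℕ) : Takes (assign e r) (store N B)
    (Function.update (store N B) r (e.eval fun x => store N B (min x 1)))
    (3 * (e.cost fun x => store N B (min x 1)) + 2 * (N + B) + 2) := by
  have h := (e.takes_comp (ρ := fun x => min x 1) (m := 2) (s := store N B)
    (fun x => by omega) (fun r hr => store_of_two_le N B hr)).seq
    ((takes_clear r _).seq (takes_move (show 2 ≠ r by omega) _))
  refine h.congr ?_ ?_
  · funext x
    by_cases h1 : x = r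
    · subst h1
      simp [show 2 ≠ x by omega]
    · by_cases h2 : x = 2
      · subst h2
        simp [h1, store_of_two_le]
      · simp [h1, h2]
  · have hsr : store N B r ≤ N + B := by
      interval_cases r
      · exact Nat.le_add_right _ _
      · exact Nat.le_add_left _ _
    have he := e.eval_le_cost fun x => store N B (min x 1)
    simp only [Function.update_self, Function.update_of_ne (show r ≠ 2 by omega),
      Function.update_of_ne (show 2 ≠ r by omega)]
    omega

theorem exists_takes_assign {f : (ℕ → ℕ) → ℕ} (hf : Elem f) {r : ℕ} (hr : r < 2) :
    ∃ c k, ∀ N B M, N ≤ M → B ≤ M → Takes c (store N B)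
      (Function.update (store N B) r (f fun x => store N B (min x 1))) (tower k M) := by
  obtain ⟨e, he, hc⟩ := hf
  obtain ⟨k, hk⟩ := (((TowerBounded.const 3).mul hc).add ((TowerBounded.const 2).mul
    ((TowerBounded.var 0).add (TowerBounded.var 1)))).add (TowerBounded.const 2)
  refine ⟨assign e r, k, fun N B M hN hB => ?_⟩
  rw [← he]
  exact (takes_assign e hr N B).mono (hk M _ (envLE_store hN hB))

/-- The program that processes a letter. -/
theorem exists_takes_letter : ∃ (b : Symb → Cmd) (k : ℕ), ∀ a N B M, 12 * N + a.digit ≤ M →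
    B ≤ M → Takes (b a) (store N B) (store (12 * N + a.digit) (2 ^ B)) (tower k M) := by
  classical
  choose b₀ k₀ h₀ using fun a : Symb => exists_takes_assign (r := 0)
    (((Elem.const 12).mul (Elem.var 0)).add (Elem.const a.digit)) two_pos
  obtain ⟨b₁, k₁, h₁⟩ := exists_takes_assign (r := 1) (Elem.two_pow (Elem.var 1)) one_lt_two
  -- The alphabet is finite, so one height serves all letters.
  obtain ⟨k, hk⟩ : TowerBounded (fun M n => M ≤ n) fun M =>
      tower (Finset.univ.sup k₀) M + tower k₁ M :=
    TowerBounded.add ⟨_, fun M n h => tower_mono_right _ h⟩ ⟨_, fun M n h => tower_mono_right _ h⟩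
  refine ⟨fun a => seq (b₀ a) b₁, k, fun a N B M hN hB => ?_⟩
  have h2 := h₀ a N B M (by omega) hB
  rw [store_update_zero] at h2
  have h3 := h₁ (12 * N + a.digit) B M hN hB
  rw [store_update_one] at h3
  exact (h2.seq h3).mono ((Nat.add_le_add_right (tower_mono_left M
    (Finset.le_sup (f := k₀) (Finset.mem_univ a))) _).trans (hk M M le_rfl))

/-- Each letter read applies one exponential to the counter `1`, so the tower acquires the length of
the word as its height without that length being computed. All intermediate values are bounded by
the final ones, hence by `M`. -/
theorem exists_run_read {b : Symb → Cmd} {k : ℕ} (hb : ∀ a N B M, 12 * N + a.digit ≤ M →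
    B ≤ M → Takes (b a) (store N B) (store (12 * N + a.digit) (2 ^ B)) (tower k M))
    (w : List Symb) {N B M : ℕ} (hN : wordNum N w ≤ M) (hB : tower w.length B ≤ M) :
    ∃ t ≤ 1 + w.length * (1 + tower k M),
      Run (read b) w (store N B) [] (store (wordNum N w) (tower w.length B)) t := by
  induction w generalizing N B with
  | nil => exact ⟨1, by simp, Run.read_nil⟩
  | cons a w ih =>
    rw [List.length_cons, tower_add] at hB ⊢
    have hN' : 12 * N + a.digit ≤ M :=
      le_trans (le_trans (Nat.le_add_right _ _) (add_length_le_wordNum _ w)) hN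
    have hB' : B ≤ M := le_trans (le_trans (le_tower 1 B) (le_tower _ _)) hB
    obtain ⟨t, ht, h1⟩ := hb a N B M hN' hB' w
    obtain ⟨t', ht', h2⟩ := ih (N := 12 * N + a.digit) hN hB
    exact ⟨1 + t + t', by rw [add_mul]; omega, h1.read_cons h2⟩

end Cmd

theorem TowerBounded.tower {ι : Type} {β : ι → ℕ → Prop} {f : ι → ℕ} (hf : TowerBounded β f)
    (k : ℕ) : TowerBounded β fun i => tower k (f i) := by
  obtain ⟨l, hl⟩ := hf
  exact ⟨k + l, fun M i hi => (tower_mono_right k (hl M i hi)).trans_eq (tower_add k l M).symm⟩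

open Cmd in
/-- A set of words that is elementary in the code of the word and a tower of exponentials of height
its length is decidable in time a tower of exponentials of height its length. -/
theorem exists_decidableInTimeO {p : (ℕ → ℕ) → Prop} (hp : ElemP p) {A : Set (List Symb)}
    (hA : ∀ w, p (fun x => store (wordNum 0 w) (tower w.length 5) (min x 1)) ↔ w ∈ A) :
    ∃ c, DecidableInTimeO A fun n => tower n c := by
  classical
  obtain ⟨b, k, hb⟩ := exists_takes_letter
  obtain ⟨b', k', hb'⟩ := exists_takes_assign hp two_pos
  -- A common bound for the code of a word of length `n` and for the tower built while reading it.
  let M : ℕ → ℕ := fun n => 12 ^ n + tower n 5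
  let T : ℕ → ℕ := fun n => 5 + (1 + n * (1 + tower k (M n)) + (tower k' (M n) + (2 * M n + 1)))
  have hβ : TowerBounded (fun n m => tower n 5 ≤ m) fun n : ℕ => n :=
    ⟨0, fun m n h => (self_le_tower n 5).trans h⟩
  have hM : TowerBounded (fun n m => tower n 5 ≤ m) M :=
    ((TowerBounded.const 12).pow hβ).add ⟨0, fun m n h => h⟩
  have hT : TowerBounded (fun n m => tower n 5 ≤ m) fun n => T n + 1 :=
    ((TowerBounded.const 5).add (((TowerBounded.const 1).add (hβ.mul ((TowerBounded.const 1).add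
      (hM.tower k)))).add ((hM.tower k').add (((TowerBounded.const 2).mul hM).add
      (TowerBounded.const 1))))).add (TowerBounded.const 1)
  obtain ⟨l, hl⟩ := hT
  -- The time is at most `tower l (tower n 5)`, and heights of towers add up commutatively, so this
  -- equals `tower n (tower l 5)`.
  refine ⟨tower l 5, Cmd.decidableInTimeO (f := fun w => decide (w ∈ A)) (T := T)
    (c := seq (seq (inc 1) (seq (inc 1) (seq (inc 1) (seq (inc 1) (inc 1)))))
      -- The five increments before reading put the base 5 of the tower into the counter `1`; the
      -- final `clear` leaves only the answer in the counter `0`.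
      (seq (read b) (seq b' (clear 1)))) (fun w => decide_eq_true_iff) (fun w => ?_) fun n => ?_⟩
  · have hz : (fun _ => 0) = store 0 0 := by
      funext x
      rcases x with _ | _ | x <;> rfl
    have hinc (B : ℕ) : Takes (inc 1) (store 0 B) (store 0 (B + 1)) 1 := by
      have := takes_inc 1 (store 0 B)
      rwa [store_update_one] at this
    have hN : wordNum 0 w ≤ M w.length := (wordNum_lt w).le.trans (Nat.le_add_right _ _)
    have hB : tower w.length 5 ≤ M w.length := Nat.le_add_left _ _
    obtain ⟨t₀, ht₀, h₀⟩ :=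
      ((hinc 0).seq ((hinc 1).seq ((hinc 2).seq ((hinc 3).seq (hinc 4))))) w
    obtain ⟨t₁, ht₁, h₁⟩ := exists_run_read hb w hN hB
    have h₂ := hb' _ _ _ hN hB
    rw [store_update_zero] at h₂
    have h₃ := takes_clear 1 (store (if p fun x => store (wordNum 0 w) (tower w.length 5) (min x 1)
      then 1 else 0) (tower w.length 5))
    rw [store_update_one] at h₃
    obtain ⟨t₂, ht₂, h₄⟩ := (h₂.seq (h₃.mono (T' := 2 * M w.length + 1) (by
      change 2 * tower w.length 5 + 1 ≤ _; omega))) []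
    refine ⟨t₀ + (t₁ + t₂), by simp only [T]; omega, ?_⟩
    rw [hz, store_update_zero]
    refine h₀.seq (h₁.seq ?_)
    convert h₄ using 2
    rw [← hA w]
    split_ifs with h <;> simp [h]
  · refine (hl _ n le_rfl).trans_eq ?_
    rw [← tower_add, ← tower_add, add_comm]

end OrdinalFO

theorem mainTheorem5 (i : ℕ) :
    ∃ c : ℕ, OrdinalFO.DecidableInTimeO
      (OrdinalFO.theoryFO ((2 : Ordinal.{0}) ^ (Ordinal.omega0.{0} ^ (i : Ordinal.{0}))))
      (fun n => OrdinalFO.tower n c) :=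
  OrdinalFO.exists_decidableInTimeO (OrdinalFO.ElemP.accepts_parser i)
    (OrdinalFO.accepts_parser_iff i)
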